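/- Throughout, graphs are finite, simple and undirected. A graph is *chordal* if it has no induced cycle of length more than three. A *minimal triangulation* of a graph $G=(V,E)$ is a chordal graph $H=(V,E\cup F)$ such that $(V,E\cup F')$ is not chordal for every $F'\subsetneq F$. A set $\Omega\subseteq V$ is a *potential maximal clique* of $G$ if it is an inclusion-maximal clique of some minimal triangulation of $G$. Given an integer $k\ge 0$, a potential maximal clique $\Omega$ is *vital* if $G[\Omega]$ has at least $|\Omega|(|\Omega|-1)/2-k$ edges; let $\Pi_k$ be the set of all vital potential maximal cliques of $G$. The pair $(G,k)$ is a *YES instance* of Minimum Fill-in if there is a set $F$ of at most $k$ pairs of distinct vertices of $G$ such that $(V,E\cup F)$ is chordal. **Lemma.** There is an algorithm that, given a graph $G$ with $n$ vertices and $m$ edges, an integer $k\ge 0$ and the set $\Pi_k$ of all vital potential maximal cliques of $G$, decides in time $\mathcal{O}(nm|\Pi_k|)$ whether $(G,k)$ is a YES instance of Minimum Fill-in. Here an algorithm is a program for a unit-cost word RAM (registers and finitely many arrays, initially zero except for the input; addition, truncated subtraction, multiplication, indirect array access, conditionals and loops), whose words have $\mathcal{O}(\log(n+k+|\Pi_k|+2))$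 bits. The input consists of the numbers $n,m,k,|\Pi_k|$, the adjacency lists of $G$ on the vertices $0,\dots,n-1$, and the list of the members of $\Pi_k$, each given as a list of vertices (all lists in arbitrary order without repetition). The time bound means at most $c\,(nm|\Pi_k|+1)$ steps for one absolute constant $c$. -/

import Mathlib

/-! ### Chordal graphs, minimal triangulations and potential maximal cliques -/

namespace MinFill

/-- A graph is chordal if it contains no induced cycle of length more than three. -/
def IsChordal {V : Type*} (G : SimpleGraph V) : Prop :=
  ∀ l : ℕ, 4 ≤ l → ¬ (SimpleGraph.cycleGraph l).IsIndContained G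

/-- `H` is a minimal triangulation of `G`: a chordal supergraph of `G` on the same vertex set
that is inclusion-minimal with this property. -/
def IsMinimalTriangulation {V : Type*} (G H : SimpleGraph V) : Prop :=
  G ≤ H ∧ IsChordal H ∧ ∀ H' : SimpleGraph V, G ≤ H' → H' < H → ¬ IsChordal H'

/-- `Ω` is a potential maximal clique of `G`: an inclusion-maximal clique of some minimal
triangulation of `G`. -/
def IsPotentialMaximalClique {V : Type*} (G : SimpleGraph V) (Ω : Finset V) : Prop :=
  ∃ H : SimpleGraph V, IsMinimalTriangulation G H ∧ Maximal H.IsClique (Ω : Set V)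

/-- A potential maximal clique `Ω` is vital (with respect to `k`) if `G[Ω]` has at least
`|Ω| (|Ω| - 1) / 2 - k` edges. -/
def IsVital {V : Type*} (G : SimpleGraph V) (k : ℕ) (Ω : Finset V) : Prop :=
  IsPotentialMaximalClique G Ω ∧
    Ω.card.choose 2 ≤ (G.induce (Ω : Set V)).edgeSet.ncard + k

/-- The set of all vital potential maximal cliques of the instance `(G, k)`. -/
def vitalPMCs {V : Type*} (G : SimpleGraph V) (k : ℕ) : Set (Finset V) :=
  {Ω | IsVital G k Ω}

/-- `(G, k)` is a YES instance of Minimum Fill-in: `G` becomes chordal after adding some set `F`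
of at most `k` pairs of distinct vertices as edges. -/
def IsYesInstance {V : Type*} (G : SimpleGraph V) (k : ℕ) : Prop :=
  ∃ F : Finset (Sym2 V), (∀ e ∈ F, ¬ e.IsDiag) ∧ F.card ≤ k ∧
    IsChordal (G ⊔ SimpleGraph.fromEdgeSet (F : Set (Sym2 V)))

/-! ### A word RAM with unit-cost instructions

The machine has registers `0, 1, 2, …` and arrays `0, 1, 2, …`, each array with cells
`0, 1, 2, …`; registers and cells hold natural numbers below a word bound `W`. A program is a
fixed finite text, which names registers and arrays by literals only, so that each program uses
finitely many registers and arrays. -/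

/-- The contents of the registers and of the arrays: `mem a i` is cell `i` of array `a`. -/
structure State where
  reg : ℕ → ℕ
  mem : ℕ → ℕ → ℕ

/-- Expressions: literals, registers, array cells (with a computed index), sum, truncated
difference and product. -/
inductive Expr where
  | lit (a : ℕ)
  | reg (r : ℕ)
  | load (a : ℕ) (i : Expr)
  | add (e f : Expr)
  | sub (e f : Expr)
  | mul (e f : Expr)

namespace Expr

/-- The value of an expression. -/
def eval (s : State) : Expr → ℕ
  | lit a => a
  | reg r => s.reg r
  | load a i => s.mem a (i.eval s)
  | add e f => e.eval s + f.eval s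
  | sub e f => e.eval s - f.eval s
  | mul e f => e.eval s * f.eval s

/-- The time for evaluating an expression: one step for each symbol. -/
def cost : Expr → ℕ
  | lit _ => 1
  | reg _ => 1
  | load _ i => i.cost + 1
  | add e f => e.cost + f.cost + 1
  | sub e f => e.cost + f.cost + 1
  | mul e f => e.cost + f.cost + 1

/-- All values that occur in the evaluation of the expression, including the indices of array
cells, are below the word bound `W`. -/
def Fits (W : ℕ) (s : State) : Expr → Prop
  | lit a => a < W
  | reg r => s.reg r < W
  | load a i => i.Fits W s ∧ s.mem a (i.eval s) < W
  | add e f => e.Fits W s ∧ f.Fits W s ∧ e.eval s + f.eval s < W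
  | sub e f => e.Fits W s ∧ f.Fits W s
  | mul e f => e.Fits W s ∧ f.Fits W s ∧ e.eval s * f.eval s < W

end Expr

/-- Programs: assignment to a register, assignment to an array cell, sequential composition,
conditional and loop. A test succeeds if its expression has a nonzero value. -/
inductive Program where
  | skip
  | set (r : ℕ) (e : Expr)
  | store (a : ℕ) (i e : Expr)
  | seq (p q : Program)
  | ite (e : Expr) (p q : Program)
  | loop (e : Expr) (p : Program)

/-- `Exec W p s t s'`: with word bound `W`, the program `p` started in state `s` halts after
exactly `t` steps in state `s'`. A computation that meets a value which is not below `W` has no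
execution. -/
inductive Exec (W : ℕ) : Program → State → ℕ → State → Prop
  | skip (s : State) : Exec W Program.skip s 1 s
  | set (s : State) (r : ℕ) (e : Expr) (he : e.Fits W s) :
      Exec W (Program.set r e) s (e.cost + 1)
        ⟨Function.update s.reg r (e.eval s), s.mem⟩
  | store (s : State) (a : ℕ) (i e : Expr) (hi : i.Fits W s) (he : e.Fits W s) :
      Exec W (Program.store a i e) s (i.cost + e.cost + 1)
        ⟨s.reg, Function.update s.mem a
          (Function.update (s.mem a) (i.eval s) (e.eval s))⟩
  | seq (s₁ s₂ s₃ : State) (t₁ t₂ : ℕ) (p q : Program)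
      (hp : Exec W p s₁ t₁ s₂) (hq : Exec W q s₂ t₂ s₃) :
      Exec W (Program.seq p q) s₁ (t₁ + t₂) s₃
  | ite_true (s s' : State) (t : ℕ) (e : Expr) (p q : Program) (he : e.Fits W s)
      (h : e.eval s ≠ 0) (hp : Exec W p s t s') :
      Exec W (Program.ite e p q) s (e.cost + 1 + t) s'
  | ite_false (s s' : State) (t : ℕ) (e : Expr) (p q : Program) (he : e.Fits W s)
      (h : e.eval s = 0) (hq : Exec W q s t s') :
      Exec W (Program.ite e p q) s (e.cost + 1 + t) s'
  | loop_false (s : State) (e : Expr) (p : Program) (he : e.Fits W s) (h : e.eval s = 0) :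
      Exec W (Program.loop e p) s (e.cost + 1) s
  | loop_true (s₁ s₂ s₃ : State) (t₁ t₂ : ℕ) (e : Expr) (p : Program) (he : e.Fits W s₁)
      (h : e.eval s₁ ≠ 0) (hp : Exec W p s₁ t₁ s₂) (hl : Exec W (Program.loop e p) s₂ t₂ s₃) :
      Exec W (Program.loop e p) s₁ (e.cost + 1 + t₁ + t₂) s₃

/-- The initial state on an input word: array `0` holds the input, everything else is zero. -/
def initState (w : List ℕ) : State where
  reg := fun _ => 0
  mem := fun a i => if a = 0 then w.getD i 0 else 0

/-! ### Encoding of the input -/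

/-- A list of vertices, preceded by its length. -/
def encodeList {n : ℕ} (l : List (Fin n)) : List ℕ :=
  l.length :: l.map (fun v => (v : ℕ))

/-- `w` is an encoding of the graph `G` on the vertices `0, …, n - 1`, the number `k` and the
family `F` of vertex sets: the four numbers `n`, `m` (the number of edges), `k`, `|F|`, then the
adjacency list of each vertex, then one list of vertices for each member of `F`. The order within
every list, and the order in which the members of `F` are listed, is arbitrary; nothing is
listed twice. -/
def Encodes {n : ℕ} (G : SimpleGraph (Fin n)) (k : ℕ) (F : Set (Finset (Fin n)))
    (w : List ℕ) : Prop :=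
  ∃ (adj : Fin n → List (Fin n)) (L : List (List (Fin n))),
    (∀ v, (adj v).Nodup ∧ ∀ u, u ∈ adj v ↔ G.Adj v u) ∧
    (∀ l ∈ L, l.Nodup) ∧
    (L.map List.toFinset).Nodup ∧
    (∀ Ω : Finset (Fin n), Ω ∈ F ↔ Ω ∈ L.map List.toFinset) ∧
    w = [n, G.edgeSet.ncard, k, F.ncard] ++
      (List.ofFn adj).flatMap encodeList ++ L.flatMap encodeList

end MinFill

/-! The algorithm is a dynamic program over blocks: connected vertex sets C together with their
neighbourhood N(C). Let H be a minimal triangulation of G in which N(C) is a clique. Some maximal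
clique Ω of H meets C and satisfies N(C) ⊆ Ω ⊆ C ∪ N(C) (`Block.exists_clique`). The components of G
- Ω inside C are smaller blocks (`block_component`), and the pairs inside Ω but not inside N(C),
together with the fill pairs meeting each of these components, are disjoint families of fill pairs
of H meeting C (`sum_fillOn_le`). Conversely, triangulations of the components can be glued along Ω
at exactly this price (`glue`). Both directions rest on Dirac's theorem and on
`IsMinimalTriangulation.not_adj`: an edge of a minimal triangulation never jumps over a
neighbourhood that is a clique of it. If H has at most k fill edges, each of its maximal cliques
misses at most k edges and is therefore vital (`isVital_of_fillOn_le`), so the given list contains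
every Ω that is needed.

Costs are counted in ordered pairs. With K = 2k + 1 the table stores the truncated difference of K
and the cost, so that 0 means "unknown or too expensive" and truncated subtraction does all the
arithmetic. Two invariants express correctness: nonzero entries are certified by actual fillings
(`SoundTable`), and entries for small blocks of any cheap H are at least as good as H
(`CompleteTable`).

The candidate blocks come from pairs of a listed clique Ω and a non-isolated vertex v. If D is the
component of G - Ω with smallest vertex v (or the empty set if there is none) and S = N(D), then the
candidate is the part of G - S that contains Ω \ S (`blk`). Every block of a minimal triangulation
with few fill edges arises in this way (`HoldsTriples.exists_step`).

The time bound uses that the number h of non-isolated vertices is at most both n and 2m. One clique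
costs O(nm) for its component labels and O(n + m) for each of its h candidates, and hn and hm are
O(nm). The table is filled in n + 1 rounds over all candidates, each being evaluated in O(n) steps
in one round only. Vertex sets are addressed by the nodes of a binary trie, with lookup in O(n)
steps (`run_intern`).

Programs are first analysed on a machine without word bound (`Run`). Since registers and cells of a
tame program grow at most by the elapsed time, `Steps.exec` transfers the result to words of
logarithmic length. -/

namespace MinFill

open SimpleGraph

/-! ### Simplicial vertices in chordal graphs and minimal triangulations. -/

section Chordal

variable {V : Type*}

/-- The neighbours of a vertex set outside of it. -/
def nb (G : SimpleGraph V) (A : Set V) : Set V := {u | u ∉ A ∧ ∃ a ∈ A, G.Adj a u}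

/-- `C` induces a connected subgraph (or is empty). -/
def ConnIn (G : SimpleGraph V) (C : Set V) : Prop :=
  ∀ A ⊆ C, A.Nonempty → (∀ a ∈ A, ∀ b ∈ C, G.Adj a b → b ∈ A) → A = C

/-- The vertex `z` is simplicial in the subgraph induced by `X`. -/
def SimplicialIn (H : SimpleGraph V) (X : Set V) (z : V) : Prop :=
  ∀ y ∈ X, ∀ w ∈ X, H.Adj z y → H.Adj z w → y ≠ w → H.Adj y w

/-- Modular subtraction is replaced by linear conditions, so that `omega` can decide adjacency on a
cycle. -/
lemma cycleGraph_adj_iff_val (k : ℕ) (u v : Fin (k + 2)) :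
    (cycleGraph (k + 2)).Adj u v ↔ (u : ℕ) = v + 1 ∨ (v : ℕ) = u + 1 ∨
      ((u : ℕ) = 0 ∧ (v : ℕ) = k + 1) ∨ ((v : ℕ) = 0 ∧ (u : ℕ) = k + 1) := by
  rw [cycleGraph_adj']
  have hu := u.2
  have hv := v.2
  rw [Fin.sub_def, Fin.sub_def]
  simp only
  have key : ∀ a b : ℕ, a < k + 2 → b < k + 2 →
      ((k + 2 - b + a) % (k + 2) = 1 ↔ a = b + 1 ∨ (a = 0 ∧ b = k + 1)) := by
    intro a b ha hb
    rcases le_or_gt b a with h | h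
    · have : k + 2 - b + a = (a - b) + (k + 2) := by omega
      rw [this, Nat.add_mod_right, Nat.mod_eq_of_lt (by omega)]
      omega
    · rw [Nat.mod_eq_of_lt (by omega)]
      omega
  rw [key _ _ hu hv, key _ _ hv hu]
  tauto

/-- The vertices of `A` that a walk from `s` reaches are closed under adjacency within `A`, hence
exhaust `A`. Walks are functions on `ℕ`, so that shortcuts amount to shifts of the index. -/
lemma exists_path_through {H : SimpleGraph V} {A : Set V} {s t : V} (hA : ConnIn H A)
    (hs : ∃ a ∈ A, H.Adj s a) (ht : ∃ a ∈ A, H.Adj a t) :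
    ∃ (k : ℕ) (f : ℕ → V), f 0 = s ∧ f k = t ∧ (∀ i < k, H.Adj (f i) (f (i + 1))) ∧
      ∀ i ≤ k, f i = s ∨ f i = t ∨ f i ∈ A := by
  let P : ℕ → V → (ℕ → V) → Prop := fun k b f =>
    f 0 = s ∧ f k = b ∧ (∀ i < k, H.Adj (f i) (f (i + 1))) ∧ ∀ i ≤ k, f i = s ∨ f i = t ∨ f i ∈ A
  have ext : ∀ k b c f, P k b f → H.Adj b c → (c = t ∨ c ∈ A) → ∃ f', P (k + 1) c f' := by
    rintro k b c f ⟨h0, hk, ha, hm⟩ hbc hc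
    refine ⟨fun i => if i ≤ k then f i else c, by simp [h0], by simp, ?_, ?_⟩
    · intro i hi
      rcases Nat.lt_succ_iff_lt_or_eq.1 hi with h | h
      · simpa [h.le, Nat.succ_le_of_lt h] using ha i h
      · subst h; simpa [hk] using hbc
    · intro i hi
      by_cases h : i ≤ k
      · simpa [h] using hm i h
      · simp only [h, if_false]; exact Or.inr hc
  have hB : {b ∈ A | ∃ k f, P k b f} = A := by
    apply hA
    · exact fun b hb => hb.1
    · obtain ⟨a, haA, hsa⟩ := hs
      have h0 : P 0 s (fun _ => s) := ⟨rfl, rfl, by simp, by simp⟩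
      obtain ⟨f', hf'⟩ := ext 0 s a (fun _ => s) h0 hsa (Or.inr haA)
      exact ⟨a, haA, 1, f', hf'⟩
    · rintro a ⟨_, k, f, hf⟩ b hb hab
      obtain ⟨f', hf'⟩ := ext k a b f hf hab (Or.inr hb)
      exact ⟨hb, k + 1, f', hf'⟩
  obtain ⟨a, haA, hat⟩ := ht
  rw [← hB] at haA
  obtain ⟨_, k, f, hf⟩ := haA
  obtain ⟨f', hf'⟩ := ext k a t f hf hat (Or.inl rfl)
  exact ⟨k + 1, f', hf'⟩

/-- In a chordal graph, a common neighbour of two nonadjacent vertices joined through `A` has a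
neighbour in `A`. -/
lemma IsChordal.exists_adj_of_connIn {H : SimpleGraph V} (hH : IsChordal H) {A : Set V}
    {s t x : V} (hA : ConnIn H A) (hs : ∃ a ∈ A, H.Adj s a) (ht : ∃ a ∈ A, H.Adj a t)
    (hst : s ≠ t) (hnst : ¬ H.Adj s t) (hxs : H.Adj x s) (hxt : H.Adj x t) (hxA : x ∉ A) :
    ∃ a ∈ A, H.Adj x a := by
  classical
  by_contra hcon
  push Not at hcon
  have hex : ∃ (k : ℕ), ∃ (f : ℕ → V), f 0 = s ∧ f k = t ∧ (∀ i < k, H.Adj (f i) (f (i + 1))) ∧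
      ∀ i ≤ k, f i = s ∨ f i = t ∨ f i ∈ A := exists_path_through hA hs ht
  -- A shortest walk has neither repetitions nor chords. If `x` saw nothing in `A`, it would see
  -- only the two ends, and would close the `k + 1` vertices of the walk to an induced cycle on `k +
  -- 2 ≥ 4` vertices.
  obtain ⟨f, h0, hk, hadj, hmem⟩ := Nat.find_spec hex
  have hmin := fun m hm => Nat.find_min hex (m := m) hm
  set k := Nat.find hex with hkdef
  -- shortcuts are impossible
  have hinj : ∀ i j, i < j → j ≤ k → f i ≠ f j := by
    intro i j hij hjk he
    refine hmin (k - (j - i)) (by omega) ⟨fun m => if m ≤ i then f m else f (m + (j - i)),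
      by simp [h0], ?_, ?_, ?_⟩
    · by_cases h : k - (j - i) ≤ i
      · have : k - (j - i) = i := by omega
        simp only [this, le_refl, if_true, he]
        rw [← hk]; congr 1; omega
      · simp only [h, if_false]; rw [← hk]; congr 1; omega
    · intro m hm
      rcases lt_trichotomy m i with h | h | h
      · simpa [h.le, Nat.succ_le_of_lt h] using hadj m (by omega)
      · subst h
        simp only [le_refl, if_true, Nat.not_succ_le_self, if_false]
        rw [he]
        have := hadj j (by omega)
        rwa [show m + 1 + (j - m) = j + 1 by omega]
      · have h1 : ¬ m ≤ i := by omega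
        have h2 : ¬ m + 1 ≤ i := by omega
        simp only [h1, h2, if_false]
        have := hadj (m + (j - i)) (by omega)
        rwa [show m + 1 + (j - i) = m + (j - i) + 1 by omega]
    · intro m hm
      by_cases h : m ≤ i
      · simpa [h] using hmem m (by omega)
      · simpa [h] using hmem (m + (j - i)) (by omega)
  have hchord : ∀ i j, i + 1 < j → j ≤ k → ¬ H.Adj (f i) (f j) := by
    intro i j hij hjk he
    refine hmin (k - (j - i - 1)) (by omega) ⟨fun m => if m ≤ i then f m else f (m + (j - i - 1)),
      by simp [h0], ?_, ?_, ?_⟩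
    · have h : ¬ k - (j - i - 1) ≤ i := by omega
      simp only [h, if_false]; rw [← hk]; congr 1; omega
    · intro m hm
      rcases lt_trichotomy m i with h | h | h
      · simpa [h.le, Nat.succ_le_of_lt h] using hadj m (by omega)
      · subst h
        simp only [le_refl, if_true, Nat.not_succ_le_self, if_false]
        rwa [show m + 1 + (j - m - 1) = j by omega]
      · have h1 : ¬ m ≤ i := by omega
        have h2 : ¬ m + 1 ≤ i := by omega
        simp only [h1, h2, if_false]
        have := hadj (m + (j - i - 1)) (by omega)
        rwa [show m + 1 + (j - i - 1) = m + (j - i - 1) + 1 by omega]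
    · intro m hm
      by_cases h : m ≤ i
      · simpa [h] using hmem m (by omega)
      · simpa [h] using hmem (m + (j - i - 1)) (by omega)
  have hk2 : 2 ≤ k := by
    by_contra h
    have : k = 0 ∨ k = 1 := by omega
    rcases this with h | h
    · rw [h] at hk; exact hst (h0 ▸ hk)
    · have := hadj 0 (by omega)
      rw [h0, zero_add, ← h, hk] at this
      exact hnst this
  have hxf : ∀ i ≤ k, f i ≠ x := by
    intro i hi he
    rcases hmem i hi with h | h | h
    · exact hxs.ne (he ▸ h)
    · exact hxt.ne (he ▸ h)
    · exact hxA (he ▸ h)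
  have hxadj : ∀ i ≤ k, (H.Adj x (f i) ↔ i = 0 ∨ i = k) := by
    intro i hi
    constructor
    · intro h
      by_contra hc
      push Not at hc
      rcases hmem i hi with h' | h' | h'
      · exact hinj 0 i (by omega) hi (by rw [h0, h'])
      · exact hinj i k (by omega) le_rfl (by rw [hk, h'])
      · exact hcon _ h' h
    · rintro (h | h)
      · rw [h, h0]; exact hxs
      · rw [h, hk]; exact hxt
  have hff : ∀ i ≤ k, ∀ j ≤ k, (H.Adj (f i) (f j) ↔ i = j + 1 ∨ j = i + 1) := by
    intro i hi j hj
    constructor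
    · intro h
      by_contra hc
      push Not at hc
      rcases lt_trichotomy i j with h' | h' | h'
      · exact hchord i j (by omega) hj h
      · subst h'; exact h.ne rfl
      · exact hchord j i (by omega) hi h.symm
    · rintro (h | h)
      · rw [h]; exact (hadj j (by omega)).symm
      · rw [h]; exact hadj i (by omega)
  let F : Fin (k + 2) → V := fun i => if (i : ℕ) ≤ k then f i else x
  have hFle : ∀ i : Fin (k + 2), (i : ℕ) ≤ k → F i = f i := fun i h => by simp [F, h]
  have hFgt : ∀ i : Fin (k + 2), ¬ (i : ℕ) ≤ k → F i = x := fun i h => by simp [F, h]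
  refine hH (k + 2) (by omega) ⟨⟨⟨F, ?_⟩, ?_⟩⟩
  · intro i j hij
    apply Fin.ext
    by_cases hi : (i : ℕ) ≤ k <;> by_cases hj : (j : ℕ) ≤ k
    · rw [hFle i hi, hFle j hj] at hij
      rcases lt_trichotomy (i : ℕ) j with h | h | h
      · exact absurd hij (hinj _ _ h hj)
      · exact h
      · exact absurd hij.symm (hinj _ _ h hi)
    · rw [hFle i hi, hFgt j hj] at hij
      exact absurd hij (hxf _ hi)
    · rw [hFgt i hi, hFle j hj] at hij
      exact absurd hij.symm (hxf _ hj)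
    · have := i.2; have := j.2; omega
  · intro i j
    have h1 := i.2
    have h2 := j.2
    change H.Adj (F i) (F j) ↔ _
    rw [cycleGraph_adj_iff_val]
    by_cases hi : (i : ℕ) ≤ k <;> by_cases hj : (j : ℕ) ≤ k
    · rw [hFle i hi, hFle j hj, hff _ hi _ hj]; omega
    · rw [hFle i hi, hFgt j hj, adj_comm, hxadj _ hi]; omega
    · rw [hFgt i hi, hFle j hj, hxadj _ hj]; omega
    · rw [hFgt i hi, hFgt j hj]
      simp only [SimpleGraph.irrefl, false_iff]; omega

lemma connIn_component {H : SimpleGraph V} {Y : Set V} {y : V} (hy : y ∈ Y) :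
    ∃ A ⊆ Y, y ∈ A ∧ ConnIn H A ∧ ∀ a ∈ A, ∀ b ∈ Y, H.Adj a b → b ∈ A := by
  let r : V → V → Prop := fun a b => H.Adj a b ∧ a ∈ Y ∧ b ∈ Y
  have hsym : Std.Symm r := ⟨fun a b h => ⟨h.1.symm, h.2.2, h.2.1⟩⟩
  refine ⟨{b | Relation.ReflTransGen r y b}, ?_, Relation.ReflTransGen.refl, ?_, ?_⟩
  · intro b hb
    rcases Relation.ReflTransGen.cases_tail hb with h | ⟨c, _, h⟩
    · exact h ▸ hy
    · exact h.2.2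
  · intro A hA hne hcl
    apply Set.Subset.antisymm hA
    obtain ⟨a, ha⟩ := hne
    have hya := hA ha
    intro b hb
    have hab : Relation.ReflTransGen r a b :=
      (Relation.ReflTransGen.stdSymm.symm _ _ hya).trans hb
    induction hab with
    | refl => exact ha
    | tail hac hcd ih =>
      exact hcl _ (ih (hya.trans hac)) _ hb hcd.1
  · intro a ha b hb hab
    rcases Relation.ReflTransGen.cases_tail ha with h | ⟨c, _, h⟩
    · exact ha.tail ⟨hab, h ▸ hy, hb⟩
    · exact ha.tail ⟨hab, h.2.2, hb⟩

/-- From the existence of simplicial vertices far from any non-universal vertex to the existence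
of simplicial vertices outside of a clique. -/
lemma exists_simplicial_of_clique_aux {H : SimpleGraph V} {X S : Set V}
    (hP : ∀ x ∈ X, (∃ y ∈ X, y ≠ x ∧ ¬ H.Adj x y) →
      ∃ z ∈ X, z ≠ x ∧ ¬ H.Adj x z ∧ SimplicialIn H X z)
    (hS : H.IsClique S) (hne : (X \ S).Nonempty) (hSX : S ⊆ X) :
    ∃ z ∈ X \ S, SimplicialIn H X z := by
  by_cases h1 : ∃ s ∈ S, ∃ y ∈ X, y ≠ s ∧ ¬ H.Adj s y
  · obtain ⟨s, hs, hy⟩ := h1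
    obtain ⟨z, hz, hzs, hnz, hsim⟩ := hP s (hSX hs) hy
    exact ⟨z, ⟨hz, fun hzS => hnz (hS hs hzS hzs.symm)⟩, hsim⟩
  -- Now `S` is complete to `X`. A vertex that misses some `a` is therefore outside of `S`; if no
  -- vertex of `X` misses another, then `X` is a clique and any vertex outside of `S` will do.
  · push Not at h1
    by_cases h2 : ∃ a ∈ X, ∃ y ∈ X, y ≠ a ∧ ¬ H.Adj a y
    · obtain ⟨a, ha, hy⟩ := h2
      obtain ⟨z, hz, hza, hnz, hsim⟩ := hP a ha hy
      refine ⟨z, ⟨hz, fun hzS => hnz (h1 z hzS a ha hza.symm).symm⟩, hsim⟩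
    · push Not at h2
      obtain ⟨z, hz⟩ := hne
      exact ⟨z, hz, fun y hy w hw _ _ hyw => h2 y hy w hw hyw.symm⟩

/-- Take a component `A` of the non-neighbours of `x` in `X`, and let `S` be its neighbours in `X`,
all adjacent to `x`. Two nonadjacent members of `S` would, through `A` and `x`, give `x` a neighbour
in `A`; so `S` is a clique. Induction applies to `A ∪ S`, which misses `x`, and a simplicial vertex
found in `A` has no further neighbours in `X`. -/
lemma IsChordal.exists_simplicial_not_adj [Finite V] {H : SimpleGraph V} (hH : IsChordal H) :
    ∀ (N : ℕ) (X : Set V), X.ncard = N → ∀ x ∈ X, (∃ y ∈ X, y ≠ x ∧ ¬ H.Adj x y) →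
      ∃ z ∈ X, z ≠ x ∧ ¬ H.Adj x z ∧ SimplicialIn H X z := by
  intro N
  induction N using Nat.strong_induction_on with
  | _ N ih =>
  rintro X hXN x hx ⟨y, hy, hyx, hnxy⟩
  let Y : Set V := {b ∈ X | b ≠ x ∧ ¬ H.Adj x b}
  obtain ⟨A, hAY, hyA, hAc, hAcl⟩ := connIn_component (H := H) (Y := Y) (y := y) ⟨hy, hyx, hnxy⟩
  let S : Set V := {s ∈ X | s ∉ A ∧ ∃ a ∈ A, H.Adj s a}
  have hSx : ∀ s ∈ S, H.Adj x s := by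
    rintro s ⟨hsX, hsA, a, ha, hsa⟩
    by_contra h
    refine hsA (hAcl a ha s ⟨hsX, ?_, h⟩ hsa.symm)
    rintro rfl
    exact (hAY ha).2.2 hsa
  have hScl : H.IsClique S := by
    intro s hs t ht hst
    by_contra hn
    obtain ⟨b, hb, hsb⟩ := ht.2.2
    obtain ⟨a, ha, hxa⟩ := hH.exists_adj_of_connIn hAc hs.2.2 ⟨b, hb, hsb.symm⟩ hst hn
      (hSx s hs) (hSx t ht) (fun h => (hAY h).2.1 rfl)
    exact (hAY ha).2.2 hxa
  have hsub : A ∪ S ⊆ X := by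
    rintro b (h | h)
    · exact (hAY h).1
    · exact h.1
  have hlt : (A ∪ S).ncard < N := by
    rw [← hXN]
    apply Set.ncard_lt_ncard _ (Set.toFinite X)
    refine ⟨hsub, fun h => ?_⟩
    rcases h hx with h | h
    · exact (hAY h).2.1 rfl
    · exact (hSx x h).ne rfl
  obtain ⟨z, ⟨hzX, hzS⟩, hsim⟩ := exists_simplicial_of_clique_aux (X := A ∪ S)
    (ih _ hlt _ rfl) hScl ⟨y, Or.inl hyA, fun h => h.2.1 hyA⟩ Set.subset_union_right
  have hzA : z ∈ A := hzX.resolve_right hzS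
  have hnbz : ∀ w ∈ X, H.Adj z w → w ∈ A ∪ S := by
    intro w hw hzw
    by_cases h : w ∈ A
    · exact Or.inl h
    · exact Or.inr ⟨hw, h, z, hzA, hzw.symm⟩
  exact ⟨z, (hAY hzA).1, (hAY hzA).2.1, (hAY hzA).2.2, fun p hp q hq hzp hzq hpq =>
    hsim p (hnbz p hp hzp) q (hnbz q hq hzq) hzp hzq hpq⟩

/-- Dirac: outside of a clique, a chordal graph has a simplicial vertex. -/
lemma IsChordal.exists_simplicial [Finite V] {H : SimpleGraph V} (hH : IsChordal H)
    {X S : Set V} (hS : H.IsClique S) (hne : (X \ S).Nonempty) :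
    ∃ z ∈ X \ S, SimplicialIn H X z := by
  obtain ⟨z, hz, hs⟩ := exists_simplicial_of_clique_aux (X := X) (S := S ∩ X)
    (hH.exists_simplicial_not_adj _ X rfl) (hS.subset Set.inter_subset_left)
    (by obtain ⟨z, hz⟩ := hne; exact ⟨z, hz.1, fun h => hz.2 h.1⟩) Set.inter_subset_right
  exact ⟨z, ⟨hz.1, fun h => hz.2 ⟨h, hz.1⟩⟩, hs⟩

/-- On an induced cycle of length at least four the two neighbours of a vertex are not adjacent, so
no vertex is simplicial. This is how all constructed graphs are shown to be chordal. -/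
lemma isChordal_of_simplicial {H : SimpleGraph V}
    (h : ∀ X : Set V, X.Nonempty → ∃ z ∈ X, SimplicialIn H X z) : IsChordal H := by
  rintro l hl ⟨φ⟩
  obtain ⟨m, rfl⟩ : ∃ m, l = m + 2 := ⟨l - 2, by omega⟩
  obtain ⟨z, ⟨i, rfl⟩, hsim⟩ := h (Set.range φ) ⟨φ 0, 0, rfl⟩
  have hi := i.2
  obtain ⟨a, hav⟩ : ∃ a : Fin (m + 2), ((i : ℕ) = m + 1 ∧ (a : ℕ) = 0) ∨
      ((i : ℕ) ≠ m + 1 ∧ (a : ℕ) = (i : ℕ) + 1) := by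
    by_cases h : (i : ℕ) = m + 1
    · exact ⟨⟨0, by omega⟩, Or.inl ⟨h, rfl⟩⟩
    · exact ⟨⟨i + 1, by omega⟩, Or.inr ⟨h, rfl⟩⟩
  obtain ⟨b, hbv⟩ : ∃ b : Fin (m + 2), ((i : ℕ) = 0 ∧ (b : ℕ) = m + 1) ∨
      ((i : ℕ) ≠ 0 ∧ (b : ℕ) + 1 = (i : ℕ)) := by
    by_cases h : (i : ℕ) = 0
    · exact ⟨⟨m + 1, by omega⟩, Or.inl ⟨h, rfl⟩⟩
    · exact ⟨⟨i - 1, by omega⟩, Or.inr ⟨h, by simp only; omega⟩⟩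
  have ha : (cycleGraph (m + 2)).Adj i a := by
    rw [cycleGraph_adj_iff_val]; omega
  have hb : (cycleGraph (m + 2)).Adj i b := by
    rw [cycleGraph_adj_iff_val]; omega
  have hab : a ≠ b := by
    intro h
    have := congrArg Fin.val h
    omega
  have := hsim _ ⟨a, rfl⟩ _ ⟨b, rfl⟩ (φ.map_adj_iff.2 ha) (φ.map_adj_iff.2 hb)
    (fun h => hab (φ.injective h))
  rw [φ.map_adj_iff, cycleGraph_adj_iff_val] at this
  omega

/-- A minimal triangulation has no edges that jump over a neighbourhood which it completes. -/
lemma IsMinimalTriangulation.not_adj [Finite V] {G H : SimpleGraph V}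
    (hH : IsMinimalTriangulation G H) {A : Set V} (hA : H.IsClique (nb G A)) {a b : V}
    (ha : a ∈ A) (hb : b ∉ A) (hb' : b ∉ nb G A) : ¬ H.Adj a b := by
  intro hab
  -- Deleting all edges between `A` and `B` keeps the graph above `G`, since `G` has no such edges.
  -- If the result is chordal, the edge `a b` contradicts minimality.
  let B : Set V := {b | b ∉ A ∧ b ∉ nb G A}
  let H' : SimpleGraph V :=
    { Adj := fun x y => H.Adj x y ∧ ¬ (x ∈ A ∧ y ∈ B) ∧ ¬ (y ∈ A ∧ x ∈ B)
      symm := ⟨fun x y h => ⟨h.1.symm, h.2.2, h.2.1⟩⟩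
      loopless := ⟨fun x h => h.1.ne rfl⟩ }
  have hle : H' ≤ H := fun x y h => h.1
  have hne : H' < H := by
    refine lt_of_le_not_ge hle fun h => ?_
    exact (h hab).2.1 ⟨ha, hb, hb'⟩
  refine hH.2.2 H' ?_ hne ?_
  · intro x y hxy
    refine ⟨hH.1 hxy, ?_, ?_⟩
    · rintro ⟨hx, hy1, hy2⟩
      exact hy2 ⟨hy1, x, hx, hxy⟩
    · rintro ⟨hx, hy1, hy2⟩
      exact hy2 ⟨hy1, y, hx, hxy.symm⟩
  · apply isChordal_of_simplicial
    intro X hX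
    -- If `X` meets `A`, a vertex of `X ∩ A` that is simplicial in `X ∩ (A ∪ nb G A)` works, because
    -- its remaining neighbours stay there. Otherwise no deleted edge lies inside `X`.
    by_cases hXA : (X ∩ A).Nonempty
    · obtain ⟨x, hxX, hxA⟩ := hXA
      obtain ⟨z, ⟨⟨hzX, hz⟩, hzS⟩, hsim⟩ := hH.2.1.exists_simplicial
        (X := X ∩ (A ∪ nb G A)) hA ⟨x, ⟨hxX, Or.inl hxA⟩, fun h => h.1 hxA⟩
      have hzA : z ∈ A := hz.resolve_right hzS
      have hcl : ∀ y, H'.Adj z y → y ∈ A ∪ nb G A := by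
        intro y hy
        by_contra h
        exact hy.2.1 ⟨hzA, fun h' => h (Or.inl h'), fun h' => h (Or.inr h')⟩
      refine ⟨z, hzX, fun p hp q hq hzp hzq hpq => ⟨hsim p ⟨hp, hcl p hzp⟩ q ⟨hq, hcl q hzq⟩
        hzp.1 hzq.1 hpq, ?_, ?_⟩⟩
      · rintro ⟨_, h1, h2⟩; exact (hcl q hzq).elim h1 h2
      · rintro ⟨_, h1, h2⟩; exact (hcl p hzp).elim h1 h2
    · obtain ⟨z, ⟨hzX, _⟩, hsim⟩ := hH.2.1.exists_simplicial (X := X) (S := ∅)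
        (by simp) (by simpa using hX)
      have hn : ∀ y ∈ X, y ∉ A := fun y hy h => hXA ⟨y, hy, h⟩
      exact ⟨z, hzX, fun p hp q hq hzp hzq hpq => ⟨hsim p hp q hq hzp.1 hzq.1 hpq,
        fun h => hn p hp h.1, fun h => hn q hq h.1⟩⟩

/-- A connected set whose neighbours form a clique has a vertex adjacent to all of them. -/
lemma IsChordal.exists_complete [Finite V] {H : SimpleGraph V} (hH : IsChordal H) {S : Set V}
    (hS : H.IsClique S) : ∀ (N : ℕ) (D : Set V), D.ncard = N → D.Nonempty → ConnIn H D →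
      (∀ s ∈ S, s ∉ D ∧ ∃ d ∈ D, H.Adj d s) → ∃ x ∈ D, ∀ s ∈ S, H.Adj x s := by
  intro N
  induction N with
  | zero =>
    intro D h hne
    rw [Set.ncard_eq_zero] at h
    simp [h] at hne
  | succ N ih =>
    intro D hDN hne hconn hnb
    obtain ⟨d, hd⟩ := hne
    -- Induct by deleting `z`. Its neighbours are pairwise adjacent, so `D \ {z}` stays connected,
    -- and a neighbour `u ∈ D` of `z` sees every vertex of `S` that `z` sees.
    obtain ⟨z, ⟨hz, hzS⟩, hsim⟩ := hH.exists_simplicial (X := D ∪ S) hS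
      ⟨d, Or.inl hd, fun h => (hnb d h).1 hd⟩
    have hzD : z ∈ D := hz.resolve_right hzS
    by_cases hzs : D \ {z} = ∅
    · refine ⟨z, hzD, fun s hs => ?_⟩
      obtain ⟨_, d, hd, hds⟩ := hnb s hs
      have : d = z := by
        by_contra h
        have : d ∈ D \ {z} := ⟨hd, h⟩
        simp [hzs] at this
      exact this ▸ hds
    · have hu : ∃ u ∈ D, u ≠ z ∧ H.Adj z u := by
        by_contra hc
        push Not at hc
        apply hzs
        have : ({z} : Set V) = D := hconn {z} (by simpa using hzD) ⟨z, rfl⟩ (by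
          rintro a rfl b hb hab
          by_contra h
          exact hc b hb h hab)
        rw [← this]; simp
      obtain ⟨u, huD, huz, hzu⟩ := hu
      have hcard : (D \ {z}).ncard = N := by
        rw [Set.ncard_sdiff_singleton_of_mem hzD, hDN, Nat.add_sub_cancel]
      suffices h : ConnIn H (D \ {z}) ∧ ∀ s ∈ S, s ∉ D \ {z} ∧ ∃ d ∈ D \ {z}, H.Adj d s by
        obtain ⟨x, hx, hxs⟩ := ih (D \ {z}) hcard ⟨u, huD, huz⟩ h.1 h.2
        exact ⟨x, hx.1, hxs⟩
      constructor
      · intro A hA hAne hcl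
        by_cases hza : ∃ a ∈ A, H.Adj z a
        · obtain ⟨a, ha, hza⟩ := hza
          have hins : insert z A = D := by
            apply hconn
            · exact Set.insert_subset hzD (hA.trans Set.sdiff_subset)
            · exact ⟨z, Set.mem_insert _ _⟩
            · rintro c (rfl | hc) b hb hcb
              · by_cases hba : b = a
                · exact hba ▸ Or.inr ha
                · exact Or.inr (hcl a ha b ⟨hb, hcb.ne.symm⟩
                    (hsim a (Or.inl (hA ha).1) b (Or.inl hb) hza hcb (Ne.symm hba)))
              · by_cases hbz : b = z
                · exact Or.inl hbz
                · exact Or.inr (hcl c hc b ⟨hb, hbz⟩ hcb)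
          rw [← hins]
          ext b
          constructor
          · exact fun hb => ⟨Or.inr hb, (hA hb).2⟩
          · rintro ⟨hb | hb, hbz⟩
            · exact absurd hb hbz
            · exact hb
        · push Not at hza
          have : A = D := hconn A (hA.trans Set.sdiff_subset) hAne (by
            intro a ha b hb hab
            by_cases hbz : b = z
            · exact absurd (hbz ▸ hab).symm (hza a ha)
            · exact hcl a ha b ⟨hb, hbz⟩ hab)
          exact absurd rfl (hA (this ▸ hzD)).2
      · intro s hs
        obtain ⟨hsD, d, hd, hds⟩ := hnb s hs
        refine ⟨fun h => hsD h.1, ?_⟩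
        by_cases hdz : d = z
        · subst hdz
          refine ⟨u, ⟨huD, huz⟩, hsim u (Or.inl huD) s (Or.inr hs) hzu hds ?_⟩
          rintro rfl
          exact hsD huD
        · exact ⟨d, ⟨hd, hdz⟩, hds⟩

end Chordal

/-! ### Counting missing edges by ordered pairs. -/

section Counting

variable {V : Type*}

lemma ncard_biUnion_le_sum {α ι : Type*} [Finite α] (I : Finset ι) (P : ι → Set α) :
    (⋃ i ∈ I, P i).ncard ≤ ∑ i ∈ I, (P i).ncard := by
  classical
  induction I using Finset.induction_on with
  | empty => simp
  | insert a I ha ih =>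
    rw [Finset.set_biUnion_insert, Finset.sum_insert ha]
    exact (Set.ncard_union_le _ _).trans (by omega)

lemma sum_ncard_eq_ncard_biUnion {α ι : Type*} [Finite α] (I : Finset ι) (P : ι → Set α)
    (h : ∀ i ∈ I, ∀ j ∈ I, i ≠ j → Disjoint (P i) (P j)) :
    ∑ i ∈ I, (P i).ncard = (⋃ i ∈ I, P i).ncard := by
  classical
  induction I using Finset.induction_on with
  | empty => simp
  | insert a I ha ih =>
    rw [Finset.set_biUnion_insert, Finset.sum_insert ha, Set.ncard_union_eq _ (Set.toFinite _)
      (Set.toFinite _), ih fun i hi j hj => h i (Finset.mem_insert_of_mem hi) j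
        (Finset.mem_insert_of_mem hj)]
    rw [Set.disjoint_iUnion₂_right]
    intro i hi
    exact h a (Finset.mem_insert_self _ _) i (Finset.mem_insert_of_mem hi)
      (fun e => ha (e ▸ hi))

lemma ncard_adj_pairs [Finite V] (K : SimpleGraph V) :
    {p : V × V | K.Adj p.1 p.2}.ncard = 2 * K.edgeSet.ncard := by
  classical
  have := Fintype.ofFinite V
  have h := K.dart_card_eq_twice_card_edges
  rw [← Nat.card_eq_fintype_card] at h
  rw [← K.coe_edgeFinset, Set.ncard_coe_finset, ← h, ← Nat.card_coe_set_eq]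
  exact Nat.card_congr ⟨fun p => ⟨p.1, p.2⟩, fun d => ⟨d.toProd, d.adj⟩, fun _ => rfl, fun _ => rfl⟩

/-- The number of ordered pairs of distinct nonadjacent vertices in `A`. -/
noncomputable def fill2 (G : SimpleGraph V) (A : Set V) : ℕ :=
  {p : V × V | p.1 ∈ A ∧ p.2 ∈ A ∧ p.1 ≠ p.2 ∧ ¬ G.Adj p.1 p.2}.ncard

/-- The number of ordered pairs of vertices that meet `C` and are adjacent in `H` but not
in `G`. -/
noncomputable def fillOn (G H : SimpleGraph V) (C : Set V) : ℕ :=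
  {p : V × V | H.Adj p.1 p.2 ∧ ¬ G.Adj p.1 p.2 ∧ (p.1 ∈ C ∨ p.2 ∈ C)}.ncard

/-- This lets the machine obtain `fill2` from the size of `A` and the number of arcs inside. -/
lemma fill2_add_adj_pairs [Finite V] (G : SimpleGraph V) (A : Set V) :
    fill2 G A + {p : V × V | p.1 ∈ A ∧ p.2 ∈ A ∧ G.Adj p.1 p.2}.ncard =
      A.ncard * (A.ncard - 1) := by
  classical
  have := Fintype.ofFinite V
  rw [fill2, ← Set.ncard_union_eq]
  · have : A.ncard * (A.ncard - 1) = (A.toFinset.offDiag).card := by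
      rw [Finset.offDiag_card, Set.ncard_eq_toFinset_card', Nat.mul_sub, mul_one]
    rw [this, ← Set.ncard_coe_finset]
    congr 1
    ext p
    simp only [Set.mem_union, Set.mem_ofPred_eq, Finset.coe_offDiag, Set.coe_toFinset,
      Set.mem_offDiag]
    constructor
    · rintro (h | h)
      · exact ⟨h.1, h.2.1, h.2.2.1⟩
      · exact ⟨h.1, h.2.1, h.2.2.ne⟩
    · rintro ⟨h1, h2, h3⟩
      by_cases h : G.Adj p.1 p.2
      · exact Or.inr ⟨h1, h2, h⟩
      · exact Or.inl ⟨h1, h2, h3, h⟩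
  · rw [Set.disjoint_left]
    exact fun p h h' => h.2.2.2 h'.2.2

lemma ncard_adj_pairs_induce [Finite V] (G : SimpleGraph V) (A : Set V) :
    {p : V × V | p.1 ∈ A ∧ p.2 ∈ A ∧ G.Adj p.1 p.2}.ncard = 2 * (G.induce A).edgeSet.ncard := by
  rw [← ncard_adj_pairs, ← Nat.card_coe_set_eq, ← Nat.card_coe_set_eq]
  exact Nat.card_congr ⟨fun p => ⟨(⟨p.1.1, p.2.1⟩, ⟨p.1.2, p.2.2.1⟩), p.2.2.2⟩,
    fun p => ⟨(p.1.1, p.1.2), p.1.1.2, p.1.2.2, p.2⟩, fun _ => rfl, fun _ => rfl⟩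

lemma fill2_le_fillOn [Finite V] {G H : SimpleGraph V} {A : Set V} (h : H.IsClique A) :
    fill2 G A ≤ fillOn G H Set.univ :=
  Set.ncard_le_ncard fun _ hp => ⟨h hp.1 hp.2.1 hp.2.2.1, hp.2.2.2, Or.inl trivial⟩

/-- Every pair missing inside a clique of `H` is a fill pair of `H`. Hence a cheap triangulation
uses only vital cliques. -/
lemma isVital_of_fillOn_le [Finite V] {G H : SimpleGraph V} (hH : IsMinimalTriangulation G H)
    {k : ℕ} (hk : fillOn G H Set.univ ≤ 2 * k) {Ω : Finset V}
    (hΩ : Maximal H.IsClique (Ω : Set V)) : IsVital G k Ω := by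
  refine ⟨⟨H, hH, hΩ⟩, ?_⟩
  have h1 := (fill2_le_fillOn (G := G) hΩ.prop).trans hk
  have h2 := fill2_add_adj_pairs G (Ω : Set V)
  rw [ncard_adj_pairs_induce, Set.ncard_coe_finset] at h2
  have h3 : 2 * Ω.card.choose 2 = Ω.card * (Ω.card - 1) := by
    rw [Nat.choose_two_right, Nat.mul_div_cancel' (Nat.even_mul_pred_self _).two_dvd]
  omega

/-- A minimal chordal graph between `G` and `G ∪ F` is a minimal triangulation, and its fill edges
belong to `F`. Ordered pairs account for the factor two. -/
lemma IsYesInstance.exists_triangulation [Finite V] {G : SimpleGraph V} {k : ℕ}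
    (h : IsYesInstance G k) :
    ∃ H, IsMinimalTriangulation G H ∧ fillOn G H Set.univ ≤ 2 * k := by
  obtain ⟨F, hF, hFk, hch⟩ := h
  obtain ⟨H, hle, hmin⟩ := Finite.exists_le_minimal
    (p := fun H : SimpleGraph V => G ≤ H ∧ IsChordal H) ⟨le_sup_left, hch⟩
  refine ⟨H, ⟨hmin.prop.1, hmin.prop.2, fun H' h1 h2 h3 => ?_⟩, ?_⟩
  · exact h2.not_ge (hmin.le_of_le ⟨h1, h3⟩ h2.le)
  · have h1 : fillOn G H Set.univ = {p : V × V | (H \ G).Adj p.1 p.2}.ncard := by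
      simp [fillOn, SimpleGraph.sdiff_adj]
    rw [h1, ncard_adj_pairs]
    have h2 : (H \ G).edgeSet ⊆ (F : Set (Sym2 V)) := by
      intro e
      induction e with
      | h x y =>
        rintro ⟨h1, h2⟩
        have := hle h1
        rw [sup_adj] at this
        rcases this with h | h
        · exact absurd h h2
        · exact ((fromEdgeSet_adj _).1 h).1
    have := Set.ncard_le_ncard h2 F.finite_toSet
    rw [Set.ncard_coe_finset] at this
    omega

/-- `G[C ∪ N(C)]`, with `N(C)` completed to a clique, has a triangulation with at most `a` new
ordered pairs that meet `C`; only the edges meeting `C` are recorded. -/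
def Fillable (G : SimpleGraph V) (C : Set V) (a : ℕ) : Prop :=
  ∃ H : SimpleGraph V, (∀ x ∈ C, ∀ y, G.Adj x y → H.Adj x y) ∧
    (∀ x y, H.Adj x y → x ∈ C ∨ y ∈ C) ∧
    (∀ x ∈ C, ∀ y, H.Adj x y → y ∈ C ∨ y ∈ nb G C) ∧
    (∀ X : Set V, (X ∩ C).Nonempty → ∃ x ∈ X ∩ C, ∀ y ∈ X, ∀ z ∈ X, H.Adj x y → H.Adj x z →
      y ≠ z → H.Adj y z ∨ (y ∈ nb G C ∧ z ∈ nb G C)) ∧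
    {p : V × V | H.Adj p.1 p.2 ∧ ¬ G.Adj p.1 p.2}.ncard ≤ a

lemma Fillable.mono {G : SimpleGraph V} {C : Set V} {a b : ℕ} (h : Fillable G C a)
    (hab : a ≤ b) : Fillable G C b := by
  obtain ⟨H, h1, h2, h3, h4, h5⟩ := h
  exact ⟨H, h1, h2, h3, h4, h5.trans hab⟩

/-- The whole vertex set has no outer neighbours, so the fourth clause of `Fillable` becomes the
existence of simplicial vertices. -/
lemma Fillable.isYesInstance [Finite V] {G : SimpleGraph V} {a k : ℕ}
    (h : Fillable G Set.univ a) (ha : a ≤ 2 * k) : IsYesInstance G k := by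
  classical
  have := Fintype.ofFinite V
  obtain ⟨H, h1, h2, h3, h4, h5⟩ := h
  have hGH : G ≤ H := fun x y hxy => h1 x trivial y hxy
  refine ⟨(H \ G).edgeFinset, ?_, ?_, ?_⟩
  · intro e he
    exact (H \ G).not_isDiag_of_mem_edgeFinset he
  · have : {p : V × V | H.Adj p.1 p.2 ∧ ¬ G.Adj p.1 p.2} = {p : V × V | (H \ G).Adj p.1 p.2} := by
      simp [SimpleGraph.sdiff_adj]
    rw [this, ncard_adj_pairs, ← SimpleGraph.coe_edgeFinset, Set.ncard_coe_finset] at h5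
    omega
  · have : G ⊔ fromEdgeSet ((H \ G).edgeFinset : Set (Sym2 V)) = H := by
      rw [SimpleGraph.coe_edgeFinset, fromEdgeSet_edgeSet, sup_sdiff_cancel_right hGH]
    rw [this]
    apply isChordal_of_simplicial
    intro X hX
    obtain ⟨x, hx, hs⟩ := h4 X (by simpa using hX)
    refine ⟨x, hx.1, fun y hy w hw hxy hxw hyw => ?_⟩
    rcases hs y hy w hw hxy hxw hyw with h | h
    · exact h
    · exact absurd trivial h.1.1

end Counting

/-! ### Gluing and splitting along a clique and the components of its complement. -/

section Families

variable {V ι : Type*}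

/-- The nonempty members of `D` are the connected components of `G - Ω`. -/
structure CompFam (G : SimpleGraph V) (Ω : Set V) (D : ι → Set V) : Prop where
  disj : ∀ i, ∀ x ∈ D i, x ∉ Ω
  nb_sub : ∀ i, nb G (D i) ⊆ Ω
  inj : ∀ i j x, x ∈ D i → x ∈ D j → i = j
  conn : ∀ i, ConnIn G (D i)
  cover : ∀ x, x ∉ Ω → ∃ i, x ∈ D i

lemma CompFam.mem_or {G : SimpleGraph V} {Ω : Set V} {D : ι → Set V} (h : CompFam G Ω D) {i : ι}
    {x y : V} (hx : x ∈ D i) (hxy : G.Adj x y) : y ∈ D i ∨ (y ∈ Ω ∧ y ∈ nb G (D i)) := by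
  by_cases hy : y ∈ D i
  · exact Or.inl hy
  · have : y ∈ nb G (D i) := ⟨hy, x, hx, hxy⟩
    exact Or.inr ⟨h.nb_sub i this, this⟩

/-- Take the given fillings of the components and complete `Ω`, except for the pairs inside `S`:
these do not meet `C`, and `Fillable` treats the neighbourhood `S` of `C` as complete anyway. The
new pairs inside `Ω` therefore cost the difference of the two fill numbers. -/
lemma glue [Finite V] {G : SimpleGraph V} {Ω S C : Set V} {D : ι → Set V} (hD : CompFam G Ω D)
    (hSΩ : S ⊆ Ω) (I : Finset ι) (hC : ∀ x, x ∈ C ↔ (x ∈ Ω ∧ x ∉ S) ∨ ∃ i ∈ I, x ∈ D i)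
    (hS : nb G C = S) (a : ι → ℕ) (ha : ∀ i ∈ I, Fillable G (D i) (a i)) :
    Fillable G C (fill2 G Ω - fill2 G S + ∑ i ∈ I, a i) := by
  have hDC : ∀ i ∈ I, ∀ x ∈ D i, x ∈ C := fun i hi x hx => (hC x).2 (Or.inr ⟨i, hi, hx⟩)
  choose! K h1 h2 h3 h4 h5 using ha
  let H : SimpleGraph V :=
    { Adj := fun x y => (∃ i ∈ I, (K i).Adj x y) ∨
        (x ∈ Ω ∧ y ∈ Ω ∧ x ≠ y ∧ ¬ (x ∈ S ∧ y ∈ S))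
      symm := ⟨by
        rintro x y (⟨i, hi, h⟩ | ⟨h1, h2, h3, h4⟩)
        · exact Or.inl ⟨i, hi, h.symm⟩
        · exact Or.inr ⟨h2, h1, h3.symm, fun h => h4 ⟨h.2, h.1⟩⟩⟩
      loopless := ⟨by
        rintro x (⟨i, hi, h⟩ | h)
        · exact h.ne rfl
        · exact h.2.2.1 rfl⟩ }
  have hΩC : ∀ x ∈ Ω, x ∉ S → x ∈ C := fun x hx hxS => (hC x).2 (Or.inl ⟨hx, hxS⟩)
  have hKD : ∀ i ∈ I, ∀ j ∈ I, ∀ x y, x ∈ D i → (K j).Adj x y → j = i := by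
    intro i hi j hj x y hx hxy
    by_contra hne
    rcases h2 j hj x y hxy with h | h
    · exact hne (hD.inj _ _ x h hx)
    · rcases h3 j hj y h x hxy.symm with h' | h'
      · exact hne (hD.inj _ _ x h' hx)
      · exact hD.disj i x hx (hD.nb_sub j h')
  have hHD : ∀ i ∈ I, ∀ x y, x ∈ D i → H.Adj x y → (K i).Adj x y := by
    rintro i hi x y hx (⟨j, hj, h⟩ | h)
    · rwa [← hKD i hi j hj x y hx h]
    · exact absurd h.1 (hD.disj i x hx)
  have hmem : ∀ x, x ∈ C ∨ x ∈ S ∨ x ∉ Ω := fun x => by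
    by_cases hx : x ∈ Ω
    · by_cases hxS : x ∈ S
      · exact Or.inr (Or.inl hxS)
      · exact Or.inl (hΩC x hx hxS)
    · exact Or.inr (Or.inr hx)
  have hΩmem : ∀ x ∈ Ω, x ∈ C ∨ x ∈ S := fun x hx => by
    rcases hmem x with h | h | h
    · exact Or.inl h
    · exact Or.inr h
    · exact absurd hx h
  refine ⟨H, ?_, ?_, ?_, ?_, ?_⟩
  · intro x hx y hxy
    have hy : y ∈ C ∨ y ∈ S := by
      by_cases h : y ∈ C
      · exact Or.inl h
      · exact Or.inr (hS ▸ ⟨h, x, hx, hxy⟩)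
    rcases (hC x).1 hx with ⟨hxΩ, hxS⟩ | ⟨i, hi, hxi⟩
    · by_cases hyΩ : y ∈ Ω
      · exact Or.inr ⟨hxΩ, hyΩ, hxy.ne, fun h => hxS h.1⟩
      · have hyC : y ∈ C := hy.resolve_right fun h => hyΩ (hSΩ h)
        rcases (hC y).1 hyC with h | ⟨i, hi, hyi⟩
        · exact absurd h.1 hyΩ
        · exact Or.inl ⟨i, hi, (h1 i hi y hyi x hxy.symm).symm⟩
    · exact Or.inl ⟨i, hi, h1 i hi x hxi y hxy⟩
  · rintro x y (⟨i, hi, h⟩ | ⟨hx, hy, hne, hS'⟩)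
    · exact (h2 i hi x y h).imp (hDC i hi x) (hDC i hi y)
    · by_cases hxS : x ∈ S
      · exact Or.inr (hΩC y hy fun h => hS' ⟨hxS, h⟩)
      · exact Or.inl (hΩC x hx hxS)
  · rintro x hx y (⟨i, hi, h⟩ | ⟨_, hy, _⟩)
    · rw [hS]
      rcases h2 i hi x y h with hxi | hyi
      · rcases h3 i hi x hxi y h with h' | h'
        · exact Or.inl (hDC i hi y h')
        · exact hΩmem y (hD.nb_sub i h')
      · exact Or.inl (hDC i hi y hyi)
    · rw [hS]; exact hΩmem y hy
  · intro X hX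
    have hΩadj : ∀ y ∈ Ω, ∀ z ∈ Ω, y ≠ z → H.Adj y z ∨ (y ∈ nb G C ∧ z ∈ nb G C) := by
      intro y hy z hz hyz
      rw [hS]
      by_cases h : y ∈ S ∧ z ∈ S
      · exact Or.inr h
      · exact Or.inl (Or.inr ⟨hy, hz, hyz, h⟩)
    -- Components are eliminated first. Once `X` meets none of them, all neighbours in `X` of a
    -- vertex of `C` lie in `Ω`.
    by_cases hXD : ∃ i ∈ I, (X ∩ D i).Nonempty
    · obtain ⟨i, hi, hne⟩ := hXD
      obtain ⟨x, hx, hs⟩ := h4 i hi X hne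
      refine ⟨x, ⟨hx.1, hDC i hi x hx.2⟩, fun y hy z hz hxy hxz hyz => ?_⟩
      rcases hs y hy z hz (hHD i hi x y hx.2 hxy) (hHD i hi x z hx.2 hxz) hyz with h | h
      · exact Or.inl (Or.inl ⟨i, hi, h⟩)
      · exact hΩadj y (hD.nb_sub i h.1) z (hD.nb_sub i h.2) hyz
    · push Not at hXD
      have hno : ∀ i ∈ I, ∀ x ∈ X, x ∉ D i := fun i hi x hx h => by
        have : x ∈ X ∩ D i := ⟨hx, h⟩
        rw [hXD i hi] at this
        exact this
      obtain ⟨x, hxX, hxC⟩ := hX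
      have hcl : ∀ y ∈ X, H.Adj x y → y ∈ Ω := by
        rintro y hy (⟨i, hi, h⟩ | h)
        · rcases h2 i hi x y h with h' | h'
          · exact absurd h' (hno i hi x hxX)
          · exact absurd h' (hno i hi y hy)
        · exact h.2.1
      exact ⟨x, ⟨hxX, hxC⟩, fun y hy z hz hxy hxz hyz =>
        hΩadj y (hcl y hy hxy) z (hcl z hz hxz) hyz⟩
  · let PΩ := {p : V × V | p.1 ∈ Ω ∧ p.2 ∈ Ω ∧ p.1 ≠ p.2 ∧ ¬ G.Adj p.1 p.2}
    let PS := {p : V × V | p.1 ∈ S ∧ p.2 ∈ S ∧ p.1 ≠ p.2 ∧ ¬ G.Adj p.1 p.2}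
    let PD := fun i => {p : V × V | (K i).Adj p.1 p.2 ∧ ¬ G.Adj p.1 p.2}
    have hsub : {p : V × V | H.Adj p.1 p.2 ∧ ¬ G.Adj p.1 p.2} ⊆ (PΩ \ PS) ∪ ⋃ i ∈ I, PD i := by
      rintro p ⟨⟨i, hi, h⟩ | ⟨h1, h2, h3, h4⟩, hp⟩
      · right
        simp only [Set.mem_iUnion]
        exact ⟨i, hi, h, hp⟩
      · left
        exact ⟨⟨h1, h2, h3, hp⟩, fun h => h4 ⟨h.1, h.2.1⟩⟩
    have hPS : PS ⊆ PΩ := fun p hp => ⟨hSΩ hp.1, hSΩ hp.2.1, hp.2.2⟩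
    calc _ ≤ ((PΩ \ PS) ∪ ⋃ i ∈ I, PD i).ncard := Set.ncard_le_ncard hsub
      _ ≤ (PΩ \ PS).ncard + (⋃ i ∈ I, PD i).ncard := Set.ncard_union_le _ _
      _ ≤ _ := by
        apply Nat.add_le_add
        · rw [Set.ncard_sdiff hPS]; exact le_rfl
        · exact (ncard_biUnion_le_sum I PD).trans (Finset.sum_le_sum h5)

/-- The part of `G - S` that contains `Ω \ S`, described through the components of `G - Ω`. -/
def blk (G : SimpleGraph V) (Ω : Set V) (D : ι → Set V) (S : Set V) : Set V :=
  {x | (x ∈ Ω ∧ x ∉ S) ∨ ∃ i, x ∈ D i ∧ ¬ nb G (D i) ⊆ S}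

/-- A component touching `Ω \ S` has a neighbour outside of `S` and so belongs to the block, and so
does every vertex of `Ω \ S`. Only `S` can be left outside. -/
lemma nb_blk_subset {G : SimpleGraph V} {Ω S : Set V} {D : ι → Set V} (hD : CompFam G Ω D) :
    nb G (blk G Ω D S) ⊆ S := by
  rintro u ⟨hu, x, hx, hxu⟩
  by_contra huS
  by_cases huΩ : u ∈ Ω
  · exact hu (Or.inl ⟨huΩ, huS⟩)
  · rcases hx with ⟨hxΩ, hxS⟩ | ⟨i, hxi, hi⟩
    · obtain ⟨i, hui⟩ := hD.cover u huΩ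
      refine hu (Or.inr ⟨i, hui, fun h => hxS (h ⟨?_, u, hui, hxu.symm⟩)⟩)
      exact fun h => hD.disj i x h hxΩ
    · rcases hD.mem_or hxi hxu with h | h
      · exact hu (Or.inr ⟨i, h, hi⟩)
      · exact huΩ h.1

/-! ### Blocks of a minimal triangulation and its maximal cliques. -/

section Triangulation

variable {G H : SimpleGraph V} {Ω : Set V} {D : ι → Set V}

lemma ConnIn.mono {C : Set V} (h : ConnIn G C) (hGH : G ≤ H) : ConnIn H C :=
  fun A hA hne hcl => h A hA hne fun a ha b hb hab => hcl a ha b hb (hGH hab)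

/-- The blocks that occur in the recursion along a minimal triangulation `H`. -/
structure Block (G H : SimpleGraph V) (C : Set V) : Prop where
  nonempty : C.Nonempty
  conn : ConnIn G C
  clique : H.IsClique (nb G C)
  back : nb G C = ∅ ∨ ∃ C' : Set V, C'.Nonempty ∧ ConnIn G C' ∧
    (∀ x ∈ C', x ∉ C ∧ x ∉ nb G C) ∧ nb G C' = nb G C

/-- The set `C'` on the far side avoids `Ω`, while its neighbours lie in `Ω`; being connected, it is
a whole component of `G - Ω`. Thus the separator can be found from `Ω` alone. -/
lemma Block.exists_sep {C : Set V} (hC : Block G H C) (hD : CompFam G Ω D)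
    (h1 : nb G C ⊆ Ω) (h2 : Ω ⊆ C ∪ nb G C) :
    nb G C = ∅ ∨ ∃ i, nb G C = nb G (D i) ∧ (D i).Nonempty := by
  rcases hC.back with h | ⟨C', ⟨x, hx⟩, hconn, hdisj, hnb⟩
  · exact Or.inl h
  · right
    have hdisj' : ∀ y ∈ C', y ∉ Ω := fun y hy hyΩ =>
      (h2 hyΩ).elim (hdisj y hy).1 (hdisj y hy).2
    obtain ⟨i, hi⟩ := hD.cover x (hdisj' x hx)
    have e1 : D i ∩ C' = D i := by
      apply hD.conn i _ Set.inter_subset_left ⟨x, hi, hx⟩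
      rintro a ⟨_, ha⟩ b hb hab
      refine ⟨hb, ?_⟩
      by_contra hbC
      have : b ∈ nb G C' := ⟨hbC, a, ha, hab⟩
      rw [hnb] at this
      exact hD.disj i b hb (h1 this)
    have e2 : D i ∩ C' = C' := by
      apply hconn _ Set.inter_subset_right ⟨x, hi, hx⟩
      rintro a ⟨ha, _⟩ b hb hab
      exact ⟨(hD.mem_or ha hab).resolve_right fun h => hdisj' b hb h.1, hb⟩
    refine ⟨i, ?_, x, hi⟩
    rw [← hnb, ← e1, e2]

/-- A component with a neighbour outside of `nb G C` touches `C`, and cannot leave it without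
meeting `nb G C ⊆ Ω`. A component meeting `C` whose neighbours all lie in `nb G C` would contain the
connected set `C`, which however meets `Ω`. -/
lemma Block.blk_eq {C : Set V} (hC : Block G H C) (hD : CompFam G Ω D)
    (h1 : nb G C ⊆ Ω) (h2 : Ω ⊆ C ∪ nb G C) (h3 : ∃ x ∈ C, x ∈ Ω) :
    blk G Ω D (nb G C) = C := by
  ext y
  constructor
  · rintro (⟨hy, hyS⟩ | ⟨i, hyi, hi⟩)
    · exact (h2 hy).resolve_right hyS
    · obtain ⟨u, ⟨hu1, d, hd, hdu⟩, huS⟩ := Set.not_subset.1 hi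
      have huC : u ∈ C := (h2 (hD.nb_sub i ⟨hu1, d, hd, hdu⟩)).resolve_right huS
      have hcl : ∀ a ∈ C, ∀ b ∈ D i, G.Adj a b → b ∈ C := by
        intro a ha b hb hab
        by_contra h
        exact hD.disj i b hb (h1 ⟨h, a, ha, hab⟩)
      have : C ∩ D i = D i := by
        apply hD.conn i _ Set.inter_subset_right ⟨d, hcl u huC d hd hdu.symm, hd⟩
        rintro a ⟨ha, _⟩ b hb hab
        exact ⟨hcl a ha b hb hab, hb⟩
      rw [← this] at hyi
      exact hyi.1
  · intro hy
    by_cases hyΩ : y ∈ Ω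
    · exact Or.inl ⟨hyΩ, fun h => h.1 hy⟩
    · obtain ⟨i, hyi⟩ := hD.cover y hyΩ
      refine Or.inr ⟨i, hyi, fun hi => ?_⟩
      have : C ∩ D i = C := by
        apply hC.conn _ Set.inter_subset_left ⟨y, hy, hyi⟩
        rintro a ⟨_, ha⟩ b hb hab
        refine ⟨hb, (hD.mem_or ha hab).resolve_right fun h => ?_⟩
        exact (hi h.2).1 hb
      obtain ⟨x, hx, hxΩ⟩ := h3
      rw [← this] at hx
      exact hD.disj i x hx.2 hxΩ

variable [Finite V]

/-- A component adjacent to all of `Ω` would contain a vertex complete to `Ω` by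
`IsChordal.exists_complete`, against the maximality of `Ω`. This is a property of potential maximal
cliques that fails for arbitrary sets. -/
lemma exists_mem_not_mem_nb [Nonempty V] (hH : IsMinimalTriangulation G H)
    (hΩ : Maximal H.IsClique Ω) (hD : CompFam G Ω D) (i : ι) : ∃ x ∈ Ω, x ∉ nb G (D i) := by
  by_contra hc
  push Not at hc
  have hne : Ω.Nonempty := by
    by_contra h
    rw [Set.not_nonempty_iff_eq_empty] at h
    obtain ⟨v⟩ := ‹Nonempty V›
    have := hΩ.le_of_ge (y := {v}) (by simp) (by simp [h])
    simp [h] at this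
  have hSΩ : nb G (D i) = Ω := Set.Subset.antisymm (hD.nb_sub i) hc
  obtain ⟨x, hx⟩ := hne
  have hDne : (D i).Nonempty := by
    obtain ⟨_, a, ha, _⟩ := hc x hx
    exact ⟨a, ha⟩
  obtain ⟨y, hy, hyc⟩ := hH.2.1.exists_complete hΩ.prop _ (D i) rfl hDne ((hD.conn i).mono hH.1)
    (by
      intro s hs
      obtain ⟨h1, a, ha, has⟩ := hc s hs
      exact ⟨h1, a, ha, hH.1 has⟩)
  have := hΩ.le_of_ge (y := insert y Ω) (by
    rw [isClique_insert]
    exact ⟨hΩ.prop, fun b hb _ => hyc b hb⟩) (Set.subset_insert _ _)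
  exact hD.disj i y hy (this (Set.mem_insert _ _))

/-- A vertex `s` of the separator is joined in `H` to some `x ∈ Ω` in the block. If `s` were not a
neighbour of the block in `G`, this edge would be one that `not_adj` forbids. -/
lemma nb_blk [Nonempty V] (hH : IsMinimalTriangulation G H)
    (hΩ : Maximal H.IsClique Ω) (hD : CompFam G Ω D) (i : ι) :
    nb G (blk G Ω D (nb G (D i))) = nb G (D i) := by
  have hsub := nb_blk_subset (S := nb G (D i)) hD
  refine Set.Subset.antisymm hsub fun s hs => ?_
  obtain ⟨x, hx, hxS⟩ := exists_mem_not_mem_nb hH hΩ hD i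
  have hsΩ := hD.nb_sub i hs
  by_contra hn
  refine hH.not_adj (A := blk G Ω D (nb G (D i)))
    (hΩ.prop.subset (hsub.trans (hD.nb_sub i))) (a := x) (b := s) (Or.inl ⟨hx, hxS⟩) ?_ hn
    (hΩ.prop hx hsΩ ?_)
  · rintro (h | ⟨j, hj, _⟩)
    · exact h.2 hs
    · exact hD.disj j s hj hsΩ
  · rintro rfl; exact hxS hs

/-- If the block fell apart, both parts would contain vertices of `Ω`. These are adjacent in `H`,
although the neighbours of one part lie in the clique `S`, which contradicts `not_adj`. -/
lemma blk_conn (hH : IsMinimalTriangulation G H)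
    (hΩ : Maximal H.IsClique Ω) (hD : CompFam G Ω D) {S : Set V} (hSΩ : S ⊆ Ω) :
    ConnIn G (blk G Ω D S) := by
  -- a union of components of the block meets, and hence contains, the rest of the clique
  have key : ∀ A ⊆ blk G Ω D S, A.Nonempty →
      (∀ a ∈ A, ∀ b ∈ blk G Ω D S, G.Adj a b → b ∈ A) → (∃ x ∈ A, x ∈ Ω) ∧ nb G A ⊆ S ∧
        ∀ i, ¬ nb G (D i) ⊆ S → (∃ x ∈ A, x ∈ D i) → D i ⊆ A := by
    intro A hA hne hcl
    have hDi : ∀ i, ¬ nb G (D i) ⊆ S → (∃ x ∈ A, x ∈ D i) → D i ⊆ A := by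
      rintro i hi ⟨x, hxA, hxi⟩
      have : A ∩ D i = D i := by
        apply hD.conn i _ Set.inter_subset_right ⟨x, hxA, hxi⟩
        rintro a ⟨haA, _⟩ b hb hab
        exact ⟨hcl a haA b (Or.inr ⟨i, hb, hi⟩) hab, hb⟩
      rw [← this]; exact Set.inter_subset_left
    refine ⟨?_, ?_, hDi⟩
    · obtain ⟨x, hx⟩ := hne
      rcases hA hx with h | ⟨i, hxi, hi⟩
      · exact ⟨x, hx, h.1⟩
      · obtain ⟨u, ⟨hu1, d, hd, hdu⟩, huS⟩ := Set.not_subset.1 hi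
        have huΩ : u ∈ Ω := hD.nb_sub i ⟨hu1, d, hd, hdu⟩
        exact ⟨u, hcl d (hDi i hi ⟨x, hx, hxi⟩ hd) u (Or.inl ⟨huΩ, huS⟩) hdu, huΩ⟩
    · rintro u ⟨hu, a, ha, hau⟩
      by_contra huS
      have : u ∉ blk G Ω D S := fun h => hu (hcl a ha u h hau)
      exact huS (nb_blk_subset hD ⟨this, a, hA ha, hau⟩)
  intro A hA hne hcl
  obtain ⟨⟨x, hxA, hxΩ⟩, hnb, hDA⟩ := key A hA hne hcl
  by_contra hAne
  have hne' : (blk G Ω D S \ A).Nonempty := by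
    by_contra h
    rw [Set.not_nonempty_iff_eq_empty, Set.sdiff_eq_empty] at h
    exact hAne (Set.Subset.antisymm hA h)
  obtain ⟨⟨y, hyA, hyΩ⟩, _, _⟩ := key _ Set.sdiff_subset hne' (by
    rintro a ⟨ha, haA⟩ b hb hab
    exact ⟨hb, fun hbA => haA (hcl b hbA a ha hab.symm)⟩)
  have hyS : y ∉ S := by
    rcases hyA.1 with h | ⟨i, h, _⟩
    · exact h.2
    · exact absurd hyΩ (hD.disj i y h)
  refine hH.not_adj (A := A) (hΩ.prop.subset (hnb.trans hSΩ)) hxA hyA.2 (fun h => hyS (hnb h)) ?_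
  exact hΩ.prop hxΩ hyΩ fun h => hyA.2 (h ▸ hxA)

/-- A vertex `x` of `C` complete to the separator extends it to a larger clique, and any maximal
clique above that works: it cannot leave `C ∪ nb G C`, because `x` has no neighbour there by
`not_adj`. -/
lemma Block.exists_clique (hH : IsMinimalTriangulation G H) {C : Set V} (hC : Block G H C) :
    ∃ Ω, Maximal H.IsClique Ω ∧ nb G C ⊆ Ω ∧ Ω ⊆ C ∪ nb G C ∧ ∃ x ∈ C, x ∈ Ω := by
  obtain ⟨x, hx, hxc⟩ := hH.2.1.exists_complete hC.clique _ C rfl hC.nonempty (hC.conn.mono hH.1)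
    (by
      rintro s ⟨h1, a, ha, has⟩
      exact ⟨h1, a, ha, hH.1 has⟩)
  obtain ⟨Ω, hle, hΩ⟩ := Finite.exists_le_maximal (p := H.IsClique) (a := insert x (nb G C)) (by
    rw [isClique_insert]
    exact ⟨hC.clique, fun b hb _ => hxc b hb⟩)
  refine ⟨Ω, hΩ, (Set.subset_insert _ _).trans hle, fun y hy => ?_, x, hx,
    hle (Set.mem_insert _ _)⟩
  by_contra h
  rw [Set.mem_union, not_or] at h
  refine hH.not_adj hC.clique hx h.1 h.2 (hΩ.prop (hle (Set.mem_insert _ _)) hy ?_)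
  rintro rfl
  exact h.1 hx

/-- The part of the graph containing the rest of `Ω` serves as the far side of the separator; it is
connected and has the same neighbours by `blk_conn` and `nb_blk`. -/
lemma block_component [Nonempty V] (hH : IsMinimalTriangulation G H)
    (hΩ : Maximal H.IsClique Ω) (hD : CompFam G Ω D) (i : ι) (hi : (D i).Nonempty) :
    Block G H (D i) := by
  refine ⟨hi, hD.conn i, hΩ.prop.subset (hD.nb_sub i), Or.inr
    ⟨blk G Ω D (nb G (D i)), ?_, blk_conn hH hΩ hD (hD.nb_sub i), ?_, nb_blk hH hΩ hD i⟩⟩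
  · obtain ⟨x, hx, hxS⟩ := exists_mem_not_mem_nb hH hΩ hD i
    exact ⟨x, Or.inl ⟨hx, hxS⟩⟩
  · rintro x (⟨hx, hxS⟩ | ⟨j, hj, hj'⟩)
    · exact ⟨fun h => hD.disj i x h hx, hxS⟩
    · refine ⟨fun h => hj' ?_, fun h => hD.disj j x hj (hD.nb_sub i h)⟩
      rw [hD.inj j i x hj h]

/-- By `not_adj` an edge of `H` from `D i` ends in `D i` or in `Ω`. So the pairs inside `Ω` and the
pairs meeting the various components are disjoint families, all counted on the right. -/
lemma sum_fillOn_le (hH : IsMinimalTriangulation G H) (hΩ : H.IsClique Ω)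
    (hD : CompFam G Ω D) {S C : Set V} (hSΩ : S ⊆ Ω) (hΩC : ∀ x ∈ Ω, x ∉ S → x ∈ C)
    (I : Finset ι) (hI : ∀ i ∈ I, D i ⊆ C) :
    fill2 G Ω - fill2 G S + ∑ i ∈ I, fillOn G H (D i) ≤ fillOn G H C := by
  let PΩ := {p : V × V | p.1 ∈ Ω ∧ p.2 ∈ Ω ∧ p.1 ≠ p.2 ∧ ¬ G.Adj p.1 p.2}
  let PS := {p : V × V | p.1 ∈ S ∧ p.2 ∈ S ∧ p.1 ≠ p.2 ∧ ¬ G.Adj p.1 p.2}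
  let PD := fun i => {p : V × V | H.Adj p.1 p.2 ∧ ¬ G.Adj p.1 p.2 ∧ (p.1 ∈ D i ∨ p.2 ∈ D i)}
  have hcl : ∀ i x y, x ∈ D i → H.Adj x y → y ∈ D i ∨ y ∈ Ω := by
    intro i x y hx hxy
    by_contra h
    rw [not_or] at h
    exact hH.not_adj (hΩ.subset (hD.nb_sub i)) hx h.1 (fun h' => h.2 (hD.nb_sub i h')) hxy
  have hPS : PS ⊆ PΩ := fun p hp => ⟨hSΩ hp.1, hSΩ hp.2.1, hp.2.2⟩
  have hdis : ∀ i ∈ I, ∀ j ∈ I, i ≠ j → Disjoint (PD i) (PD j) := by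
    intro i _ j _ hij
    rw [Set.disjoint_left]
    have hne : ∀ x y, H.Adj x y → x ∈ D i → y ∈ D j → False := fun x y hxy hx hy => by
      rcases hcl i x y hx hxy with h | h
      · exact hij (hD.inj i j y h hy)
      · exact hD.disj j y hy h
    rintro ⟨x, y⟩ ⟨hxy, _, h⟩ ⟨_, _, h'⟩
    rcases h with h | h <;> rcases h' with h' | h'
    · exact hij (hD.inj i j _ h h')
    · exact hne x y hxy h h'
    · exact hne y x hxy.symm h h'
    · exact hij (hD.inj i j _ h h')
  have hdis' : Disjoint (PΩ \ PS) (⋃ i ∈ I, PD i) := by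
    rw [Set.disjoint_left]
    rintro p ⟨hp, _⟩ hp'
    simp only [Set.mem_iUnion] at hp'
    obtain ⟨i, _, _, _, h | h⟩ := hp'
    · exact hD.disj i _ h hp.1
    · exact hD.disj i _ h hp.2.1
  calc _ = (PΩ \ PS).ncard + (⋃ i ∈ I, PD i).ncard := by
        rw [← sum_ncard_eq_ncard_biUnion I PD hdis, Set.ncard_sdiff hPS]; rfl
    _ = ((PΩ \ PS) ∪ ⋃ i ∈ I, PD i).ncard := (Set.ncard_union_eq hdis').symm
    _ ≤ _ := by
      refine Set.ncard_le_ncard ?_ (Set.toFinite _)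
      rintro p (⟨hp, hpS⟩ | hp)
      · refine ⟨hΩ hp.1 hp.2.1 hp.2.2.1, hp.2.2.2, ?_⟩
        by_contra h
        rw [not_or] at h
        refine hpS ⟨?_, ?_, hp.2.2⟩
        · by_contra h'; exact h.1 (hΩC _ hp.1 h')
        · by_contra h'; exact h.2 (hΩC _ hp.2.1 h')
      · simp only [Set.mem_iUnion] at hp
        obtain ⟨i, hi, h1, h2, h3⟩ := hp
        exact ⟨h1, h2, h3.imp (fun h => hI i hi h) (fun h => hI i hi h)⟩

end Triangulation

end Families

/-! ### Sound and complete tables of block values. -/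

section Table

variable {V ι : Type*} [Finite V] {G H : SimpleGraph V} {Ω : Set V} {D : ι → Set V} {K : ℕ}

/-- A nonzero entry `a` of the table certifies a triangulation of the block with at most `K - a`
new ordered pairs. -/
def SoundTable (G : SimpleGraph V) (K : ℕ) (t : Set V → ℕ) : Prop :=
  ∀ A, t A ≠ 0 → t A ≤ K ∧ Fillable G A (K - t A)

/-- The entries for the blocks of `H` with fewer than `r` vertices are at least as good as `H`. -/
def CompleteTable (G H : SimpleGraph V) (K : ℕ) (t : Set V → ℕ) (r : ℕ) : Prop :=
  ∀ C, Block G H C → C.ncard < r → K - fillOn G H C ≤ t C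

/-- A single zero entry contributes the whole `K` and sends the truncated difference to zero. A
nonzero result therefore certifies every entry that was used. -/
lemma ne_zero_of_sub_sum_ne_zero {ι : Type*} {K w : ℕ} {I : Finset ι} {f : ι → ℕ}
    (h : K - w - ∑ i ∈ I, (K - f i) ≠ 0) : ∀ i ∈ I, f i ≠ 0 := by
  intro i hi h0
  have := Finset.single_le_sum (f := fun i => K - f i) (fun _ _ => Nat.zero_le _) hi
  simp only [h0] at this
  omega

/-- That `Ω` is a potential maximal clique matters here only through `nb_blk`, which provides the
separator that `glue` requires. -/
lemma SoundTable.glue [Nonempty V] {t : Set V → ℕ} (ht : SoundTable G K t)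
    (hH : IsMinimalTriangulation G H) (hΩ : Maximal H.IsClique Ω) (hD : CompFam G Ω D) (v : ι)
    (I : Finset ι) (hI : ∀ i, i ∈ I ↔ ¬ nb G (D i) ⊆ nb G (D v))
    (h : K - (fill2 G Ω - fill2 G (nb G (D v))) - ∑ i ∈ I, (K - t (D i)) ≠ 0) :
    Fillable G (blk G Ω D (nb G (D v)))
      (K - (K - (fill2 G Ω - fill2 G (nb G (D v))) - ∑ i ∈ I, (K - t (D i)))) := by
  have h0 := ne_zero_of_sub_sum_ne_zero h
  refine (MinFill.glue hD (hD.nb_sub v) I ?_ (nb_blk hH hΩ hD v) (fun i => K - t (D i))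
    fun i hi => (ht _ (h0 i hi)).2).mono (by omega)
  intro x
  simp only [blk, Set.mem_ofPred_eq]
  refine or_congr_right ⟨?_, ?_⟩
  · rintro ⟨i, hx, hi⟩; exact ⟨i, (hI i).2 hi, hx⟩
  · rintro ⟨i, hi, hx⟩; exact ⟨i, hx, (hI i).1 hi⟩

/-- For each block of `H` there is a maximal clique of `H` that explains the value of the block
through smaller blocks. -/
lemma Block.exists_step [Nonempty V] (hH : IsMinimalTriangulation G H) {C : Set V}
    (hC : Block G H C) : ∃ Ω, Maximal H.IsClique Ω ∧ ∀ D : ι → Set V, CompFam G Ω D →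
      (nb G C = ∅ ∨ ∃ i, nb G C = nb G (D i) ∧ (D i).Nonempty) ∧
      blk G Ω D (nb G C) = C ∧ ∀ I : Finset ι, (∀ i, i ∈ I ↔ ¬ nb G (D i) ⊆ nb G C) →
        ∀ t, CompleteTable G H K t C.ncard → K - fillOn G H C ≤
          K - (fill2 G Ω - fill2 G (nb G C)) - ∑ i ∈ I, (K - t (D i)) := by
  obtain ⟨Ω, hΩ, h1, h2, h3⟩ := hC.exists_clique hH
  refine ⟨Ω, hΩ, fun D hD => ?_⟩
  have hblk := hC.blk_eq hD h1 h2 h3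
  refine ⟨hC.exists_sep hD h1 h2, hblk, fun I hI t ht => ?_⟩
  have hsub : ∀ i ∈ I, D i ⊆ C := by
    intro i hi x hx
    rw [← hblk]
    exact Or.inr ⟨i, hx, (hI i).1 hi⟩
  have hle := sum_fillOn_le hH hΩ.prop hD h1 (fun x hx hxS => (h2 hx).resolve_right hxS) I hsub
  have hsum : ∑ i ∈ I, (K - t (D i)) ≤ ∑ i ∈ I, fillOn G H (D i) := by
    apply Finset.sum_le_sum
    intro i hi
    have hne : (D i).Nonempty := by
      obtain ⟨u, ⟨_, d, hd, _⟩, _⟩ := Set.not_subset.1 ((hI i).1 hi)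
      exact ⟨d, hd⟩
    -- The component is strictly smaller than `C`, since it misses the vertex of `C` that lies in
    -- `Ω`.
    have := ht _ (block_component hH hΩ hD i hne) (by
      apply Set.ncard_lt_ncard _ (Set.toFinite _)
      refine ⟨hsub i hi, fun h => ?_⟩
      obtain ⟨x, hx, hxΩ⟩ := h3
      exact hD.disj i x (h hx) hxΩ)
    omega
  omega

/-- The whole graph is glued from its components along the empty clique. Those outside of `I` have
no edges and are filled by `⊥` at no cost, so the table need not know them. -/
lemma SoundTable.isYesInstance [Fintype ι] {t : Set V → ℕ} {k : ℕ} (ht : SoundTable G (2 * k + 1) t)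
    (hD : CompFam G ∅ D) (I : Finset ι)
    (hI : ∀ i, i ∉ I → ∀ x ∈ D i, ∀ y, ¬ G.Adj x y)
    (h : 2 * k + 1 - ∑ i ∈ I, (2 * k + 1 - t (D i)) ≠ 0) : IsYesInstance G k := by
  classical
  have h0 := ne_zero_of_sub_sum_ne_zero (w := 0) h
  have hnb : nb G Set.univ = ∅ := by ext; simp [nb]
  refine (MinFill.glue (S := ∅) (C := Set.univ) hD (by simp) Finset.univ (fun x => ?_) hnb
    (fun i => if i ∈ I then 2 * k + 1 - t (D i) else 0) fun i _ => ?_).isYesInstance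
    (k := k) ?_
  · obtain ⟨i, hi⟩ := hD.cover x (by simp)
    simpa using ⟨i, hi⟩
  · by_cases hi : i ∈ I
    · simpa [hi] using (ht _ (h0 i hi)).2
    · simp only [hi, if_false]
      exact ⟨⊥, fun x hx y hxy => absurd hxy (hI i hi x hx y), by simp, by simp,
        fun X ⟨x, hx⟩ => ⟨x, hx, by simp⟩, by simp⟩
  · rw [Finset.sum_ite_mem, Finset.univ_inter]
    simp only [tsub_self]
    omega

/-- The fill pairs of the components are disjoint and number at most `2 * k`, one less than the
constant from which they are subtracted. -/
lemma CompleteTable.ne_zero {t : Set V → ℕ} {k r : ℕ} (hH : IsMinimalTriangulation G H)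
    (hk : fillOn G H Set.univ ≤ 2 * k) (ht : CompleteTable G H (2 * k + 1) t r)
    (hr : (Set.univ : Set V).ncard < r)
    (hD : CompFam G ∅ D) (I : Finset ι) (hI : ∀ i ∈ I, (D i).Nonempty) :
    2 * k + 1 - ∑ i ∈ I, (2 * k + 1 - t (D i)) ≠ 0 := by
  have hsum : ∑ i ∈ I, (2 * k + 1 - t (D i)) ≤ ∑ i ∈ I, fillOn G H (D i) := by
    apply Finset.sum_le_sum
    intro i hi
    have hnb : nb G (D i) = ∅ := Set.subset_empty_iff.1 (hD.nb_sub i)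
    have := ht (D i) ⟨hI i hi, hD.conn i, by rw [hnb]; simp, Or.inl hnb⟩
      ((Set.ncard_le_ncard (Set.subset_univ _)).trans_lt hr)
    omega
  have := sum_fillOn_le (C := Set.univ) (S := ∅) hH (by simp) hD (by simp) (by simp) I (by simp)
  omega

end Table

/-! ### Executions without a word bound -/

namespace State

/-- Assign to a register. -/
def setReg (s : State) (r v : ℕ) : State := ⟨Function.update s.reg r v, s.mem⟩

/-- Assign to an array cell. -/
def setMem (s : State) (a i v : ℕ) : State :=
  ⟨s.reg, Function.update s.mem a (Function.update (s.mem a) i v)⟩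

@[simp] lemma setReg_reg (s : State) (r v r' : ℕ) :
    (s.setReg r v).reg r' = if r' = r then v else s.reg r' := by
  simp [setReg, Function.update_apply]

@[simp] lemma setReg_mem (s : State) (r v : ℕ) : (s.setReg r v).mem = s.mem := rfl

@[simp] lemma setMem_reg (s : State) (a i v : ℕ) : (s.setMem a i v).reg = s.reg := rfl

@[simp] lemma setMem_mem (s : State) (a i v a' : ℕ) :
    (s.setMem a i v).mem a' = if a' = a then Function.update (s.mem a) i v else s.mem a' := by
  simp only [setMem, Function.update_apply]

/-- All registers and cells are at most `B`. -/
def AllLe (B : ℕ) (s : State) : Prop := (∀ r, s.reg r ≤ B) ∧ ∀ a i, s.mem a i ≤ B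

lemma AllLe.setReg {B : ℕ} {s : State} (h : AllLe B s) {r v : ℕ} (hv : v ≤ B) :
    AllLe B (s.setReg r v) := by
  refine ⟨fun r' => ?_, h.2⟩
  rw [setReg_reg]; split_ifs
  · exact hv
  · exact h.1 r'

lemma AllLe.setMem {B : ℕ} {s : State} (h : AllLe B s) {a i v : ℕ} (hv : v ≤ B) :
    AllLe B (s.setMem a i v) := by
  refine ⟨h.1, fun a' j => ?_⟩
  rw [setMem_mem]; split_ifs
  · rw [Function.update_apply]; split_ifs
    · exact hv
    · exact h.2 a j
  · exact h.2 a' j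

lemma AllLe.mono {B B' : ℕ} {s : State} (h : AllLe B s) (hB : B ≤ B') : AllLe B' s :=
  ⟨fun r => (h.1 r).trans hB, fun a i => (h.2 a i).trans hB⟩

end State

/-- `Steps p s t s'`: the program `p` started in `s` halts after `t` steps in `s'`, on a machine
without a word bound. -/
inductive Steps : Program → State → ℕ → State → Prop
  | skip (s : State) : Steps Program.skip s 1 s
  | set (s : State) (r : ℕ) (e : Expr) :
      Steps (Program.set r e) s (e.cost + 1) (s.setReg r (e.eval s))
  | store (s : State) (a : ℕ) (i e : Expr) :
      Steps (Program.store a i e) s (i.cost + e.cost + 1) (s.setMem a (i.eval s) (e.eval s))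
  | seq {s₁ s₂ s₃ : State} {t₁ t₂ : ℕ} {p q : Program}
      (hp : Steps p s₁ t₁ s₂) (hq : Steps q s₂ t₂ s₃) : Steps (Program.seq p q) s₁ (t₁ + t₂) s₃
  | ite_true {s s' : State} {t : ℕ} {e : Expr} {p q : Program}
      (h : e.eval s ≠ 0) (hp : Steps p s t s') : Steps (Program.ite e p q) s (e.cost + 1 + t) s'
  | ite_false {s s' : State} {t : ℕ} {e : Expr} {p q : Program}
      (h : e.eval s = 0) (hq : Steps q s t s') : Steps (Program.ite e p q) s (e.cost + 1 + t) s'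
  | loop_false {s : State} {e : Expr} {p : Program} (h : e.eval s = 0) :
      Steps (Program.loop e p) s (e.cost + 1) s
  | loop_true {s₁ s₂ s₃ : State} {t₁ t₂ : ℕ} {e : Expr} {p : Program}
      (h : e.eval s₁ ≠ 0) (hp : Steps p s₁ t₁ s₂) (hl : Steps (Program.loop e p) s₂ t₂ s₃) :
      Steps (Program.loop e p) s₁ (e.cost + 1 + t₁ + t₂) s₃

/-! ### Word bounds -/

/-- The value of the expression exceeds the largest value of the state by at most its cost. -/
def Expr.tame : Expr → Bool
  | lit a => a ≤ 4
  | reg _ => true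
  | load _ _ => true
  | add e (lit a) => e.tame && decide (a ≤ 1)
  | add _ _ => false
  | sub e _ => e.tame
  | mul _ _ => false

/-- All literals are at most `4`. -/
def Expr.small : Expr → Bool
  | lit a => a ≤ 4
  | reg _ => true
  | load _ i => i.small
  | add e f => e.small && f.small
  | sub e f => e.small && f.small
  | mul e f => e.small && f.small

/-- All expressions are short, with small literals, and all assigned ones are tame. -/
def Program.tame : Program → Bool
  | skip => true
  | set _ e => e.tame && e.small && decide (e.cost ≤ 30)
  | store _ i e => i.small && decide (i.cost ≤ 30) && e.tame && e.small && decide (e.cost ≤ 30)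
  | seq p q => p.tame && q.tame
  | ite e p q => e.small && decide (e.cost ≤ 30) && p.tame && q.tame
  | loop e p => e.small && decide (e.cost ≤ 30) && p.tame

/-- Only literals are added. A subtrahend is unrestricted, as truncated subtraction never exceeds
the minuend; products may thus occur there. -/
lemma Expr.eval_le_of_tame {B : ℕ} {s : State} (hB : 4 ≤ B) (hs : s.AllLe B) :
    ∀ e : Expr, e.tame → e.eval s ≤ B + e.cost
  | lit a, h => by
    simp only [tame, decide_eq_true_eq] at h
    simp only [eval]; omega
  | reg r, _ => by have := hs.1 r; simp only [eval]; omega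
  | load a i, _ => by have := hs.2 a (i.eval s); simp only [eval]; omega
  | add e (lit a), h => by
    simp only [tame, Bool.and_eq_true, decide_eq_true_eq] at h
    have := eval_le_of_tame hB hs e h.1
    simp only [eval, cost]; omega
  | sub e f, h => by
    simp only [tame] at h
    have := eval_le_of_tame hB hs e h
    simp only [eval, cost]; omega
  | add _ (reg _), h => by simp [tame] at h
  | add _ (load _ _), h => by simp [tame] at h
  | add _ (add _ _), h => by simp [tame] at h
  | add _ (sub _ _), h => by simp [tame] at h
  | add _ (mul _ _), h => by simp [tame] at h
  | mul _ _, h => by simp [tame] at h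

/-- Each symbol contributes at most one factor `B` to intermediate values; a sum is absorbed because
`B` is at least two. -/
lemma Expr.fits_of_small {B W : ℕ} {s : State} (hB : 4 ≤ B) (hs : s.AllLe B) :
    ∀ e : Expr, e.small → B ^ e.cost < W → e.Fits W s ∧ e.eval s ≤ B ^ e.cost
  | lit a, h, hW => by
    simp only [small, decide_eq_true_eq] at h
    simp only [Fits, eval, cost, pow_one] at *
    omega
  | reg r, _, hW => by
    have := hs.1 r
    simp only [Fits, eval, cost, pow_one] at *
    omega
  | load a i, h, hW => by
    simp only [cost, small] at *
    have h1 : B ^ i.cost ≤ B ^ (i.cost + 1) := Nat.pow_le_pow_right (by omega) (by omega)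
    have h2 : B ≤ B ^ (i.cost + 1) := Nat.le_self_pow (by omega) B
    have := hs.2 a (i.eval s)
    exact ⟨⟨(fits_of_small hB hs i h (by omega)).1, by omega⟩, by simp only [eval]; omega⟩
  | add e f, h, hW => by
    simp only [cost, small, Bool.and_eq_true] at *
    have hle : B ^ e.cost + B ^ f.cost ≤ B ^ (e.cost + f.cost + 1) := by
      have h1 : B ^ e.cost ≤ B ^ (e.cost + f.cost) := Nat.pow_le_pow_right (by omega) (by omega)
      have h2 : B ^ f.cost ≤ B ^ (e.cost + f.cost) := Nat.pow_le_pow_right (by omega) (by omega)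
      have h3 : B ^ (e.cost + f.cost) * 2 ≤ B ^ (e.cost + f.cost) * B :=
        Nat.mul_le_mul_left _ (by omega)
      rw [pow_succ]
      omega
    obtain ⟨a1, a2⟩ := fits_of_small hB hs e h.1 (W := W) (by omega)
    obtain ⟨b1, b2⟩ := fits_of_small hB hs f h.2 (W := W) (by omega)
    exact ⟨⟨a1, b1, by omega⟩, by simp only [eval]; omega⟩
  | sub e f, h, hW => by
    simp only [cost, small, Bool.and_eq_true] at *
    have h1 : B ^ e.cost ≤ B ^ (e.cost + f.cost + 1) := Nat.pow_le_pow_right (by omega) (by omega)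
    have h2 : B ^ f.cost ≤ B ^ (e.cost + f.cost + 1) := Nat.pow_le_pow_right (by omega) (by omega)
    obtain ⟨a1, a2⟩ := fits_of_small hB hs e h.1 (W := W) (by omega)
    obtain ⟨b1, b2⟩ := fits_of_small hB hs f h.2 (W := W) (by omega)
    exact ⟨⟨a1, b1⟩, by simp only [eval]; omega⟩
  | mul e f, h, hW => by
    simp only [cost, small, Bool.and_eq_true] at *
    have hle : B ^ e.cost * B ^ f.cost ≤ B ^ (e.cost + f.cost + 1) := by
      rw [← pow_add]
      exact Nat.pow_le_pow_right (by omega) (by omega)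
    have h1 : B ^ e.cost ≤ B ^ (e.cost + f.cost + 1) := Nat.pow_le_pow_right (by omega) (by omega)
    have h2 : B ^ f.cost ≤ B ^ (e.cost + f.cost + 1) := Nat.pow_le_pow_right (by omega) (by omega)
    obtain ⟨a1, a2⟩ := fits_of_small hB hs e h.1 (W := W) (by omega)
    obtain ⟨b1, b2⟩ := fits_of_small hB hs f h.2 (W := W) (by omega)
    have := Nat.mul_le_mul a2 b2
    exact ⟨⟨a1, b1, by omega⟩, by simp only [eval]; omega⟩

lemma Expr.fits_of_cost_le {B W : ℕ} {s : State} (hB : 4 ≤ B) (hs : s.AllLe B) {e : Expr}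
    (he : e.small) (hc : e.cost ≤ 30) (hW : B ^ 30 < W) : e.Fits W s :=
  (e.fits_of_small hB hs he ((Nat.pow_le_pow_right (by omega) hc).trans_lt hW)).1

/-- A tame program that halts in `t` steps without a word bound also does so with a word bound
that is polynomial in `t` and the largest initial value. -/
lemma Steps.exec {W : ℕ} {p : Program} {s s' : State} {t : ℕ} (h : Steps p s t s') :
    ∀ {B : ℕ}, p.tame → 4 ≤ B → s.AllLe B → (B + t) ^ 30 < W →
      Exec W p s t s' ∧ s'.AllLe (B + t) := by
  have hmon : ∀ {a b : ℕ}, a ≤ b → b ^ 30 < W → a ^ 30 < W :=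
    fun hab hb => (Nat.pow_le_pow_left hab 30).trans_lt hb
  -- The bound on stored values grows additively with time. The exponent 30, the largest cost of an
  -- expression, is applied only to temporary values and never accumulates.
  induction h with
  | skip s => exact fun _ _ hs _ => ⟨Exec.skip s, hs.mono (by omega)⟩
  | set s r e =>
    intro B hp hB hs hW
    simp only [Program.tame, Bool.and_eq_true, decide_eq_true_eq] at hp
    have hv := e.eval_le_of_tame hB hs hp.1.1
    exact ⟨Exec.set s r e (e.fits_of_cost_le hB hs hp.1.2 hp.2 (hmon (by omega) hW)),
      (hs.mono (by omega)).setReg (by omega)⟩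
  | store s a i e =>
    intro B hp hB hs hW
    simp only [Program.tame, Bool.and_eq_true, decide_eq_true_eq] at hp
    have hv := e.eval_le_of_tame hB hs hp.1.1.2
    have hW' := hmon (show B ≤ B + (i.cost + e.cost + 1) by omega) hW
    exact ⟨Exec.store s a i e (i.fits_of_cost_le hB hs hp.1.1.1.1 hp.1.1.1.2 hW')
      (e.fits_of_cost_le hB hs hp.1.2 hp.2 hW'), (hs.mono (by omega)).setMem (by omega)⟩
  | seq _ _ ih1 ih2 =>
    intro B hp hB hs hW
    simp only [Program.tame, Bool.and_eq_true] at hp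
    obtain ⟨h1, h2⟩ := ih1 hp.1 hB hs (hmon (by omega) hW)
    obtain ⟨h3, h4⟩ := ih2 hp.2 (by omega) h2 (hmon (by omega) hW)
    exact ⟨Exec.seq _ _ _ _ _ _ _ h1 h3, h4.mono (by omega)⟩
  | ite_true h _ ih =>
    intro B hp hB hs hW
    simp only [Program.tame, Bool.and_eq_true, decide_eq_true_eq] at hp
    obtain ⟨h1, h2⟩ := ih hp.1.2 hB hs (hmon (by omega) hW)
    exact ⟨Exec.ite_true _ _ _ _ _ _ (Expr.fits_of_cost_le hB hs hp.1.1.1 hp.1.1.2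
      (hmon (by omega) hW)) h h1, h2.mono (by omega)⟩
  | ite_false h _ ih =>
    intro B hp hB hs hW
    simp only [Program.tame, Bool.and_eq_true, decide_eq_true_eq] at hp
    obtain ⟨h1, h2⟩ := ih hp.2 hB hs (hmon (by omega) hW)
    exact ⟨Exec.ite_false _ _ _ _ _ _ (Expr.fits_of_cost_le hB hs hp.1.1.1 hp.1.1.2
      (hmon (by omega) hW)) h h1, h2.mono (by omega)⟩
  | loop_false h =>
    intro B hp hB hs hW
    simp only [Program.tame, Bool.and_eq_true, decide_eq_true_eq] at hp
    exact ⟨Exec.loop_false _ _ _ (Expr.fits_of_cost_le hB hs hp.1.1 hp.1.2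
      (hmon (by omega) hW)) h, hs.mono (by omega)⟩
  | loop_true h _ _ ih1 ih2 =>
    intro B hp hB hs hW
    have hp' := hp
    simp only [Program.tame, Bool.and_eq_true, decide_eq_true_eq] at hp
    obtain ⟨h1, h2⟩ := ih1 hp.2 hB hs (hmon (by omega) hW)
    obtain ⟨h3, h4⟩ := ih2 hp' (by omega) h2 (hmon (by omega) hW)
    exact ⟨Exec.loop_true _ _ _ _ _ _ _ (Expr.fits_of_cost_le hB hs hp.1.1 hp.1.2
      (hmon (by omega) hW)) h h1 h3, h4.mono (by omega)⟩

/-! ### Frames -/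

namespace Program

/-- Whether the program assigns to the register `r`. -/
def writesReg : Program → ℕ → Bool
  | skip, _ => false
  | set r' _, r => r' == r
  | store _ _ _, _ => false
  | seq p q, r => p.writesReg r || q.writesReg r
  | ite _ p q, r => p.writesReg r || q.writesReg r
  | loop _ p, r => p.writesReg r

/-- Whether the program assigns to the array `a`. -/
def writesMem : Program → ℕ → Bool
  | skip, _ => false
  | set _ _, _ => false
  | store a' _ _, a => a' == a
  | seq p q, a => p.writesMem a || q.writesMem a
  | ite _ p q, a => p.writesMem a || q.writesMem a
  | loop _ p, a => p.writesMem a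

end Program

/-- The states agree outside of the registers and arrays to which `p` assigns. -/
structure Agree (p : Program) (s s' : State) : Prop where
  reg : ∀ r, p.writesReg r = false → s'.reg r = s.reg r
  mem : ∀ a, p.writesMem a = false → s'.mem a = s.mem a

/-- Since `writesReg` and `writesMem` are Boolean functions, frame conditions for concrete programs
are discharged by `rfl`. -/
lemma Steps.agree {p : Program} {s s' : State} {t : ℕ} (h : Steps p s t s') : Agree p s s' := by
  induction h with
  | skip s => exact ⟨fun _ _ => rfl, fun _ _ => rfl⟩
  | set s r e =>
    refine ⟨fun r' h => ?_, fun _ _ => rfl⟩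
    have h' : r' ≠ r := fun e => by simp [Program.writesReg, e] at h
    simp [h']
  | store s a i e =>
    refine ⟨fun _ _ => rfl, fun a' h => ?_⟩
    have h' : a' ≠ a := fun e => by simp [Program.writesMem, e] at h
    simp [h']
  | seq _ _ ih1 ih2 =>
    constructor
    · intro r h
      simp only [Program.writesReg, Bool.or_eq_false_iff] at h
      rw [ih2.reg r h.2, ih1.reg r h.1]
    · intro r h
      simp only [Program.writesMem, Bool.or_eq_false_iff] at h
      rw [ih2.mem r h.2, ih1.mem r h.1]
  | ite_true _ _ ih =>
    constructor
    · intro r h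
      simp only [Program.writesReg, Bool.or_eq_false_iff] at h
      exact ih.reg r h.1
    · intro r h
      simp only [Program.writesMem, Bool.or_eq_false_iff] at h
      exact ih.mem r h.1
  | ite_false _ _ ih =>
    constructor
    · intro r h
      simp only [Program.writesReg, Bool.or_eq_false_iff] at h
      exact ih.reg r h.2
    · intro r h
      simp only [Program.writesMem, Bool.or_eq_false_iff] at h
      exact ih.mem r h.2
  | loop_false _ => exact ⟨fun _ _ => rfl, fun _ _ => rfl⟩
  | loop_true _ _ _ ih1 ih2 =>
    constructor
    · intro r h
      rw [ih2.reg r h]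
      exact ih1.reg r h
    · intro r h
      rw [ih2.mem r h]
      exact ih1.mem r h

/-! ### Total correctness with time bounds -/

/-- Started in `s`, the program halts within `B` steps, in a state that satisfies `Q`. -/
def Run (p : Program) (s : State) (B : ℕ) (Q : State → Prop) : Prop :=
  ∃ t s', Steps p s t s' ∧ t ≤ B ∧ Q s'

lemma Run.mono {p : Program} {s : State} {B B' : ℕ} {Q Q' : State → Prop} (h : Run p s B Q)
    (hB : B ≤ B') (hQ : ∀ s', Agree p s s' → Q s' → Q' s') : Run p s B' Q' := by
  obtain ⟨t, s', h1, h2, h3⟩ := h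
  exact ⟨t, s', h1, h2.trans hB, hQ s' h1.agree h3⟩

lemma Run.seq {p q : Program} {s : State} {B₁ B₂ B : ℕ} {Q Q' : State → Prop}
    (hp : Run p s B₁ Q) (hq : ∀ s', Agree p s s' → Q s' → Run q s' B₂ Q') (hB : B₁ + B₂ ≤ B) :
    Run (p.seq q) s B Q' := by
  obtain ⟨t, s', h1, h2, h3⟩ := hp
  obtain ⟨t', s'', h4, h5, h6⟩ := hq s' h1.agree h3
  exact ⟨t + t', s'', h1.seq h4, by omega, h6⟩

lemma Run.ite {p q : Program} {e : Expr} {s : State} {B B' : ℕ} {Q : State → Prop}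
    (hp : e.eval s ≠ 0 → Run p s B Q) (hq : e.eval s = 0 → Run q s B Q)
    (hB : e.cost + 1 + B ≤ B') : Run (Program.ite e p q) s B' Q := by
  by_cases h : e.eval s = 0
  · obtain ⟨t, s', h1, h2, h3⟩ := hq h
    exact ⟨_, s', h1.ite_false h, by omega, h3⟩
  · obtain ⟨t, s', h1, h2, h3⟩ := hp h
    exact ⟨_, s', h1.ite_true h, by omega, h3⟩

namespace Program

/-- The program has no loops. -/
def isLine : Program → Bool
  | skip => true
  | set _ _ => true
  | store _ _ _ => true
  | seq p q => p.isLine && q.isLine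
  | ite _ p q => p.isLine && q.isLine
  | loop _ _ => false

/-- The final state of a program without loops. -/
def result : Program → State → State
  | skip, s => s
  | set r e, s => s.setReg r (e.eval s)
  | store a i e, s => s.setMem a (i.eval s) (e.eval s)
  | seq p q, s => q.result (p.result s)
  | ite e p q, s => if e.eval s = 0 then q.result s else p.result s
  | loop _ _, s => s

/-- The largest possible time of a program without loops. -/
def lineCost : Program → ℕ
  | skip => 1
  | set _ e => e.cost + 1
  | store _ i e => i.cost + e.cost + 1
  | seq p q => p.lineCost + q.lineCost
  | ite e p q => e.cost + 1 + max p.lineCost q.lineCost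
  | loop _ _ => 0

end Program

lemma steps_of_isLine : ∀ (p : Program) (s : State), p.isLine →
    ∃ t ≤ p.lineCost, Steps p s t (p.result s)
  | .skip, s, _ => ⟨1, le_rfl, .skip s⟩
  | .set r e, s, _ => ⟨_, le_rfl, .set s r e⟩
  | .store a i e, s, _ => ⟨_, le_rfl, .store s a i e⟩
  | .seq p q, s, h => by
    simp only [Program.isLine, Bool.and_eq_true] at h
    obtain ⟨t1, h1, h1'⟩ := steps_of_isLine p s h.1
    obtain ⟨t2, h2, h2'⟩ := steps_of_isLine q (p.result s) h.2
    exact ⟨t1 + t2, Nat.add_le_add h1 h2, h1'.seq h2'⟩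
  | .ite e p q, s, h => by
    simp only [Program.isLine, Bool.and_eq_true] at h
    by_cases he : e.eval s = 0
    · obtain ⟨t, h1, h1'⟩ := steps_of_isLine q s h.2
      refine ⟨e.cost + 1 + t, ?_, ?_⟩
      · simp only [Program.lineCost]; omega
      · simp only [Program.result, he, if_true]; exact h1'.ite_false he
    · obtain ⟨t, h1, h1'⟩ := steps_of_isLine p s h.1
      refine ⟨e.cost + 1 + t, ?_, ?_⟩
      · simp only [Program.lineCost]; omega
      · simp only [Program.result, he, if_false]; exact h1'.ite_true he
  | .loop _ _, _, h => by simp [Program.isLine] at h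

lemma Run.line {p : Program} {s : State} {B : ℕ} {Q : State → Prop} (hp : p.isLine = true)
    (hB : p.lineCost ≤ B) (hQ : Q (p.result s)) : Run p s B Q := by
  obtain ⟨t, h1, h2⟩ := steps_of_isLine p s hp
  exact ⟨t, _, h2, h1.trans hB, hQ⟩

/-- For each value of the register `i` from `0` up to the content of the register `r`
(exclusively), execute the body. -/
def Program.forLoop (i r : ℕ) (body : Program) : Program :=
  .seq (.set i (.lit 0)) (.loop (.sub (.reg r) (.reg i))
    (.seq body (.set i (.add (.reg i) (.lit 1)))))

/-- The invariant is stated for the state in which the counter has already been advanced. An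
iteration adds four steps for the test and four for the increment; the remaining six pay for the
initialisation and the last, failing test. -/
lemma Run.forLoop {i r N B : ℕ} {body : Program} {s : State} {Q : State → Prop}
    (I : ℕ → State → Prop) (b : ℕ → ℕ) (hN : s.reg r = N) (hir : (r == i) = false)
    (hwi : body.writesReg i = false) (hwr : body.writesReg r = false)
    (h0 : I 0 (s.setReg i 0))
    (hstep : ∀ j < N, ∀ s₁, Agree (Program.forLoop i r body) s s₁ → s₁.reg i = j → I j s₁ →
      Run body s₁ (b j) fun s₂ => I (j + 1) (s₂.setReg i (j + 1)))
    (hB : ∑ j ∈ Finset.range N, (b j + 8) + 6 ≤ B)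
    (hQ : ∀ s₁, Agree (Program.forLoop i r body) s s₁ → s₁.reg i = N → I N s₁ → Q s₁) :
    Run (Program.forLoop i r body) s B Q := by
  have hri : r ≠ i := by simpa using hir
  let L : Program := .loop (.sub (.reg r) (.reg i)) (.seq body (.set i (.add (.reg i) (.lit 1))))
  have hL : ∀ m j, j + m = N → ∀ s₁, Agree (Program.forLoop i r body) s s₁ → s₁.reg i = j →
      I j s₁ → Run L s₁ (∑ x ∈ Finset.range m, (b (j + x) + 8) + 4) fun s₂ =>
        Agree (Program.forLoop i r body) s s₂ ∧ s₂.reg i = N ∧ I N s₂ := by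
    intro m
    induction m with
    | zero =>
      rintro j hj s₁ ha hi hI
      rw [add_zero] at hj
      subst hj
      have hr : s₁.reg r = s.reg r := ha.reg r (by
        simp only [Program.forLoop, Program.writesReg, hwr, Bool.false_or, Bool.or_self]
        simpa using fun e => hri e.symm)
      refine ⟨_, s₁, .loop_false ?_, ?_, ha, hi, hI⟩
      · simp [Expr.eval, hr, hN, hi]
      · simp [Expr.cost]
    | succ m ih =>
      rintro j hj s₁ ha hi hI
      have hr : s₁.reg r = s.reg r := ha.reg r (by
        simp only [Program.forLoop, Program.writesReg, hwr, Bool.false_or, Bool.or_self]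
        simpa using fun e => hri e.symm)
      obtain ⟨t, s₂, h1, h2, h3⟩ := hstep j (by omega) s₁ ha hi hI
      have ha2 : Agree (Program.forLoop i r body) s (s₂.setReg i (j + 1)) := by
        constructor
        · intro r' h
          simp only [Program.forLoop, Program.writesReg, Bool.or_eq_false_iff] at h
          have : r' ≠ i := by rintro rfl; simp at h
          rw [State.setReg_reg, if_neg this, h1.agree.reg r' h.2.1, ha.reg r' (by
            simp only [Program.forLoop, Program.writesReg, Bool.or_eq_false_iff]; exact h)]
        · intro a h
          have h' := h
          simp only [Program.forLoop, Program.writesMem, Bool.or_eq_false_iff] at h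
          rw [State.setReg_mem, h1.agree.mem a h.2.1, ha.mem a h']
      obtain ⟨t', s₃, h4, h5, h6⟩ := ih (j + 1) (by omega) _ ha2 (by simp) h3
      have hi2 : s₂.reg i = j := by rw [h1.agree.reg i hwi, hi]
      refine ⟨_, s₃, .loop_true (t₂ := t') ?_ (h1.seq (.set _ _ _)) ?_, ?_, h6⟩
      · simp only [Expr.eval, hr, hN, hi]; omega
      · simpa [Expr.eval, hi2] using h4
      · rw [Finset.sum_range_succ']
        simp only [Expr.cost, add_zero]
        have : ∀ x, j + 1 + x = j + (x + 1) := fun x => by omega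
        simp only [this] at h5
        omega
  have ha0 : Agree (Program.forLoop i r body) s (s.setReg i 0) := by
    constructor
    · intro r' h
      simp only [Program.forLoop, Program.writesReg, Bool.or_eq_false_iff] at h
      have : r' ≠ i := by rintro rfl; simp at h
      rw [State.setReg_reg, if_neg this]
    · intro a _; rfl
  obtain ⟨t, s', h1, h2, h3, h4, h5⟩ := hL N 0 (by omega) _ ha0 (by simp) h0
  refine ⟨_, s', .seq (.set _ _ _) h1, ?_, hQ s' h3 h4 h5⟩
  simp only [zero_add] at h2
  simp only [Expr.cost]
  omega

/-- The test `e = f`. -/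
def Expr.eq (e f : Expr) : Expr := .sub (.lit 1) (.add (.sub e f) (.sub f e))

/-- The test `e < f`. -/
def Expr.lt (e f : Expr) : Expr := .sub f e

lemma Expr.eq_eval_eq_zero (s : State) (e f : Expr) :
    (Expr.eq e f).eval s = 0 ↔ e.eval s ≠ f.eval s := by
  simp only [Expr.eq, Expr.eval]; omega

lemma Expr.lt_eval_eq_zero (s : State) (e f : Expr) :
    (Expr.lt e f).eval s = 0 ↔ ¬ e.eval s < f.eval s := by
  simp only [Expr.lt, Expr.eval]; omega

/-! ### The program

Registers: `0` answer, `1` number `n` of vertices, `2` number of listed cliques, `3` the number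
`K = 2 * k + 1`, `4` number of arcs, `5` input position, `6` number of non-isolated vertices,
`7` arc counter, `8` last trie node, `9` the number `n + 1`, `10` to `14` loop variables,
`15` size of the current clique `Ω`, `16` arcs in `Ω`, `17` current vertex, `18` size of the
current separator `S`, `19` arcs in `S`, `20` size of the current block, `21` current trie node,
`22` accumulator, `23` number of triples.

Arrays: `0` input, `1` and `2` tails and heads of the arcs, `3` the non-isolated vertices,
`4` component labels, `5` trie, `6` trie nodes of the components, `7` membership in `S`,
`8` labels of the components in the block, `9` trie nodes of the blocks, `10` truncated fill-in
of `Ω` outside of `S`, `11` sizes of the blocks, `12` trie nodes of the components in the blocks,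
`13` the table, `14` indicator of the set to be looked up in the trie. -/

namespace Program

/-- Increment a register. -/
def incr (r : ℕ) : Program := .set r (.add (.reg r) (.lit 1))

/-- The cell of the trie for the child of the current node. -/
def child : Expr := .add (.mul (.lit 2) (.reg 21)) (.load 14 (.reg 12))

/-- Look up the set with indicator array `14` in the trie, inserting it if it is absent. -/
def intern : Program :=
  .seq (.set 21 (.lit 1)) <| .forLoop 12 1 <|
    .seq (.ite (.load 5 child) .skip (.seq (incr 8) (.store 5 child (.reg 8))))
      (.set 21 (.load 5 child))

/-- The label of the tail of the current arc. -/
def labTail : Expr := .load 4 (.load 1 (.reg 12))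

/-- The label of the head of the current arc. -/
def labHead : Expr := .load 4 (.load 2 (.reg 12))

/-- Propagate the smallest labels through the components. -/
def labels : Program :=
  .forLoop 13 1 <| .forLoop 12 4 <|
    .ite (.mul (.lt labHead labTail) (.lt labTail (.reg 1)))
      (.store 4 (.load 1 (.reg 12)) labHead) .skip

/-- Give each vertex its own label. -/
def initLabels : Program := .forLoop 12 1 (.store 4 (.reg 12) (.reg 12))

/-- Enter the components into the trie. -/
def internComponents : Program :=
  .forLoop 11 6 <| .seq (.set 17 (.load 3 (.reg 11))) <|
    .seq (.forLoop 12 1 (.store 14 (.reg 12) (.eq (.load 4 (.reg 12)) (.reg 17)))) <|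
    .seq intern (.store 6 (.reg 17) (.reg 21))

/-- Append the arcs from the current vertex to the vertices in the next list. -/
def readArcs : Program :=
  .forLoop 12 15 <| .seq (.store 1 (.reg 7) (.reg 10)) <|
    .seq (.store 2 (.reg 7) (.load 0 (.reg 5))) <| .seq (incr 7) (incr 5)

/-- Read the adjacency lists. -/
def readGraph : Program :=
  .seq (.set 5 (.lit 4)) <|
  .seq (.forLoop 10 1 <|
    .seq (.set 15 (.load 0 (.reg 5))) <| .seq (incr 5) <|
    .seq (.ite (.reg 15) (.seq (.store 3 (.reg 6) (.reg 10)) (incr 6)) .skip) readArcs)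
  (.set 4 (.reg 7))

/-- Read the next clique, whose vertices get the label `n`. -/
def readClique : Program :=
  .seq (.set 15 (.load 0 (.reg 5))) <| .seq (incr 5) <|
    .forLoop 12 15 (.seq (.store 4 (.load 0 (.reg 5)) (.reg 1)) (incr 5))

/-- Count the arcs in the clique. -/
def countArcs : Program :=
  .seq (.set 16 (.lit 0)) <| .forLoop 12 4 <|
    .ite (.mul (.eq labTail (.reg 1)) (.eq labHead (.reg 1))) (incr 16) .skip

/-- Mark the neighbours of the component with label `17`. -/
def markSeparator : Program :=
  .seq (.forLoop 12 1 (.seq (.store 7 (.reg 12) (.lit 0)) (.store 8 (.reg 12) (.lit 0)))) <|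
  .forLoop 12 4 <|
    .ite (.mul (.eq labTail (.reg 17)) (.eq labHead (.reg 1)))
      (.store 7 (.load 2 (.reg 12)) (.lit 1)) .skip

/-- Count the arcs in the separator and mark the components that have other neighbours. -/
def markBlock : Program :=
  .seq (.set 19 (.lit 0)) <| .forLoop 12 4 <|
    .seq (.ite (.mul (.load 7 (.load 1 (.reg 12))) (.load 7 (.load 2 (.reg 12)))) (incr 19) .skip)
      (.ite (.mul (.mul (.eq labHead (.reg 1)) (.sub (.lit 1) (.load 7 (.load 2 (.reg 12)))))
        (.lt labTail (.reg 1))) (.store 8 labTail (.lit 1)) .skip)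

/-- Compute the block, its size and the size of the separator. -/
def collectBlock : Program :=
  .seq (.set 18 (.lit 0)) <| .seq (.set 20 (.lit 0)) <| .forLoop 12 1 <|
    .seq (.ite (.lt (.load 4 (.reg 12)) (.reg 1))
      (.store 14 (.reg 12) (.load 8 (.load 4 (.reg 12))))
      (.store 14 (.reg 12) (.sub (.lit 1) (.load 7 (.reg 12))))) <|
    .seq (.ite (.load 7 (.reg 12)) (incr 18) .skip)
      (.ite (.load 14 (.reg 12)) (incr 20) .skip)

/-- Record the components in the block. -/
def recordComponents : Program :=
  .forLoop 12 1 <| .ite (.load 8 (.reg 12))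
    (.store 12 (.add (.mul (.reg 23) (.reg 1)) (.reg 12)) (.load 6 (.reg 12)))
    (.store 12 (.add (.mul (.reg 23) (.reg 1)) (.reg 12)) (.lit 0))

/-- Record the trie node, the weight and the size of the block. -/
def recordBlock : Program :=
  .seq (.store 9 (.reg 23) (.reg 21)) <|
  .seq (.store 10 (.reg 23) (.sub (.reg 3) (.sub
    (.sub (.mul (.reg 15) (.sub (.reg 15) (.lit 1))) (.reg 16))
    (.sub (.mul (.reg 18) (.sub (.reg 18) (.lit 1))) (.reg 19))))) <|
  .seq (.store 11 (.reg 23) (.reg 20)) (incr 23)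

/-- Record the triple of the current clique and vertex. -/
def triple : Program :=
  .seq (.set 17 (.load 3 (.reg 11))) <| .seq markSeparator <| .seq markBlock <|
    .seq collectBlock <| .seq intern <| .seq recordComponents recordBlock

/-- Process the next clique. -/
def clique : Program :=
  .seq initLabels <| .seq readClique <| .seq labels <| .seq countArcs <|
    .seq internComponents <| .forLoop 11 6 triple

/-- Improve the table by means of the current triple. -/
def improve : Program :=
  .seq (.set 22 (.load 10 (.reg 14))) <|
  .seq (.forLoop 12 1 <| .set 22 (.sub (.reg 22) (.sub (.reg 3)
    (.load 13 (.load 12 (.add (.mul (.reg 14) (.reg 1)) (.reg 12))))))) <|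
  .ite (.lt (.load 13 (.load 9 (.reg 14))) (.reg 22))
    (.store 13 (.load 9 (.reg 14)) (.reg 22)) .skip

/-- Fill the table, by increasing size of the blocks. -/
def fillTable : Program :=
  .seq (.store 13 (.lit 0) (.reg 3)) <| .seq (.set 9 (.add (.reg 1) (.lit 1))) <|
  .forLoop 13 9 <| .forLoop 14 23 <|
    .ite (.eq (.load 11 (.reg 14)) (.reg 13)) improve .skip

/-- Combine the table entries for the components of the graph. -/
def answer : Program :=
  .seq (.set 22 (.reg 3)) <|
  .seq (.forLoop 11 6 <| .seq (.set 17 (.load 3 (.reg 11))) <|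
    .ite (.eq (.load 4 (.reg 17)) (.reg 17))
      (.set 22 (.sub (.reg 22) (.sub (.reg 3) (.load 13 (.load 6 (.reg 17)))))) .skip) <|
  .ite (.reg 22) (.set 0 (.lit 1)) (.set 0 (.lit 0))

/-- The algorithm for instances with edges and a nonempty list of cliques. -/
def solve : Program :=
  .seq readGraph <| .seq (.set 8 (.lit 1)) <| .seq (.forLoop 10 2 clique) <|
    .seq initLabels <| .seq labels <| .seq internComponents <| .seq fillTable answer

/-- The algorithm. -/
def main : Program :=
  .seq (.set 1 (.load 0 (.lit 0))) <| .seq (.set 2 (.load 0 (.lit 3))) <|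
  .seq (.set 3 (.add (.add (.load 0 (.lit 2)) (.load 0 (.lit 2))) (.lit 1))) <|
  .ite (.load 0 (.lit 1)) (.ite (.reg 2) solve (.set 0 (.lit 0))) (.set 0 (.lit 1))

/-- The full program is not tame, because it forms `2 * k + 1` by adding two cells; that prologue is
executed by hand in `exec_main`. -/
lemma tame_solve : solve.tame = true := by decide

end Program

lemma Run.forLoop_const {i r N B : ℕ} {body : Program} {s : State} {Q : State → Prop} (c : ℕ)
    (I : ℕ → State → Prop) (hN : s.reg r = N) (hir : (r == i) = false)
    (hwi : body.writesReg i = false) (hwr : body.writesReg r = false)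
    (h0 : I 0 (s.setReg i 0))
    (hstep : ∀ j < N, ∀ s₁, Agree (Program.forLoop i r body) s s₁ → s₁.reg i = j → I j s₁ →
      Run body s₁ c fun s₂ => I (j + 1) (s₂.setReg i (j + 1)))
    (hB : N * (c + 8) + 6 ≤ B)
    (hQ : ∀ s₁, Agree (Program.forLoop i r body) s s₁ → s₁.reg i = N → I N s₁ → Q s₁) :
    Run (Program.forLoop i r body) s B Q :=
  Run.forLoop I (fun _ => c) hN hir hwi hwr h0 hstep (by simpa using hB) hQ

/-! ### The trie -/

/-- The node of the trie that is reached along the first `x` bits of `b`; `0` if absent. -/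
def walk (ch b : ℕ → ℕ) : ℕ → ℕ
  | 0 => 1
  | x + 1 => ch (2 * walk ch b x + b x)

/-- The child pointers `ch` form a forest on the nodes up to `last`. -/
structure IsTrie (ch : ℕ → ℕ) (last : ℕ) : Prop where
  low : ∀ i < 2, ch i = 0
  range : ∀ i, ch i ≠ 0 → 2 ≤ ch i ∧ ch i ≤ last
  inj : ∀ i j, ch i ≠ 0 → ch i = ch j → i = j
  pos : 1 ≤ last

/-- A node occurs in only one cell, and the index of this cell determines the parent and the last
bit. -/
lemma IsTrie.walk_inj {ch : ℕ → ℕ} {last : ℕ} (h : IsTrie ch last) {b b' : ℕ → ℕ} :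
    ∀ x, (∀ y < x, b y ≤ 1) → (∀ y < x, b' y ≤ 1) → walk ch b x ≠ 0 →
      walk ch b x = walk ch b' x → ∀ y < x, b y = b' y := by
  intro x
  induction x with
  | zero => intro _ _ _ _ y hy; omega
  | succ x ih =>
    intro hb hb' h0 he y hy
    have h1 := h.inj _ _ h0 he
    have hbx := hb x (by omega)
    have hbx' := hb' x (by omega)
    have h2 : walk ch b x = walk ch b' x := by omega
    have h3 : walk ch b x ≠ 0 := by
      intro hw
      refine h0 (h.low _ ?_)
      rw [hw]; omega
    rcases Nat.lt_succ_iff_lt_or_eq.1 hy with hy | rfl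
    · exact ih (fun y hy => hb y (by omega)) (fun y hy => hb' y (by omega)) h3 h2 y hy
    · omega

/-- Cells 0 and 1 would be the children of the absent node 0. They are empty, so a walk that ends in
a node has passed only through nodes, whose pointers are kept. -/
lemma walk_ext {ch ch' b : ℕ → ℕ} (hlow : ∀ i < 2, ch i = 0)
    (he : ∀ i, ch i ≠ 0 → ch' i = ch i) :
    ∀ x, (∀ y < x, b y ≤ 1) → walk ch b x ≠ 0 → walk ch' b x = walk ch b x := by
  intro x
  induction x with
  | zero => intros; rfl
  | succ x ih =>
    intro hb h
    have h3 : walk ch b x ≠ 0 := by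
      intro hw
      have := hb x (by omega)
      exact h (hlow _ (by rw [hw]; omega))
    rw [walk, ih (fun y hy => hb y (by omega)) h3]
    exact he _ h

lemma IsTrie.insert {ch : ℕ → ℕ} {last i : ℕ} (h : IsTrie ch last) (hi : 2 ≤ i) : IsTrie (Function.update ch i (last + 1)) (last + 1) := by
  have hp := h.pos
  constructor
  · intro j hj
    rw [Function.update_of_ne (by omega)]; exact h.low j hj
  · intro j hj
    rw [Function.update_apply] at hj ⊢
    split_ifs with hji
    · omega
    · rw [if_neg hji] at hj
      have := h.range j hj; omega
  · intro j l hj he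
    rw [Function.update_apply] at hj
    rw [Function.update_apply, Function.update_apply] at he
    split_ifs at hj he with h1 h2 h2
    · omega
    · have := h.range l (by omega); omega
    · have := h.range j hj; omega
    · exact h.inj j l hj he
  · omega

lemma walk_congr {ch b b' : ℕ → ℕ} : ∀ x, (∀ y < x, b y = b' y) → walk ch b x = walk ch b' x
  | 0, _ => rfl
  | x + 1, h => by
    rw [walk, walk, walk_congr x fun y hy => h y (by omega), h x (by omega)]

/-- Node numbers are permanent, so nodes recorded earlier stay valid while the trie grows. -/
lemma run_intern {n : ℕ} {s : State} (hn : s.reg 1 = n) (ht : IsTrie (s.mem 5) (s.reg 8))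
    (hb : ∀ x < n, s.mem 14 x ≤ 1) :
    Run Program.intern s (70 * n + 8) fun s' => IsTrie (s'.mem 5) (s'.reg 8) ∧
      (∀ i, s.mem 5 i ≠ 0 → s'.mem 5 i = s.mem 5 i) ∧
      s'.reg 21 = walk (s'.mem 5) (s.mem 14) n ∧ s'.reg 21 ≠ 0 := by
  refine Run.seq (B₁ := 2) (Q := fun s' => s' = s.setReg 21 1) (Run.line rfl le_rfl rfl) ?_
    (B₂ := 70 * n + 6) (by omega)
  rintro _ - rfl
  refine Run.forLoop_const 62 (fun j s' => IsTrie (s'.mem 5) (s'.reg 8) ∧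
      (∀ i, s.mem 5 i ≠ 0 → s'.mem 5 i = s.mem 5 i) ∧
      s'.reg 21 = walk (s'.mem 5) (s.mem 14) j ∧ s'.reg 21 ≠ 0) (N := n) (by simp [hn])
      rfl rfl rfl ?_ ?_ (by omega) ?_
  · simp [walk, ht]
  · rintro j hj s₁ ha hi ⟨h1, h2, h3, h4⟩
    have h14 : s₁.mem 14 = s.mem 14 := ha.mem 14 rfl
    have hidx : Program.child.eval s₁ = 2 * walk (s₁.mem 5) (s.mem 14) j + s.mem 14 j := by
      simp [Program.child, Expr.eval, h3, hi, h14]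
    have h2i : 2 ≤ 2 * walk (s₁.mem 5) (s.mem 14) j + s.mem 14 j := by rw [← h3]; omega
    refine Run.line rfl (by decide) ?_
    by_cases hz : s₁.mem 5 (2 * walk (s₁.mem 5) (s.mem 14) j + s.mem 14 j) = 0
    · have hext : ∀ i, s₁.mem 5 i ≠ 0 → Function.update (s₁.mem 5)
          (2 * walk (s₁.mem 5) (s.mem 14) j + s.mem 14 j) (s₁.reg 8 + 1) i = s₁.mem 5 i := by
        intro i hi
        rw [Function.update_of_ne]
        rintro rfl; exact hi hz
      -- The new pointer leaves the path walked so far unchanged, although the walk is now taken in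
      -- the updated array.
      have hw := walk_ext (b := s.mem 14) h1.low hext j (fun y hy => hb y (by omega))
        (by rw [← h3]; exact h4)
      have hres : (Program.result (.seq (.ite (.load 5 Program.child) .skip
          (.seq (Program.incr 8) (.store 5 Program.child (.reg 8))))
          (.set 21 (.load 5 Program.child))) s₁).setReg 12 (j + 1) =
          (((s₁.setReg 8 (s₁.reg 8 + 1)).setMem 5
          (2 * walk (s₁.mem 5) (s.mem 14) j + s.mem 14 j) (s₁.reg 8 + 1)).setReg 21
            (s₁.reg 8 + 1)).setReg 12 (j + 1) := by
        have e1 : Program.child.eval (s₁.setReg 8 (s₁.reg 8 + 1)) = Program.child.eval s₁ := by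
          simp [Program.child, Expr.eval]
        have e2 : ∀ i v, Program.child.eval ((s₁.setReg 8 (s₁.reg 8 + 1)).setMem 5 i v) =
            Program.child.eval s₁ := by
          intro i v; simp [Program.child, Expr.eval]
        simp [Program.result, Expr.eval, hidx, hz, Program.incr, e1, e2]
      rw [hres]
      refine ⟨?_, ?_, ?_, ?_⟩
      · simpa using h1.insert h2i
      · intro i hi
        have := h2 i hi
        simpa [this] using hext i (by rw [this]; exact hi)
      · simp [walk, hw]
      · simp
    · have hres : (Program.result (.seq (.ite (.load 5 Program.child) .skip
          (.seq (Program.incr 8) (.store 5 Program.child (.reg 8))))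
          (.set 21 (.load 5 Program.child))) s₁).setReg 12 (j + 1) =
          (s₁.setReg 21 (s₁.mem 5 (2 * walk (s₁.mem 5) (s.mem 14) j + s.mem 14 j))).setReg 12
            (j + 1) := by
        simp [Program.result, Expr.eval, hidx, hz]
      rw [hres]
      refine ⟨by simpa using h1, by simpa using h2, ?_, by simpa using hz⟩
      simp [walk]
  · rintro s₁ - - h
    exact h

/-! ### Component labels -/

/-- The arrays `src` and `dst` list the arcs of `G`, each once, in the cells below `M`. -/
structure ListsArcs {n : ℕ} (G : SimpleGraph (Fin n)) (src dst : ℕ → ℕ) (M : ℕ) : Prop where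
  valid : ∀ e < M, ∃ a b : Fin n, G.Adj a b ∧ src e = a ∧ dst e = b
  complete : ∀ a b : Fin n, G.Adj a b → ∃ e < M, src e = a ∧ dst e = b
  inj : ∀ e < M, ∀ e' < M, src e = src e' → dst e = dst e' → e = e'

/-- The array `nz` lists the non-isolated vertices, each once, in the cells below `h`. -/
structure ListsNonisolated {n : ℕ} (G : SimpleGraph (Fin n)) (nz : ℕ → ℕ) (h : ℕ) : Prop where
  valid : ∀ j < h, ∃ v : Fin n, nz j = v ∧ ∃ u, G.Adj v u
  complete : ∀ v u : Fin n, G.Adj v u → ∃ j < h, nz j = v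
  inj : ∀ i < h, ∀ j < h, nz i = nz j → i = j

/-- The state holds the graph `G` and the parameter `K`. -/
structure HoldsGraph {n : ℕ} (G : SimpleGraph (Fin n)) (K M h : ℕ) (s : State) : Prop where
  vertices : s.reg 1 = n
  param : s.reg 3 = K
  arcCount : s.reg 4 = M
  nzCount : s.reg 6 = h
  arcs : ListsArcs G (s.mem 1) (s.mem 2) M
  nz : ListsNonisolated G (s.mem 3) h

/-- The program does not touch the representation of the graph. -/
def Program.keepsGraph (p : Program) : Bool :=
  !p.writesReg 1 && !p.writesReg 3 && !p.writesReg 4 && !p.writesReg 6 &&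
    !p.writesMem 1 && !p.writesMem 2 && !p.writesMem 3

lemma HoldsGraph.agree {n : ℕ} {G : SimpleGraph (Fin n)} {K M h : ℕ} {s s' : State}
    {p : Program} (hs : HoldsGraph G K M h s) (ha : Agree p s s') (hp : p.keepsGraph = true) :
    HoldsGraph G K M h s' := by
  simp only [Program.keepsGraph, Bool.and_eq_true, Bool.not_eq_true'] at hp
  obtain ⟨⟨⟨⟨⟨⟨h1, h3⟩, h4⟩, h6⟩, m1⟩, m2⟩, m3⟩ := hp
  refine ⟨?_, ?_, ?_, ?_, ?_, ?_⟩
  · rw [ha.reg 1 h1, hs.vertices]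
  · rw [ha.reg 3 h3, hs.param]
  · rw [ha.reg 4 h4, hs.arcCount]
  · rw [ha.reg 6 h6, hs.nzCount]
  · rw [ha.mem 1 m1, ha.mem 2 m2]; exact hs.arcs
  · rw [ha.mem 3 m3]; exact hs.nz

/-- The subgraph of the edges that avoid `Ω`. -/
def avoid {V : Type*} (G : SimpleGraph V) (Ω : Set V) : SimpleGraph V where
  Adj a b := G.Adj a b ∧ a ∉ Ω ∧ b ∉ Ω
  symm := ⟨fun _ _ h => ⟨h.1.symm, h.2.2, h.2.1⟩⟩
  loopless := ⟨fun _ h => h.1.ne rfl⟩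

lemma not_mem_of_reachable {V : Type*} {G : SimpleGraph V} {Ω : Set V} {x y : V} (hx : x ∉ Ω)
    (h : (avoid G Ω).Reachable x y) : y ∉ Ω := by
  obtain ⟨p⟩ := h
  induction p with
  | nil => exact hx
  | cons h _ ih => exact ih h.2.2

section Labels

variable {n : ℕ} {G : SimpleGraph (Fin n)} {Ω : Set (Fin n)} {lab : ℕ → ℕ}

/-- The labels after `r` rounds of propagation. -/
structure PartialLabels (G : SimpleGraph (Fin n)) (Ω : Set (Fin n)) (r : ℕ) (lab : ℕ → ℕ) :
    Prop where
  mem : ∀ x : Fin n, x ∈ Ω → lab x = n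
  root : ∀ x : Fin n, x ∉ Ω → ∃ l : Fin n, lab x = l ∧ (avoid G Ω).Reachable x l
  near : ∀ x y : Fin n, x ∉ Ω → ∀ p : (avoid G Ω).Walk x y, p.length ≤ r → lab x ≤ y

/-- The vertices outside of `Ω` are labelled by the smallest vertices of their components in
`G - Ω`, those in `Ω` by `n`. -/
structure Labels (G : SimpleGraph (Fin n)) (Ω : Set (Fin n)) (lab : ℕ → ℕ) : Prop where
  mem : ∀ x : Fin n, x ∈ Ω → lab x = n
  root : ∀ x : Fin n, x ∉ Ω → ∃ l : Fin n, lab x = l ∧ (avoid G Ω).Reachable x l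
  min : ∀ x y : Fin n, x ∉ Ω → (avoid G Ω).Reachable x y → lab x ≤ y

/-- Reachable vertices are joined by a path, which has fewer than `n` edges; so `n` rounds suffice.
-/
lemma PartialLabels.labels (h : PartialLabels G Ω n lab) : Labels G Ω lab := by
  classical
  refine ⟨h.mem, h.root, fun x y hx hxy => ?_⟩
  obtain ⟨p, hp⟩ := hxy.exists_isPath
  have := hp.length_lt
  rw [Fintype.card_fin] at this
  exact h.near x y hx p this.le

/-- The set of vertices with a given label. -/
def labelSet (lab : ℕ → ℕ) (l : Fin n) : Set (Fin n) := {x | lab x = l}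

lemma Labels.eq_of_reachable (h : Labels G Ω lab) {x y : Fin n} (hx : x ∉ Ω)
    (hxy : (avoid G Ω).Reachable x y) : lab x = lab y := by
  have hy := not_mem_of_reachable hx hxy
  obtain ⟨l, hl, hxl⟩ := h.root x hx
  obtain ⟨l', hl', hyl⟩ := h.root y hy
  have h1 := h.min x l' hx (hxy.trans hyl)
  have h2 := h.min y l hy (hxy.symm.trans hxl)
  omega

lemma Labels.lt_iff (h : Labels G Ω lab) (x : Fin n) : lab x < n ↔ x ∉ Ω := by
  constructor
  · intro h1 h2
    rw [h.mem x h2] at h1; omega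
  · intro hx
    obtain ⟨l, hl, _⟩ := h.root x hx
    rw [hl]; exact l.2

lemma Labels.eq_iff (h : Labels G Ω lab) (x : Fin n) : lab x = n ↔ x ∈ Ω := by
  constructor
  · intro h1
    by_contra h2
    have := (h.lt_iff x).2 h2
    omega
  · exact h.mem x

/-- A label is the smallest vertex of its component and carries itself. Consequently all other
vertices have empty label sets. -/
lemma Labels.mem_self (h : Labels G Ω lab) {l x : Fin n} (hx : x ∈ labelSet lab l) :
    l ∈ labelSet lab l := by
  have hx' : lab x = l := hx
  have hxΩ : x ∉ Ω := (h.lt_iff x).1 (by rw [hx']; exact l.2)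
  obtain ⟨l', hl', hr⟩ := h.root x hxΩ
  have : l' = l := Fin.ext (by omega)
  subst this
  exact (h.eq_of_reachable hxΩ hr).symm.trans hx'

lemma Labels.compFam (h : Labels G Ω lab) : CompFam G Ω (labelSet lab) := by
  have hdisj : ∀ i : Fin n, ∀ x ∈ labelSet lab i, x ∉ Ω := by
    intro i x hx
    rw [← h.lt_iff]
    have : lab x = i := hx
    rw [this]; exact i.2
  refine ⟨hdisj, ?_, ?_, ?_, ?_⟩
  · rintro i u ⟨hu, a, ha, hau⟩
    by_contra huΩ
    refine hu ?_
    have : lab a = lab u := h.eq_of_reachable (hdisj i a ha)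
      (Adj.reachable ⟨hau, hdisj i a ha, huΩ⟩)
    exact this.symm.trans ha
  · intro i j x hi hj
    have h1 : lab x = i := hi
    have h2 : lab x = j := hj
    exact Fin.ext (by omega)
  · intro i A hA ⟨a, ha⟩ hcl
    apply Set.Subset.antisymm hA
    have key : ∀ x y, (avoid G Ω).Reachable x y → x ∈ A → y ∈ A := by
      rintro x y ⟨p⟩ hx
      induction p with
      | nil => exact hx
      | cons hxy _ ih =>
        refine ih (hcl _ hx _ ?_ hxy.1)
        exact (h.eq_of_reachable hxy.2.1 (Adj.reachable hxy)).symm.trans (hA hx)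
    have hreach : ∀ x ∈ labelSet lab i, (avoid G Ω).Reachable x i := by
      intro x hx
      obtain ⟨l, hl, hr⟩ := h.root x (hdisj i x hx)
      have hx' : lab x = i := hx
      rwa [show l = i from Fin.ext (by omega)] at hr
    intro x hx
    exact key a x ((hreach a (hA ha)).trans (hreach x hx).symm) ha
  · intro x hx
    obtain ⟨l, hl, _⟩ := h.root x hx
    exact ⟨l, hl⟩

/-- Labels are relaxed in place along all arcs, as in the Bellman–Ford algorithm. The inner
invariant compares with the labels at the start of the round, which is harmless since labels only
decrease. -/
lemma run_labels {K M h : ℕ} {s : State} (hs : HoldsGraph G K M h s)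
    (h0 : PartialLabels G Ω 0 (s.mem 4)) :
    Run Program.labels s (n * (48 * M + 14) + 6) fun s' => Labels G Ω (s'.mem 4) := by
  refine Run.forLoop_const (48 * M + 6) (fun r s' => PartialLabels G Ω r (s'.mem 4)) hs.vertices
    rfl rfl rfl h0 ?_ (by rw [show 48 * M + 6 + 8 = 48 * M + 14 by ring]) ?_
  · rintro r hr s₁ ha hi hI
    have hs₁ := hs.agree ha rfl
    refine (Run.forLoop_const 40 (fun e s' =>
      (∀ x : Fin n, x ∈ Ω → s'.mem 4 x = n) ∧
      (∀ x : Fin n, x ∉ Ω → ∃ l : Fin n, s'.mem 4 x = l ∧ (avoid G Ω).Reachable x l) ∧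
      (∀ x : Fin n, s'.mem 4 x ≤ s₁.mem 4 x) ∧
      ∀ e' < e, ∀ x y : Fin n, x ∉ Ω → y ∉ Ω → s₁.mem 1 e' = x → s₁.mem 2 e' = y →
        s'.mem 4 x ≤ s₁.mem 4 y) (Q := fun s' => PartialLabels G Ω (r + 1) (s'.mem 4))
      hs₁.arcCount rfl rfl rfl ?_ ?_ (by omega) ?_).mono le_rfl
        fun s' _ h => by simpa using h
    · exact ⟨hI.mem, hI.root, fun _ => le_rfl, by simp⟩
    · rintro e he s₂ ha₂ hi₂ ⟨h1, h2, h3, h4⟩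
      refine Run.line rfl (by decide) ?_
      obtain ⟨a, b, hab, hsa, hsb⟩ := hs₁.arcs.valid e he
      have hs₂ := hs₁.agree ha₂ rfl
      have e1 : s₂.mem 1 e = a := by rw [ha₂.mem 1 rfl, hsa]
      have e2 : s₂.mem 2 e = b := by rw [ha₂.mem 2 rfl, hsb]
      have hval : (Program.labTail.eval s₂ = s₂.mem 4 a) ∧ Program.labHead.eval s₂ = s₂.mem 4 b := by
        simp [Program.labTail, Program.labHead, Expr.eval, hi₂, e1, e2]
      have hcond : ((Program.labHead.lt Program.labTail).mul
          (Program.labTail.lt (.reg 1))).eval s₂ = 0 ↔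
          ¬ (s₂.mem 4 b < s₂.mem 4 a ∧ s₂.mem 4 a < n) := by
        have h5 := Expr.lt_eval_eq_zero s₂ Program.labHead Program.labTail
        have h6 := Expr.lt_eval_eq_zero s₂ Program.labTail (.reg 1)
        rw [hval.1, hval.2] at h5
        rw [hval.1, Expr.eval, hs₂.vertices] at h6
        simp only [Expr.eval, mul_eq_zero, h5, h6]
        tauto
      simp only [Program.result, hcond]
      by_cases hc : s₂.mem 4 b < s₂.mem 4 a ∧ s₂.mem 4 a < n
      · have haΩ : a ∉ Ω := fun h => by have := h1 a h; omega
        have hbΩ : b ∉ Ω := fun h => by have := h1 b h; omega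
        have hab' : (avoid G Ω).Adj a b := ⟨hab, haΩ, hbΩ⟩
        have hmem : ∀ x : Fin n, ((s₂.setMem 4 a (s₂.mem 4 b)).setReg 12 (e + 1)).mem 4 x =
            if x = a then s₂.mem 4 b else s₂.mem 4 x := by
          intro x
          simp [Function.update_apply, Fin.ext_iff]
        simp only [hc, not_true_eq_false, and_self, if_false, hval.2]
        have ev : (Expr.load 1 (.reg 12)).eval s₂ = a := by simp [Expr.eval, hi₂, e1]
        rw [ev]
        refine ⟨?_, ?_, ?_, ?_⟩
        · intro x hx
          rw [hmem, if_neg (by rintro rfl; exact haΩ hx)]; exact h1 x hx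
        · intro x hx
          rw [hmem]
          split_ifs with hxa
          · obtain ⟨l, hl, hr⟩ := h2 b hbΩ
            exact ⟨l, hl, hxa ▸ hab'.reachable.trans hr⟩
          · exact h2 x hx
        · intro x
          rw [hmem]
          have := h3 x
          split_ifs with hxa
          · subst hxa; omega
          · exact this
        · intro e' he' x y hx hy hx' hy'
          rw [hmem]
          split_ifs with hxa
          · rcases Nat.lt_succ_iff_lt_or_eq.1 he' with h | h
            · have := h4 e' h x y hx hy hx' hy'
              subst hxa; omega
            · subst h
              have : y = b := Fin.ext (by omega)
              subst this; exact h3 y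
          · rcases Nat.lt_succ_iff_lt_or_eq.1 he' with h | h
            · exact h4 e' h x y hx hy hx' hy'
            · subst h
              exact absurd (Fin.ext (by omega)) hxa
      · simp only [hc, not_false_eq_true, if_true]
        refine ⟨by simpa using h1, by simpa using h2, by simpa using h3, ?_⟩
        intro e' he' x y hx hy hx' hy'
        rw [State.setReg_mem]
        rcases Nat.lt_succ_iff_lt_or_eq.1 he' with h | h
        · exact h4 e' h x y hx hy hx' hy'
        · subst h
          have hxa : x = a := Fin.ext (by omega)
          have hyb : y = b := Fin.ext (by omega)
          subst hxa hyb
          obtain ⟨l, hl, _⟩ := h2 x hx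
          have := l.2
          have := h3 y
          omega
    · rintro s₂ ha₂ hi₂ ⟨h1, h2, h3, h4⟩
      refine ⟨h1, h2, ?_⟩
      intro x y hx p hp
      cases p with
      | nil => exact (h3 x).trans (hI.near x x hx .nil (by simp))
      -- The first edge of the walk was relaxed in this round, and the rest of the walk is covered
      -- by the earlier rounds.
      | @cons _ z _ hxz q =>
        obtain ⟨e, he, hex, hez⟩ := hs₁.arcs.complete x z hxz.1
        refine (h4 e he x z hx hxz.2.2 hex hez).trans (hI.near z y hxz.2.2 q ?_)
        simp only [Walk.length_cons] at hp; omega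
  · rintro s₁ - - h
    exact h.labels

end Labels

/-! ### Reading a clique -/

/-- The array `f` holds the list `l` from position `p` on. -/
def Reads (f : ℕ → ℕ) (p : ℕ) (l : List ℕ) : Prop := ∀ i (h : i < l.length), f (p + i) = l[i]

lemma Reads.head {f : ℕ → ℕ} {p a : ℕ} {l : List ℕ} (h : Reads f p (a :: l)) : f p = a := by
  exact h 0 (by simp)

lemma Reads.tail {f : ℕ → ℕ} {p a : ℕ} {l : List ℕ} (h : Reads f p (a :: l)) :
    Reads f (p + 1) l := fun i hi => by
  have := h (i + 1) (by simpa using hi)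
  rw [List.getElem_cons_succ] at this
  rw [← this]; congr 1; omega

lemma Reads.left {f : ℕ → ℕ} {p : ℕ} {l l' : List ℕ} (h : Reads f p (l ++ l')) : Reads f p l :=
  fun i hi => by
    rw [h i (by rw [List.length_append]; omega), List.getElem_append_left hi]

lemma Reads.right {f : ℕ → ℕ} {p : ℕ} {l l' : List ℕ} (h : Reads f p (l ++ l')) :
    Reads f (p + l.length) l' := fun i hi => by
  have := h (l.length + i) (by rw [List.length_append]; omega)
  rw [List.getElem_append_right (by omega)] at this
  rw [add_assoc, this]; congr 1; omega

lemma encodeList_eq {n : ℕ} (l : List (Fin n)) : encodeList l = l.length :: l.map Fin.val := by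
  simp only [encodeList, List.map_id_fun', id_eq, List.cons.injEq, true_and]
  rw [List.bind_eq_flatMap, List.map_eq_flatMap]
  rfl

section Cliques

variable {n : ℕ} {G : SimpleGraph (Fin n)} {Ω : Set (Fin n)} {lab : ℕ → ℕ} {K M h : ℕ}

lemma run_initLabels {s : State} (hn : s.reg 1 = n) :
    Run Program.initLabels s (11 * n + 6) fun s' => ∀ x < n, s'.mem 4 x = x := by
  refine Run.forLoop_const 3 (fun j s' => ∀ x < j, s'.mem 4 x = x) hn rfl rfl rfl (by simp) ?_
    (by omega) fun s' _ _ h => h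
  intro j hj s₁ ha hi hI
  refine Run.line rfl (by decide) ?_
  intro x hx
  simp only [Program.result, Expr.eval, hi, State.setReg_mem, State.setMem_mem, if_true,
    Function.update_apply]
  split_ifs with hxj
  · exact hxj.symm
  · exact hI x (by omega)

lemma partialLabels_zero (h : ∀ x : Fin n, (x ∈ Ω → lab x = n) ∧ (x ∉ Ω → lab x = x)) :
    PartialLabels G Ω 0 lab := by
  refine ⟨fun x => (h x).1, fun x hx => ⟨x, (h x).2 hx, .rfl⟩, fun x y hx p hp => ?_⟩
  cases p with
  | nil => exact ((h x).2 hx).le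
  | cons _ q => simp at hp

lemma run_readClique {s : State} {l : List (Fin n)} (hn : s.reg 1 = n)
    (hlab : ∀ x < n, s.mem 4 x = x) (hr : Reads (s.mem 0) (s.reg 5) (encodeList l))
    (hl : l.Nodup) :
    Run Program.readClique s (30 * n + 20) fun s' => s'.reg 5 = s.reg 5 + (encodeList l).length ∧
      s'.reg 15 = l.length ∧ PartialLabels G {x | x ∈ l} 0 (s'.mem 4) := by
  have hln : l.length ≤ n := by simpa using hl.length_le_card
  rw [encodeList_eq] at hr ⊢
  refine Run.seq (B₁ := 3) (Q := fun s' => s' = s.setReg 15 l.length) (Run.line rfl (by decide) ?_)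
    (B₂ := 30 * n + 17) ?_ (by omega)
  · simp [Program.result, Expr.eval, hr.head]
  rintro _ - rfl
  refine Run.seq (B₁ := 4) (Q := fun s' => s' = (s.setReg 15 l.length).setReg 5 (s.reg 5 + 1))
    (Run.line rfl (by decide) ?_) (B₂ := 30 * n + 6) ?_ (by omega)
  · simp [Program.result, Expr.eval, Program.incr]
  rintro _ - rfl
  refine Run.forLoop_const 15 (N := l.length) (fun j s' => s'.reg 5 = s.reg 5 + 1 + j ∧
    ∀ x : Fin n, s'.mem 4 x = if x ∈ l.take j then n else (x : ℕ)) (by simp) rfl rfl rfl ?_ ?_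
    (by nlinarith) ?_
  · refine ⟨by simp, fun x => ?_⟩
    simpa using hlab x x.2
  · rintro j hj s₁ ha hi ⟨h1, h2⟩
    refine Run.line rfl (by decide) ?_
    have hm0 : s₁.mem 0 (s₁.reg 5) = l[j] := by
      rw [ha.mem 0 rfl, h1]
      have := hr.tail j (by rw [List.length_map]; exact hj)
      rw [List.getElem_map] at this
      exact this
    have hn1 : s₁.reg 1 = n := by rw [ha.reg 1 rfl]; simpa using hn
    have hres : Program.result (.seq (.store 4 (.load 0 (.reg 5)) (.reg 1)) (Program.incr 5)) s₁ =
        (s₁.setMem 4 l[j] n).setReg 5 (s₁.reg 5 + 1) := by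
      simp [Program.result, Expr.eval, Program.incr, hm0, hn1]
    rw [hres]
    refine ⟨by simp [h1]; omega, fun x => ?_⟩
    simp only [State.setReg_mem, State.setMem_mem, if_true, Function.update_apply, h2]
    rw [List.take_add_one, List.getElem?_eq_getElem hj]
    simp only [Option.toList_some, List.mem_append, List.mem_singleton, ← Fin.ext_iff]
    split_ifs <;> tauto
  · rintro s₁ ha hi ⟨h1, h2⟩
    refine ⟨?_, ?_, partialLabels_zero fun x => ?_⟩
    · rw [h1]; simp; omega
    · rw [ha.reg 15 rfl]; simp
    · rw [h2 x, List.take_length]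
      exact ⟨fun hx => if_pos hx, fun hx => if_neg hx⟩

/-- Each ordered adjacent pair is listed exactly once, so a counter in a loop over the arcs gives a
cardinality of ordered pairs. -/
lemma ListsArcs.count {src dst : ℕ → ℕ} (ha : ListsArcs G src dst M) (P : ℕ → ℕ → Prop)
    [DecidablePred fun e => P (src e) (dst e)] :
    Nat.count (fun e => P (src e) (dst e)) M =
      {p : Fin n × Fin n | G.Adj p.1 p.2 ∧ P p.1 p.2}.ncard := by
  classical
  rw [Nat.count_eq_card_filter_range, ← Set.ncard_coe_finset]
  have hlt : ∀ e < M, src e < n ∧ dst e < n := by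
    intro e he
    obtain ⟨a, b, _, h1, h2⟩ := ha.valid e he
    omega
  have hmem : ∀ e, e ∈ (((Finset.range M).filter fun e => P (src e) (dst e) : Finset ℕ) : Set ℕ) ↔
      e < M ∧ P (src e) (dst e) := by simp
  refine Set.ncard_congr (fun e he => (⟨src e, (hlt e ((hmem e).1 he).1).1⟩,
    ⟨dst e, (hlt e ((hmem e).1 he).1).2⟩)) ?_ ?_ ?_
  · intro e he
    obtain ⟨he, hP⟩ := (hmem e).1 he
    obtain ⟨a, b, hab, h1, h2⟩ := ha.valid e he
    have e1 : (⟨src e, (hlt e he).1⟩ : Fin n) = a := Fin.ext h1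
    have e2 : (⟨dst e, (hlt e he).2⟩ : Fin n) = b := Fin.ext h2
    exact ⟨by simpa only [e1, e2] using hab, hP⟩
  · intro e e' he he' heq
    simp only [Prod.mk.injEq, Fin.mk.injEq] at heq
    exact ha.inj e ((hmem e).1 he).1 e' ((hmem e').1 he').1 heq.1 heq.2
  · rintro ⟨a, b⟩ ⟨hab, hP⟩
    obtain ⟨e, he, h1, h2⟩ := ha.complete a b hab
    exact ⟨e, (hmem e).2 ⟨he, by rw [h1, h2]; exact hP⟩, by simp [h1, h2]⟩

lemma count_eq_ncard (P : ℕ → Prop) [DecidablePred P] :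
    Nat.count P n = {x : Fin n | P x}.ncard := by
  classical
  rw [Nat.count_eq_card_filter_range, ← Set.ncard_image_of_injective _ Fin.val_injective,
    ← Set.ncard_coe_finset]
  congr 1
  ext x
  simp only [Finset.coe_filter, Finset.mem_range, Set.mem_ofPred_eq, Set.mem_image]
  constructor
  · rintro ⟨h1, h2⟩; exact ⟨⟨x, h1⟩, h2, rfl⟩
  · rintro ⟨y, h1, rfl⟩; exact ⟨y.2, h1⟩

lemma run_countArcs {s : State} (hs : HoldsGraph G K M h s) (hl : Labels G Ω (s.mem 4)) :
    Run Program.countArcs s (48 * M + 8) fun s' =>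
      s'.reg 16 = {p : Fin n × Fin n | p.1 ∈ Ω ∧ p.2 ∈ Ω ∧ G.Adj p.1 p.2}.ncard := by
  refine Run.seq (B₁ := 2) (Q := fun s' => s' = s.setReg 16 0) (Run.line rfl le_rfl rfl) ?_
    (B₂ := 48 * M + 6) (by omega)
  rintro _ - rfl
  refine Run.forLoop_const 40 (fun j s' => s'.reg 16 = Nat.count
    (fun e => s.mem 4 (s.mem 1 e) = n ∧ s.mem 4 (s.mem 2 e) = n) j) (N := M)
    (by simp [hs.arcCount]) rfl rfl rfl (by simp) ?_ (by omega) ?_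
  · rintro j hj s₁ ha hi hI
    refine Run.line rfl (by decide) ?_
    have h4 : s₁.mem 4 = s.mem 4 := ha.mem 4 rfl
    have h1 : s₁.mem 1 = s.mem 1 := ha.mem 1 rfl
    have h2 : s₁.mem 2 = s.mem 2 := ha.mem 2 rfl
    have hn : s₁.reg 1 = n := by rw [ha.reg 1 rfl]; simpa using hs.vertices
    have hc : ((Program.labTail.eq (.reg 1)).mul (Program.labHead.eq (.reg 1))).eval s₁ = 0 ↔
        ¬ (s.mem 4 (s.mem 1 j) = n ∧ s.mem 4 (s.mem 2 j) = n) := by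
      simp only [Expr.eval, mul_eq_zero, Expr.eq_eval_eq_zero, Program.labTail, Program.labHead,
        hi, h4, h1, h2, hn]
      tauto
    simp only [Program.result, hc, Nat.count_succ]
    by_cases h : s.mem 4 (s.mem 1 j) = n ∧ s.mem 4 (s.mem 2 j) = n
    · simp [h, Program.incr, Program.result, Expr.eval, hI]
    · simp only [h, not_false_eq_true, if_true, if_false, State.setReg_reg]
      simpa using hI
  · rintro s₁ ha hi hI
    rw [hI, hs.arcs.count fun a b => s.mem 4 a = n ∧ s.mem 4 b = n]
    congr 1
    ext p
    simp only [Set.mem_ofPred_eq, hl.eq_iff]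
    tauto

/-! ### Trie nodes of vertex sets -/

open Classical in
/-- The indicator function of a vertex set. -/
noncomputable def ind (A : Set (Fin n)) (x : ℕ) : ℕ := if ∃ h : x < n, (⟨x, h⟩ : Fin n) ∈ A then 1 else 0

lemma ind_le_one (A : Set (Fin n)) (x : ℕ) : ind A x ≤ 1 := by
  unfold ind; split_ifs <;> omega

lemma ind_ne_zero (A : Set (Fin n)) (x : Fin n) : ind A x ≠ 0 ↔ x ∈ A := by
  unfold ind
  constructor
  · intro h
    by_contra hx
    exact h (if_neg fun ⟨_, h'⟩ => hx h')
  · intro h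
    rw [if_pos ⟨x.2, h⟩]; omega

lemma eq_ind_of {A : Set (Fin n)} {x : Fin n} {a : ℕ} (h : a ≤ 1) (h' : a ≠ 0 ↔ x ∈ A) :
    a = ind A x := by
  have h1 := ind_ne_zero A x
  have h2 := ind_le_one A x
  by_cases hx : x ∈ A
  · have := h'.2 hx; have := h1.2 hx; omega
  · have := mt h'.1 hx; have := mt h1.1 hx; omega

/-- The trie node of a vertex set; `0` if there is none. -/
noncomputable def key (ch : ℕ → ℕ) (A : Set (Fin n)) : ℕ := walk ch (ind A) n

/-- This allows an array indexed by nodes to be read as a function of vertex sets. -/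
lemma IsTrie.key_inj {ch : ℕ → ℕ} {last : ℕ} (ht : IsTrie ch last) {A B : Set (Fin n)}
    (hA : key ch A ≠ 0) (h : key ch A = key ch B) : A = B := by
  ext x
  rw [← ind_ne_zero, ← ind_ne_zero, ht.walk_inj n (fun _ _ => ind_le_one _ _)
    (fun _ _ => ind_le_one _ _) hA h x x.2]

/-- The trie `ch'` extends the trie `ch`. -/
def TrieLe (ch ch' : ℕ → ℕ) : Prop := ∀ i, ch i ≠ 0 → ch' i = ch i

lemma TrieLe.trans {ch ch' ch'' : ℕ → ℕ} (h : TrieLe ch ch') (h' : TrieLe ch' ch'') :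
    TrieLe ch ch'' := fun i hi => by
  have := h i hi
  rw [h' i (by rwa [this]), this]

lemma IsTrie.key_ext {ch ch' : ℕ → ℕ} {last : ℕ} (ht : IsTrie ch last) (h : TrieLe ch ch')
    {A : Set (Fin n)} (hA : key ch A ≠ 0) : key ch' A = key ch A :=
  walk_ext ht.low h n (fun _ _ => ind_le_one _ _) hA

lemma run_intern_set {s : State} (hn : s.reg 1 = n) (ht : IsTrie (s.mem 5) (s.reg 8))
    {A : Set (Fin n)} (hA : ∀ x : Fin n, s.mem 14 x = ind A x) :
    Run Program.intern s (70 * n + 8) fun s' => IsTrie (s'.mem 5) (s'.reg 8) ∧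
      TrieLe (s.mem 5) (s'.mem 5) ∧ s'.reg 21 = key (s'.mem 5) A ∧ s'.reg 21 ≠ 0 := by
  have hA' : ∀ x < n, s.mem 14 x = ind A x := fun x hx => hA ⟨x, hx⟩
  refine (run_intern hn ht fun x hx => ?_).mono le_rfl fun s' _ h => ⟨h.1, h.2.1, ?_, h.2.2.2⟩
  · rw [hA' x hx]; exact ind_le_one _ _
  · rw [h.2.2.1]; exact walk_congr n hA'

/-- The trie nodes of the components with non-isolated labels are recorded. -/
def HoldsComponents (G : SimpleGraph (Fin n)) (s : State) : Prop :=
  ∀ v u : Fin n, G.Adj v u → s.mem 6 v = key (s.mem 5) (labelSet (n := n) (s.mem 4) v) ∧ s.mem 6 v ≠ 0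

/-- Only the `h` non-isolated vertices are treated as labels, which keeps the cost `h * n` within `n
* M`. By `Labels.exists_adj`, a component with any other label has no incident edges and is never
needed. -/
lemma run_internComponents {s : State} (hs : HoldsGraph G K M h s)
    (ht : IsTrie (s.mem 5) (s.reg 8)) :
    Run Program.internComponents s (h * (100 * n + 50) + 6) fun s' =>
      IsTrie (s'.mem 5) (s'.reg 8) ∧ TrieLe (s.mem 5) (s'.mem 5) ∧ HoldsComponents G s' := by
  refine Run.forLoop_const (100 * n + 42) (fun j s' => IsTrie (s'.mem 5) (s'.reg 8) ∧
    TrieLe (s.mem 5) (s'.mem 5) ∧ ∀ v : Fin n, (∃ i < j, s.mem 3 i = v) →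
      s'.mem 6 v = key (s'.mem 5) (labelSet (n := n) (s.mem 4) v) ∧ s'.mem 6 v ≠ 0)
    hs.nzCount rfl rfl rfl ⟨ht, fun i _ => rfl, by simp⟩ ?_ (by nlinarith) ?_
  · rintro j hj s₁ ha hi ⟨h1, h2, h3⟩
    obtain ⟨v, hv, -⟩ := hs.nz.valid j hj
    have hs₁ := hs.agree ha rfl
    have h4 : s₁.mem 4 = s.mem 4 := ha.mem 4 rfl
    refine Run.seq (B₁ := 3) (Q := fun s' => s' = s₁.setReg 17 v) (Run.line rfl (by decide) ?_) ?_
      (B₂ := 100 * n + 30) (by omega)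
    · simp [Program.result, Expr.eval, hi, ha.mem 3 rfl, hv]
    rintro s₂ ha₂ hs₂
    have hg₂ := hs₁.agree ha₂ rfl
    refine Run.seq (B₁ := 21 * n + 6) (Q := fun s' => ∀ x : Fin n, s'.mem 14 x =
      ind (labelSet (n := n) (s.mem 4) v) x) ?_ ?_ (B₂ := 70 * n + 24) (by omega)
    · refine Run.forLoop_const 13 (fun j s' => ∀ x : Fin n, (x : ℕ) < j → s'.mem 14 x =
        ind (labelSet (n := n) (s.mem 4) v) x) hg₂.vertices rfl rfl rfl (by simp) ?_ (by omega)
        fun s' _ _ h x => h x x.2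
      intro i hi' s₃ ha₃ hi₃ hI
      refine Run.line rfl (by decide) ?_
      intro x hx
      have e4 : s₃.mem 4 = s.mem 4 := by rw [ha₃.mem 4 rfl, ha₂.mem 4 rfl, h4]
      have e17 : s₃.reg 17 = v := by rw [ha₃.reg 17 rfl, hs₂]; simp
      simp only [Program.result, State.setReg_mem, State.setMem_mem, if_true, hi₃, Expr.eval,
        Function.update_apply]
      split_ifs with hxi
      · apply eq_ind_of
        · simp only [Expr.eq, Expr.eval]; omega
        · rw [Ne, Expr.eq_eval_eq_zero]
          simp only [Expr.eval, hi₃, e4, e17, ← hxi, not_not]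
          rfl
      · exact hI x (by omega)
    rintro s₃ ha₃ hA
    have hg₃ := hg₂.agree ha₃ rfl
    have e5 : s₃.mem 5 = s₁.mem 5 := by rw [ha₃.mem 5 rfl, ha₂.mem 5 rfl]
    have e8 : s₃.reg 8 = s₁.reg 8 := by rw [ha₃.reg 8 rfl, ha₂.reg 8 rfl]
    refine Run.seq (run_intern_set hg₃.vertices (by rw [e5, e8]; exact h1) hA) ?_ (B₂ := 3)
      (by omega)
    rintro s₄ ha₄ ⟨t1, t2, t3, t4⟩
    refine Run.line rfl (by decide) ?_
    have e17 : s₄.reg 17 = v := by rw [ha₄.reg 17 rfl, ha₃.reg 17 rfl, hs₂]; simp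
    have e6 : s₄.mem 6 = s₁.mem 6 := by rw [ha₄.mem 6 rfl, ha₃.mem 6 rfl, ha₂.mem 6 rfl]
    rw [e5] at t2
    refine ⟨by simpa [Program.result] using t1, by simpa [Program.result] using h2.trans t2, ?_⟩
    rintro u ⟨i, hij, hiu⟩
    simp only [Program.result, State.setReg_mem, State.setMem_mem, if_true, Expr.eval, e17,
      Function.update_apply, ← Fin.ext_iff]
    simp only [show (5 : ℕ) ≠ 6 by decide, if_false]
    by_cases huv : u = v
    · simp only [huv, if_true]
      exact ⟨t3, t4⟩
    · simp only [huv, if_false]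
      have hlt : i < j := by
        rcases Nat.lt_succ_iff_lt_or_eq.1 hij with h | h
        · exact h
        · subst h
          exact absurd (Fin.ext (by omega)) huv
      obtain ⟨q1, q2⟩ := h3 u ⟨i, hlt, hiu⟩
      rw [e6]
      exact ⟨by rw [q1, h1.key_ext t2 (by rwa [← q1])], q2⟩
  · rintro s₁ ha hi ⟨h1, h2, h3⟩
    refine ⟨h1, h2, fun v u hvu => ?_⟩
    rw [ha.mem 4 rfl]
    exact h3 v (hs.nz.complete v u hvu)

end Cliques

/-! ### The triples of a clique -/

section Triples

variable {n : ℕ} {G : SimpleGraph (Fin n)} {Ω : Set (Fin n)} {lab : ℕ → ℕ} {K M h : ℕ}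

lemma Labels.mem_nb (hl : Labels G Ω lab) (v u : Fin n) :
    u ∈ nb G (labelSet lab v) ↔ lab u = n ∧ ∃ x : Fin n, lab x = v ∧ G.Adj x u := by
  rw [hl.eq_iff]
  constructor
  · intro hu
    obtain ⟨x, hx, hxu⟩ := hu.2
    exact ⟨hl.compFam.nb_sub v hu, x, hx, hxu⟩
  · rintro ⟨hu, x, hx, hxu⟩
    exact ⟨fun h => hl.compFam.disj v u h hu, x, hx, hxu⟩

lemma run_markSeparator {s : State} (hs : HoldsGraph G K M h s) (hl : Labels G Ω (s.mem 4))
    {v : Fin n} (hv : s.reg 17 = v) :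
    Run Program.markSeparator s (14 * n + 48 * M + 12) fun s' =>
      (∀ u : Fin n, s'.mem 7 u = ind (nb G (labelSet (s.mem 4) v)) u) ∧
        ∀ u : Fin n, s'.mem 8 u = 0 := by
  refine Run.seq (B₁ := 14 * n + 6) (B₂ := 48 * M + 6)
    (Q := fun s' => ∀ u < n, s'.mem 7 u = 0 ∧ s'.mem 8 u = 0) ?_ ?_ (by omega)
  · refine Run.forLoop_const 6 (fun j s' => ∀ u < j, s'.mem 7 u = 0 ∧ s'.mem 8 u = 0) hs.vertices
      rfl rfl rfl (by simp) ?_ (by omega) fun s' _ _ h => h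
    intro j hj s₁ ha hi hI
    refine Run.line rfl (by decide) ?_
    intro x hx
    simp only [Program.result, Expr.eval, hi, State.setReg_mem, State.setMem_mem, State.setMem_reg,
      if_true, Function.update_apply]
    by_cases hxj : x = j
    · simp [hxj]
    · simpa [hxj] using hI x (by omega)
  intro s₁ ha hz
  have hs₁ := hs.agree ha rfl
  have h4 : s₁.mem 4 = s.mem 4 := ha.mem 4 rfl
  have h1 : s₁.mem 1 = s.mem 1 := ha.mem 1 rfl
  have h2 : s₁.mem 2 = s.mem 2 := ha.mem 2 rfl
  refine Run.forLoop_const 40 (fun j s' => (∀ u : Fin n, s'.mem 7 u ≤ 1) ∧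
    ∀ u : Fin n, s'.mem 7 u ≠ 0 ↔ ∃ e < j, s.mem 4 (s.mem 1 e) = v ∧ s.mem 4 (s.mem 2 e) = n ∧
      s.mem 2 e = u) hs₁.arcCount rfl rfl rfl ?_ ?_ (by omega) ?_
  · exact ⟨fun u => by simp [hz u u.2], fun u => by simp [hz u u.2]⟩
  · rintro j hj s₂ ha₂ hi₂ ⟨hI1, hI2⟩
    refine Run.line rfl (by decide) ?_
    have e4 : s₂.mem 4 = s.mem 4 := by rw [ha₂.mem 4 rfl, h4]
    have e1 : s₂.mem 1 = s.mem 1 := by rw [ha₂.mem 1 rfl, h1]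
    have e2 : s₂.mem 2 = s.mem 2 := by rw [ha₂.mem 2 rfl, h2]
    have en : s₂.reg 1 = n := (hs₁.agree ha₂ rfl).vertices
    have ev : s₂.reg 17 = v := by rw [ha₂.reg 17 rfl, ha.reg 17 rfl, hv]
    have hc : ((Program.labTail.eq (.reg 17)).mul (Program.labHead.eq (.reg 1))).eval s₂ = 0 ↔
        ¬ (s.mem 4 (s.mem 1 j) = v ∧ s.mem 4 (s.mem 2 j) = n) := by
      simp only [Expr.eval, mul_eq_zero, Expr.eq_eval_eq_zero, Program.labTail, Program.labHead,
        hi₂, e4, e1, e2, en, ev]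
      tauto
    simp only [Program.result, hc]
    by_cases hcond : s.mem 4 (s.mem 1 j) = v ∧ s.mem 4 (s.mem 2 j) = n
    · simp only [hcond, and_self, not_true_eq_false, if_false]
      have hm : ∀ u : Fin n, ((s₂.setMem 7 ((Expr.load 2 (Expr.reg 12)).eval s₂)
          ((Expr.lit 1).eval s₂)).setReg 12 (j + 1)).mem 7 u =
            if s.mem 2 j = u then 1 else s₂.mem 7 u := by
        intro u
        simp [Expr.eval, hi₂, e2, Function.update_apply, eq_comm]
      refine ⟨fun u => ?_, fun u => ?_⟩
      · rw [hm]; split_ifs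
        · exact le_rfl
        · exact hI1 u
      · rw [hm]; split_ifs with hu
        · simp only [ne_eq, one_ne_zero, not_false_eq_true, true_iff]
          exact ⟨j, by omega, hcond.1, hcond.2, hu⟩
        · rw [hI2]
          constructor
          · rintro ⟨e, he, h⟩; exact ⟨e, by omega, h⟩
          · rintro ⟨e, he, h⟩
            rcases Nat.lt_succ_iff_lt_or_eq.1 he with h' | h'
            · exact ⟨e, h', h⟩
            · subst h'; exact absurd h.2.2 hu
    · simp only [hcond, not_false_eq_true, if_true]
      refine ⟨by simpa using hI1, fun u => ?_⟩
      rw [State.setReg_mem, hI2]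
      constructor
      · rintro ⟨e, he, h⟩; exact ⟨e, by omega, h⟩
      · rintro ⟨e, he, h⟩
        rcases Nat.lt_succ_iff_lt_or_eq.1 he with h' | h'
        · exact ⟨e, h', h⟩
        · subst h'; exact absurd ⟨h.1, h.2.1⟩ hcond
  · rintro s₂ ha₂ hi₂ ⟨hI1, hI2⟩
    refine ⟨fun u => eq_ind_of (hI1 u) ?_, fun u => ?_⟩
    · rw [hI2, hl.mem_nb]
      constructor
      · rintro ⟨e, he, q1, q2, q3⟩
        obtain ⟨a, b, hab, ra, rb⟩ := hs.arcs.valid e he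
        have : b = u := Fin.ext (by omega)
        subst this
        rw [ra] at q1
        exact ⟨by rw [← q3]; exact q2, a, q1, hab⟩
      · rintro ⟨q1, x, q2, q3⟩
        obtain ⟨e, he, ra, rb⟩ := hs.arcs.complete x u q3
        exact ⟨e, he, by rw [ra, q2], by rw [rb, q1], rb⟩
    · rw [ha₂.mem 8 rfl]; exact (hz u u.2).2

/-- All neighbours of a component lie in `Ω`. It therefore belongs to the block exactly if an arc
leads from it to a vertex of `Ω` not marked as a member of `S`. -/
lemma run_markBlock {s : State} (hs : HoldsGraph G K M h s) (hl : Labels G Ω (s.mem 4))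
    {S : Set (Fin n)} (hS : ∀ u : Fin n, s.mem 7 u = ind S u) (hz : ∀ u : Fin n, s.mem 8 u = 0) :
    Run Program.markBlock s (68 * M + 8) fun s' =>
      s'.reg 19 = {p : Fin n × Fin n | p.1 ∈ S ∧ p.2 ∈ S ∧ G.Adj p.1 p.2}.ncard ∧
      (∀ i : Fin n, s'.mem 8 i ≤ 1) ∧
      ∀ i : Fin n, s'.mem 8 i ≠ 0 ↔ ¬ nb G (labelSet (s.mem 4) i) ⊆ S := by
  refine Run.seq (B₁ := 2) (Q := fun s' => s' = s.setReg 19 0) (Run.line rfl le_rfl rfl) ?_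
    (B₂ := 68 * M + 6) (by omega)
  rintro _ - rfl
  refine Run.forLoop_const 60 (fun j s' => s'.reg 19 = Nat.count
    (fun e => s.mem 7 (s.mem 1 e) ≠ 0 ∧ s.mem 7 (s.mem 2 e) ≠ 0) j ∧
    (∀ i : Fin n, s'.mem 8 i ≤ 1) ∧ ∀ i : Fin n, s'.mem 8 i ≠ 0 ↔ ∃ e < j, s.mem 4 (s.mem 1 e) = i ∧ s.mem 4 (s.mem 2 e) = n ∧
      s.mem 7 (s.mem 2 e) = 0) (N := M)
    (by simp [hs.arcCount]) rfl rfl rfl ?_ ?_ (by omega) ?_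
  · exact ⟨by simp, fun i => by simp [hz], fun i => by simp [hz]⟩
  · rintro j hj s₁ ha hi ⟨hI1, hI0, hI2⟩
    have h4 : s₁.mem 4 = s.mem 4 := ha.mem 4 rfl
    have h1 : s₁.mem 1 = s.mem 1 := ha.mem 1 rfl
    have h2 : s₁.mem 2 = s.mem 2 := ha.mem 2 rfl
    have h7 : s₁.mem 7 = s.mem 7 := ha.mem 7 rfl
    have hn : s₁.reg 1 = n := by rw [ha.reg 1 rfl]; simpa using hs.vertices
    refine Run.seq (B₁ := 20) (B₂ := 40) (Q := fun s' => s'.reg 19 = Nat.count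
      (fun e => s.mem 7 (s.mem 1 e) ≠ 0 ∧ s.mem 7 (s.mem 2 e) ≠ 0) (j + 1))
      (Run.line rfl (by decide) ?_) ?_ (by omega)
    · have hc : ((Expr.load 7 (.load 1 (.reg 12))).mul (.load 7 (.load 2 (.reg 12)))).eval s₁ = 0 ↔
          ¬ (s.mem 7 (s.mem 1 j) ≠ 0 ∧ s.mem 7 (s.mem 2 j) ≠ 0) := by
        simp only [Expr.eval, mul_eq_zero, hi, h7, h1, h2]
        tauto
      simp only [Program.result, hc, Nat.count_succ]
      by_cases h : s.mem 7 (s.mem 1 j) ≠ 0 ∧ s.mem 7 (s.mem 2 j) ≠ 0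
      · simp [h, Program.incr, Program.result, Expr.eval, hI1]
      · simp only [h, not_false_eq_true, if_true, if_false, hI1, add_zero]
    · intro s₂ ha₂ hcount
      have e12 : s₂.reg 12 = j := by rw [ha₂.reg 12 rfl, hi]
      have e4 : s₂.mem 4 = s.mem 4 := by rw [ha₂.mem 4 rfl, h4]
      have e1 : s₂.mem 1 = s.mem 1 := by rw [ha₂.mem 1 rfl, h1]
      have e2 : s₂.mem 2 = s.mem 2 := by rw [ha₂.mem 2 rfl, h2]
      have e7 : s₂.mem 7 = s.mem 7 := by rw [ha₂.mem 7 rfl, h7]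
      have e8 : s₂.mem 8 = s₁.mem 8 := by rw [ha₂.mem 8 rfl]
      have en : s₂.reg 1 = n := by rw [ha₂.reg 1 rfl, hn]
      refine Run.line rfl (by decide) ?_
      have hc : ((Expr.mul (Program.labHead.eq (.reg 1))
          (.sub (.lit 1) (.load 7 (.load 2 (.reg 12))))).mul
          (Program.labTail.lt (.reg 1))).eval s₂ = 0 ↔
          ¬ (s.mem 4 (s.mem 2 j) = n ∧ s.mem 7 (s.mem 2 j) = 0 ∧ s.mem 4 (s.mem 1 j) < n) := by
        have h5 := Expr.eq_eval_eq_zero s₂ Program.labHead (.reg 1)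
        have h6 := Expr.lt_eval_eq_zero s₂ Program.labTail (.reg 1)
        simp only [Program.labTail, Program.labHead, Expr.eval, e12, e4, e1, e2, en] at h5 h6
        simp only [Expr.eval, mul_eq_zero, Program.labTail, Program.labHead, h5, h6,
          e12, e2, e7]
        rw [show 1 - s.mem 7 (s.mem 2 j) = 0 ↔ ¬ s.mem 7 (s.mem 2 j) = 0 by omega]
        tauto
      simp only [Program.result, hc]
      by_cases hcond : s.mem 4 (s.mem 2 j) = n ∧ s.mem 7 (s.mem 2 j) = 0 ∧ s.mem 4 (s.mem 1 j) < n
      · simp only [hcond, and_self, not_true_eq_false, if_false]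
        have hm : ∀ i : Fin n, ((s₂.setMem 8 (Program.labTail.eval s₂)
          ((Expr.lit 1).eval s₂)).setReg 12 (j + 1)).mem 8 i =
            if s.mem 4 (s.mem 1 j) = i then 1 else s₁.mem 8 i := by
          intro i
          simp [Program.labTail, Expr.eval, e12, e1, e4, e8, Function.update_apply, eq_comm]
        refine ⟨by simpa using hcount, fun i => ?_, fun i => ?_⟩
        · rw [hm]; split_ifs
          · exact le_rfl
          · exact hI0 i
        rw [hm]; split_ifs with hu
        · simp only [ne_eq, one_ne_zero, not_false_eq_true, true_iff]
          exact ⟨j, by omega, hu, hcond.1, hcond.2.1⟩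
        · rw [hI2]
          constructor
          · rintro ⟨e, he, h⟩; exact ⟨e, by omega, h⟩
          · rintro ⟨e, he, h⟩
            rcases Nat.lt_succ_iff_lt_or_eq.1 he with h' | h'
            · exact ⟨e, h', h⟩
            · subst h'; exact absurd h.1 hu
      · simp only [hcond, not_false_eq_true, if_true]
        refine ⟨by simpa using hcount, fun i => by simpa [e8] using hI0 i, fun i => ?_⟩
        rw [State.setReg_mem, e8, hI2]
        constructor
        · rintro ⟨e, he, h⟩; exact ⟨e, by omega, h⟩
        · rintro ⟨e, he, h⟩
          rcases Nat.lt_succ_iff_lt_or_eq.1 he with h' | h'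
          · exact ⟨e, h', h⟩
          · subst h'
            have := i.2
            exact absurd ⟨h.2.1, h.2.2, by omega⟩ hcond
  · rintro s₁ ha hi ⟨hI1, hI0, hI2⟩
    refine ⟨?_, hI0, ?_⟩
    · rw [hI1, hs.arcs.count fun a b => s.mem 7 a ≠ 0 ∧ s.mem 7 b ≠ 0]
      congr 1
      ext p
      simp only [Set.mem_ofPred_eq, hS, ind_ne_zero]
      tauto
    · intro i
      rw [hI2, Set.not_subset]
      constructor
      · rintro ⟨e, he, q1, q2, q3⟩
        obtain ⟨a, b, hab, ra, rb⟩ := hs.arcs.valid e he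
        rw [rb] at q2 q3
        rw [ra] at q1
        refine ⟨b, (hl.mem_nb i b).2 ⟨q2, a, q1, hab⟩, fun hb => ?_⟩
        rw [← ind_ne_zero, ← hS] at hb
        exact hb q3
      · rintro ⟨u, hu, huS⟩
        obtain ⟨q1, x, q2, q3⟩ := (hl.mem_nb i u).1 hu
        obtain ⟨e, he, ra, rb⟩ := hs.arcs.complete x u q3
        refine ⟨e, he, by rw [ra, q2], by rw [rb, q1], ?_⟩
        rw [rb, hS]
        by_contra hne
        exact huS ((ind_ne_zero S u).1 hne)

lemma run_collectBlock {s : State} (hn : s.reg 1 = n) (hl : Labels G Ω (s.mem 4))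
    {S : Set (Fin n)} (hS : ∀ u : Fin n, s.mem 7 u = ind S u)
    (hg : ∀ i : Fin n, s.mem 8 i ≤ 1)
    (hg' : ∀ i : Fin n, s.mem 8 i ≠ 0 ↔ ¬ nb G (labelSet (s.mem 4) i) ⊆ S) :
    Run Program.collectBlock s (70 * n + 10) fun s' =>
      s'.reg 18 = S.ncard ∧ s'.reg 20 = (blk G Ω (labelSet (s.mem 4)) S).ncard ∧
      ∀ x : Fin n, s'.mem 14 x = ind (blk G Ω (labelSet (s.mem 4)) S) x := by
  refine Run.seq (B₁ := 2) (Q := fun s' => s' = s.setReg 18 0) (Run.line rfl le_rfl rfl) ?_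
    (B₂ := 70 * n + 8) (by omega)
  rintro _ - rfl
  refine Run.seq (B₁ := 2) (Q := fun s' => s' = (s.setReg 18 0).setReg 20 0)
    (Run.line rfl le_rfl rfl) ?_ (B₂ := 70 * n + 6) (by omega)
  rintro _ - rfl
  set C := blk G Ω (labelSet (s.mem 4)) S with hC
  refine Run.forLoop_const 60 (fun j s' => s'.reg 18 = Nat.count (fun x => ind S x ≠ 0) j ∧
    s'.reg 20 = Nat.count (fun x => ind C x ≠ 0) j ∧
    ∀ x < j, s'.mem 14 x = ind C x) (N := n) (by simp [hn]) rfl rfl rfl (by simp) ?_ (by omega) ?_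
  · rintro j hj s₁ ha hi ⟨hI1, hI2, hI3⟩
    have h4 : s₁.mem 4 = s.mem 4 := ha.mem 4 rfl
    have h7 : s₁.mem 7 = s.mem 7 := ha.mem 7 rfl
    have h8 : s₁.mem 8 = s.mem 8 := ha.mem 8 rfl
    have hn₁ : s₁.reg 1 = n := by rw [ha.reg 1 rfl]; simpa using hn
    let x : Fin n := ⟨j, hj⟩
    refine Run.seq (B₁ := 20) (B₂ := 40) (Q := fun s' => s' = s₁.setMem 14 j (ind C j))
      (Run.line rfl (by decide) ?_) ?_ (by omega)
    · have hc : ((Expr.load 4 (.reg 12)).lt (.reg 1)).eval s₁ = 0 ↔ ¬ x ∉ Ω := by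
        rw [Expr.lt_eval_eq_zero, ← hl.lt_iff]
        simp [Expr.eval, hi, h4, hn₁, x]
      simp only [Program.result]
      by_cases hx : x ∈ Ω
      · have : (Expr.sub (.lit 1) (.load 7 (.reg 12))).eval s₁ = ind C j := by
          refine eq_ind_of (x := x) ?_ ?_
          · simp only [Expr.eval]; omega
          · have h1 := hS x
            have h2 := ind_ne_zero S x
            have : x ∈ C ↔ x ∉ S := by
              rw [hC]
              constructor
              · rintro (h | ⟨i, h, _⟩)
                · exact h.2
                · exact absurd hx (hl.compFam.disj i x h)
              · exact fun h => Or.inl ⟨hx, h⟩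
            rw [this, ← h2, ← h1]
            simp only [Expr.eval, hi, h7]
            have := ind_le_one S x
            change ¬ (1 - s.mem 7 j = 0) ↔ ¬ (s.mem 7 j ≠ 0)
            omega
        rw [if_pos (hc.2 (not_not.2 hx)), this]
        simp [Expr.eval, hi]
      · have : (Expr.load 8 (.load 4 (.reg 12))).eval s₁ = ind C j := by
          obtain ⟨l, hxl, _⟩ := hl.root x hx
          have hev : (Expr.load 8 (.load 4 (.reg 12))).eval s₁ = s.mem 8 l := by
            rw [← hxl]; simp [Expr.eval, hi, h4, h8, x]
          rw [hev]
          refine eq_ind_of (x := x) (hg l) ?_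
          rw [hg']
          constructor
          · exact fun h => Or.inr ⟨l, hxl, h⟩
          · rintro (h | ⟨i, h, h'⟩)
            · exact absurd h.1 hx
            · rwa [hl.compFam.inj l i x hxl h]
        rw [if_neg (fun h => hc.1 h hx), this]
        simp [Expr.eval, hi]
    · rintro _ - rfl
      refine Run.line rfl (by decide) ?_
      have hm14 : ∀ y < j + 1, Function.update (s₁.mem 14) j (ind C j) y = ind C y := by
        intro y hy
        rw [Function.update_apply]
        split_ifs with hyj
        · rw [hyj]
        · exact hI3 y (by omega)
      have e7 : s₁.mem 7 j = ind S j := by rw [h7]; exact hS x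
      by_cases h1 : ind S j = 0 <;> by_cases h2 : ind C j = 0 <;>
        simp [Program.result, Expr.eval, Program.incr, hi, e7, h1, h2, hI1, hI2, Nat.count_succ] <;>
        simpa [h2] using hm14
  · rintro s₁ ha hi ⟨hI1, hI2, hI3⟩
    refine ⟨?_, ?_, fun x => hI3 x x.2⟩
    · rw [hI1, count_eq_ncard]
      congr 1; ext x; exact ind_ne_zero S x
    · rw [hI2, count_eq_ncard]
      congr 1; ext x; exact ind_ne_zero C x

end Triples

/-! ### Recording the block of one clique and one component. -/

section Record

variable {n : ℕ} {G : SimpleGraph (Fin n)} {Ω : Set (Fin n)} {lab : ℕ → ℕ} {K M h : ℕ}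

/-- An isolated root would be its whole connected component and thus equal to `x`. Hence loops over
non-isolated vertices see every component with an edge. -/
lemma Labels.exists_adj (hl : Labels G Ω lab) {i x u : Fin n} (hx : x ∈ labelSet lab i)
    (hxu : G.Adj x u) : ∃ w, G.Adj i w := by
  by_contra hc
  push Not at hc
  have : ({i} : Set (Fin n)) = labelSet lab i := by
    apply hl.compFam.conn i
    · simpa using hl.mem_self hx
    · exact ⟨i, rfl⟩
    · rintro a rfl b _ hab
      exact absurd hab (hc b)
  rw [← this] at hx
  obtain rfl : x = i := hx
  exact hc u hxu

/-- The entries with index `τ` describe the block of the clique `Ω` and the component `D v`. -/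
structure TripleAt (G : SimpleGraph (Fin n)) (K : ℕ) (s : State) (τ : ℕ) (Ω : Set (Fin n))
    (D : Fin n → Set (Fin n)) (v : Fin n) : Prop where
  node : s.mem 9 τ = key (s.mem 5) (blk G Ω D (nb G (D v)))
  node_ne : s.mem 9 τ ≠ 0
  weight : s.mem 10 τ = K - (fill2 G Ω - fill2 G (nb G (D v)))
  size : s.mem 11 τ = (blk G Ω D (nb G (D v))).ncard
  comp : ∀ i : Fin n, ¬ nb G (D i) ⊆ nb G (D v) →
    s.mem 12 (τ * n + i) = key (s.mem 5) (D i) ∧ s.mem 12 (τ * n + i) ≠ 0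
  comp_zero : ∀ i : Fin n, nb G (D i) ⊆ nb G (D v) → s.mem 12 (τ * n + i) = 0

/-- The trie is extended and the first `T` triples are kept. -/
structure Keeps (n T : ℕ) (s s' : State) : Prop where
  trie : TrieLe (s.mem 5) (s'.mem 5)
  node : ∀ τ < T, s'.mem 9 τ = s.mem 9 τ
  weight : ∀ τ < T, s'.mem 10 τ = s.mem 10 τ
  size : ∀ τ < T, s'.mem 11 τ = s.mem 11 τ
  comp : ∀ i < T * n, s'.mem 12 i = s.mem 12 i

lemma Keeps.trans {T T' : ℕ} {s s' s'' : State} (h : Keeps n T s s') (h' : Keeps n T' s' s'')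
    (hT : T ≤ T') : Keeps n T s s'' := by
  have := Nat.mul_le_mul_right n hT
  exact ⟨h.trie.trans h'.trie, fun τ hτ => by rw [h'.node τ (by omega), h.node τ hτ],
    fun τ hτ => by rw [h'.weight τ (by omega), h.weight τ hτ],
    fun τ hτ => by rw [h'.size τ (by omega), h.size τ hτ],
    fun i hi => by rw [h'.comp i (by omega), h.comp i hi]⟩

lemma TripleAt.keep {T last τ : ℕ} {s s' : State} {D : Fin n → Set (Fin n)} {v : Fin n}
    (h : TripleAt G K s τ Ω D v) (hτ : τ < T) (ht : IsTrie (s.mem 5) last)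
    (hk : Keeps n T s s') : TripleAt G K s' τ Ω D v := by
  have hidx : ∀ i : Fin n, τ * n + i < T * n := fun i => by
    have := Nat.mul_le_mul_right n (Nat.succ_le_of_lt hτ)
    rw [Nat.succ_mul] at this
    omega
  refine ⟨?_, ?_, ?_, ?_, ?_, ?_⟩
  · have h1 := h.node
    rw [hk.node τ hτ, h1, ht.key_ext hk.trie]
    rw [← h1]; exact h.node_ne
  · rw [hk.node τ hτ]; exact h.node_ne
  · rw [hk.weight τ hτ, h.weight]
  · rw [hk.size τ hτ, h.size]
  · intro i hi
    obtain ⟨h1, h2⟩ := h.comp i hi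
    rw [hk.comp _ (hidx i)]
    refine ⟨?_, h2⟩
    rw [h1, ht.key_ext hk.trie]
    rwa [← h1]
  · intro i hi
    rw [hk.comp _ (hidx i)]
    exact h.comp_zero i hi

lemma HoldsComponents.keep {last : ℕ} {s s' : State} (h : HoldsComponents G s)
    (ht : IsTrie (s.mem 5) last) (h5 : TrieLe (s.mem 5) (s'.mem 5)) (h4 : s'.mem 4 = s.mem 4)
    (h6 : s'.mem 6 = s.mem 6) : HoldsComponents G s' := by
  intro v u hvu
  obtain ⟨h1, h2⟩ := h v u hvu
  rw [h4, h6]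
  refine ⟨?_, h2⟩
  rw [h1, ht.key_ext h5]
  rwa [← h1]

lemma run_recordComponents {s : State} {T : ℕ} (hn : s.reg 1 = n) (hT : s.reg 23 = T) :
    Run Program.recordComponents s (30 * n + 6) fun s' =>
      (∀ i < n, s'.mem 12 (T * n + i) = if s.mem 8 i = 0 then 0 else s.mem 6 i) ∧
      ∀ i < T * n, s'.mem 12 i = s.mem 12 i := by
  refine Run.forLoop_const 20 (fun j s' =>
      (∀ i < j, s'.mem 12 (T * n + i) = if s.mem 8 i = 0 then 0 else s.mem 6 i) ∧
      ∀ i < T * n, s'.mem 12 i = s.mem 12 i) hn rfl rfl rfl (by simp) ?_ (by omega)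
      fun s' _ _ h => h
  rintro j hj s₁ ha hi ⟨h1, h2⟩
  refine Run.line rfl (by decide) ?_
  have hn₁ : s₁.reg 1 = n := by rw [ha.reg 1 rfl, hn]
  have hT₁ : s₁.reg 23 = T := by rw [ha.reg 23 rfl, hT]
  have hres : Program.result (.ite (.load 8 (.reg 12))
    (.store 12 (.add (.mul (.reg 23) (.reg 1)) (.reg 12)) (.load 6 (.reg 12)))
    (.store 12 (.add (.mul (.reg 23) (.reg 1)) (.reg 12)) (.lit 0))) s₁ =
      s₁.setMem 12 (T * n + j) (if s.mem 8 j = 0 then 0 else s.mem 6 j) := by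
    simp only [Program.result, Expr.eval, hi, hn₁, hT₁, ha.mem 8 rfl, ha.mem 6 rfl]
    split_ifs <;> rfl
  rw [hres]
  simp only [State.setReg_mem, State.setMem_mem, if_true, Function.update_apply]
  constructor
  · intro i hij
    by_cases h : i = j
    · simp [h]
    · rw [if_neg (by omega)]; exact h1 i (by omega)
  · intro i hi'
    rw [if_neg (by omega)]; exact h2 i hi'

/-- The data of the current clique. -/
structure HoldsClique (G : SimpleGraph (Fin n)) (Ω : Set (Fin n)) (s : State) : Prop where
  size : s.reg 15 = Ω.ncard
  arcs : s.reg 16 = {p : Fin n × Fin n | p.1 ∈ Ω ∧ p.2 ∈ Ω ∧ G.Adj p.1 p.2}.ncard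
  labels : Labels G Ω (s.mem 4)

/-- The vertex `v` need not be a label. If it is not, its label set and the separator are empty;
this provides the blocks without neighbours. -/
lemma run_triple {s : State} {T j : ℕ} {v : Fin n} (hs : HoldsGraph G K M h s)
    (hc : HoldsClique G Ω s) (ht : IsTrie (s.mem 5) (s.reg 8)) (hd : HoldsComponents G s)
    (hT : s.reg 23 = T) (hj : s.reg 11 = j) (hv : s.mem 3 j = v) :
    Run Program.triple s (200 * n + 120 * M + 100) fun s' => IsTrie (s'.mem 5) (s'.reg 8) ∧
      Keeps n T s s' ∧ s'.reg 23 = T + 1 ∧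
      TripleAt G K s' T Ω (labelSet (s.mem 4)) v := by
  have hl := hc.labels
  set S := nb G (labelSet (s.mem 4) v) with hS
  set C := blk G Ω (labelSet (s.mem 4)) S with hC
  refine Run.seq (B₁ := 3) (Q := fun s' => s' = s.setReg 17 v) (Run.line rfl (by decide) ?_) ?_
    (B₂ := 200 * n + 120 * M + 97) (by omega)
  · simp [Program.result, Expr.eval, hj, hv]
  intro s₁ a₁ q₁
  have g₁ := hs.agree a₁ rfl
  have l₁ : s₁.mem 4 = s.mem 4 := a₁.mem 4 rfl
  have v₁ : s₁.reg 17 = v := by rw [q₁]; simp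
  refine Run.seq (run_markSeparator (Ω := Ω) g₁ (by rw [l₁]; exact hl) v₁) ?_
    (B₂ := 180 * n + 72 * M + 85) (by omega)
  rintro s₂ a₂ ⟨q₂, z₂⟩
  have g₂ := g₁.agree a₂ rfl
  have l₂ : s₂.mem 4 = s.mem 4 := by rw [a₂.mem 4 rfl, l₁]
  rw [l₁] at q₂
  refine Run.seq (run_markBlock (Ω := Ω) g₂ (by rw [l₂]; exact hl) q₂ z₂) ?_
    (B₂ := 180 * n + 77) (by omega)
  rintro s₃ a₃ ⟨q₃, b₃, r₃⟩
  have g₃ := g₂.agree a₃ rfl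
  have l₃ : s₃.mem 4 = s.mem 4 := by rw [a₃.mem 4 rfl, l₂]
  rw [l₂] at r₃
  have q₃' : ∀ u : Fin n, s₃.mem 7 u = ind S u := by rw [a₃.mem 7 rfl]; exact q₂
  refine Run.seq (run_collectBlock (Ω := Ω) g₃.vertices (by rw [l₃]; exact hl) q₃' b₃
    (by rw [l₃]; exact r₃)) ?_ (B₂ := 110 * n + 67) (by omega)
  rintro s₄ a₄ ⟨q₄, r₄, t₄⟩
  rw [l₃] at r₄ t₄
  have g₄ := g₃.agree a₄ rfl
  have e5 : s₄.mem 5 = s.mem 5 := by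
    rw [a₄.mem 5 rfl, a₃.mem 5 rfl, a₂.mem 5 rfl, a₁.mem 5 rfl]
  have e8 : s₄.reg 8 = s.reg 8 := by
    rw [a₄.reg 8 rfl, a₃.reg 8 rfl, a₂.reg 8 rfl, a₁.reg 8 rfl]
  refine Run.seq (run_intern_set g₄.vertices (by rw [e5, e8]; exact ht) t₄) ?_
    (B₂ := 30 * n + 59) (by omega)
  rintro s₅ a₅ ⟨t₅, u₅, q₅, n₅⟩
  have g₅ := g₄.agree a₅ rfl
  have T₅ : s₅.reg 23 = T := by
    rw [a₅.reg 23 rfl, a₄.reg 23 rfl, a₃.reg 23 rfl, a₂.reg 23 rfl, a₁.reg 23 rfl, hT]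
  refine Run.seq (run_recordComponents g₅.vertices T₅) ?_ (B₂ := 53) (by omega)
  rintro s₆ a₆ ⟨q₆, k₆⟩
  have g₆ := g₅.agree a₆ rfl
  refine Run.line rfl (by decide) ?_
  have T₆ : s₆.reg 23 = T := by rw [a₆.reg 23 rfl, T₅]
  have f21 : s₆.reg 21 = key (s₅.mem 5) C := by rw [a₆.reg 21 rfl, q₅]
  have f15 : s₆.reg 15 = Ω.ncard := by
    rw [a₆.reg 15 rfl, a₅.reg 15 rfl, a₄.reg 15 rfl, a₃.reg 15 rfl, a₂.reg 15 rfl, a₁.reg 15 rfl,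
      hc.size]
  have f16 := hc.arcs
  rw [← a₁.reg 16 rfl, ← a₂.reg 16 rfl, ← a₃.reg 16 rfl, ← a₄.reg 16 rfl, ← a₅.reg 16 rfl,
    ← a₆.reg 16 rfl] at f16
  have f18 : s₆.reg 18 = S.ncard := by rw [a₆.reg 18 rfl, a₅.reg 18 rfl, q₄]
  have f19 := q₃
  rw [← a₄.reg 19 rfl, ← a₅.reg 19 rfl, ← a₆.reg 19 rfl] at f19
  have f20 : s₆.reg 20 = C.ncard := by rw [a₆.reg 20 rfl, a₅.reg 20 rfl, r₄]
  -- All ordered pairs of distinct vertices, minus the arcs among them.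
  have fill_Ω : s₆.reg 15 * (s₆.reg 15 - 1) - s₆.reg 16 = fill2 G Ω := by
    rw [f15, f16, ← fill2_add_adj_pairs G Ω, Nat.add_sub_cancel]
  have fill_S : s₆.reg 18 * (s₆.reg 18 - 1) - s₆.reg 19 = fill2 G S := by
    rw [f18, f19, ← fill2_add_adj_pairs G S, Nat.add_sub_cancel]
  have m5 : s₆.mem 5 = s₅.mem 5 := a₆.mem 5 rfl
  have hres : Program.result Program.recordBlock s₆ =
      (((s₆.setMem 9 T (s₆.reg 21)).setMem 10 T (K - (fill2 G Ω - fill2 G S))).setMem 11 T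
        (s₆.reg 20)).setReg 23 (T + 1) := by
    simp [Program.recordBlock, Program.result, Expr.eval, T₆, Program.incr, fill_Ω, fill_S,
      g₆.param]
  rw [hres]
  have e12 : ∀ i < T * n, s₆.mem 12 i = s.mem 12 i := by
    intro i hi
    rw [k₆ i hi, a₅.mem 12 rfl, a₄.mem 12 rfl, a₃.mem 12 rfl, a₂.mem 12 rfl, a₁.mem 12 rfl]
  have e9 : s₆.mem 9 = s.mem 9 := by
    rw [a₆.mem 9 rfl, a₅.mem 9 rfl, a₄.mem 9 rfl, a₃.mem 9 rfl, a₂.mem 9 rfl, a₁.mem 9 rfl]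
  have e10 : s₆.mem 10 = s.mem 10 := by
    rw [a₆.mem 10 rfl, a₅.mem 10 rfl, a₄.mem 10 rfl, a₃.mem 10 rfl, a₂.mem 10 rfl, a₁.mem 10 rfl]
  have e11 : s₆.mem 11 = s.mem 11 := by
    rw [a₆.mem 11 rfl, a₅.mem 11 rfl, a₄.mem 11 rfl, a₃.mem 11 rfl, a₂.mem 11 rfl, a₁.mem 11 rfl]
  have e8' : s₅.mem 8 = s₃.mem 8 := by rw [a₅.mem 8 rfl, a₄.mem 8 rfl]
  have e6' : s₅.mem 6 = s.mem 6 := by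
    rw [a₅.mem 6 rfl, a₄.mem 6 rfl, a₃.mem 6 rfl, a₂.mem 6 rfl, a₁.mem 6 rfl]
  have le5 : TrieLe (s.mem 5) (s₅.mem 5) := by rw [← e5]; exact u₅
  refine ⟨?_, ⟨?_, ?_, ?_, ?_, ?_⟩, by simp, ⟨?_, ?_, ?_, ?_, ?_, ?_⟩⟩
  · simpa [m5, a₆.reg 8 rfl] using t₅
  · simpa [m5] using le5
  · intro τ hτ
    simp [hτ.ne, e9]
  · intro τ hτ
    simp [hτ.ne, e10]
  · intro τ hτ
    simp [hτ.ne, e11]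
  · intro i hi
    simpa using e12 i hi
  · simpa [m5] using f21
  · simpa [a₆.reg 21 rfl] using n₅
  · simp [S]
  · simpa using f20
  · intro i hi
    have hne : s₅.mem 8 i ≠ 0 := by rw [e8', r₃]; exact hi
    have hval : s₆.mem 12 (T * n + i) = s.mem 6 i := by rw [q₆ i i.2, if_neg hne, e6']
    obtain ⟨u, ⟨_, d, hd', hdu⟩, _⟩ := Set.not_subset.1 hi
    obtain ⟨w, hw⟩ := hl.exists_adj hd' hdu
    obtain ⟨k1, k2⟩ := hd i w hw
    simp only [State.setReg_mem, State.setMem_mem]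
    rw [if_neg (by decide), if_neg (by decide), if_neg (by decide), if_neg (by decide),
      if_neg (by decide), if_neg (by decide), hval, m5]
    refine ⟨?_, k2⟩
    rw [k1, ht.key_ext le5]
    rwa [← k1]
  · intro i hi
    have hz : s₅.mem 8 i = 0 := by
      by_contra hne
      rw [e8'] at hne
      exact (r₃ i).1 hne hi
    have hval : s₆.mem 12 (T * n + i) = 0 := by rw [q₆ i i.2, if_pos hz]
    simpa using hval

end Record

/-! ### Processing the list of cliques. -/

section Cliques

variable {n : ℕ} {G : SimpleGraph (Fin n)} {Ω : Set (Fin n)} {K M h : ℕ}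

lemma Keeps.of_mem {T : ℕ} {s s' : State} (h5 : TrieLe (s.mem 5) (s'.mem 5))
    (h9 : s'.mem 9 = s.mem 9) (h10 : s'.mem 10 = s.mem 10) (h11 : s'.mem 11 = s.mem 11)
    (h12 : s'.mem 12 = s.mem 12) : Keeps n T s s' :=
  ⟨h5, fun _ _ => by rw [h9], fun _ _ => by rw [h10], fun _ _ => by rw [h11],
    fun _ _ => by rw [h12]⟩

lemma TripleAt.setReg {s : State} {τ r a : ℕ} {D : Fin n → Set (Fin n)} {v : Fin n}
    (h : TripleAt G K s τ Ω D v) : TripleAt G K (s.setReg r a) τ Ω D v :=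
  ⟨h.node, h.node_ne, h.weight, h.size, h.comp, h.comp_zero⟩

/-- The recorded triples belong to the cliques in `P`, and for each of these there is one for
each non-isolated vertex. -/
structure HoldsTriples (G : SimpleGraph (Fin n)) (K : ℕ) (P : Set (Set (Fin n))) (s : State) :
    Prop where
  valid : ∀ τ < s.reg 23, ∃ Ω ∈ P, ∃ lab v, Labels G Ω lab ∧
    TripleAt G K s τ Ω (labelSet lab) v
  complete : ∀ Ω ∈ P, ∃ lab, Labels G Ω lab ∧ ∀ v u, G.Adj v u → ∃ τ < s.reg 23,
    TripleAt G K s τ Ω (labelSet lab) v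

lemma HoldsTriples.keep {P : Set (Set (Fin n))} {last : ℕ} {s s' : State}
    (hp : HoldsTriples G K P s) (ht : IsTrie (s.mem 5) last) (hk : Keeps n (s.reg 23) s s')
    (h23 : s'.reg 23 = s.reg 23) : HoldsTriples G K P s' := by
  constructor
  · intro τ hτ
    rw [h23] at hτ
    obtain ⟨Ω, hΩ, lab, v, hl, hv⟩ := hp.valid τ hτ
    exact ⟨Ω, hΩ, lab, v, hl, hv.keep hτ ht hk⟩
  · intro Ω hΩ
    obtain ⟨lab, hl, hv⟩ := hp.complete Ω hΩ
    refine ⟨lab, hl, fun v u hvu => ?_⟩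
    obtain ⟨τ, hτ, hv⟩ := hv v u hvu
    exact ⟨τ, by rwa [h23], hv.keep hτ ht hk⟩

lemma run_triples {P : Set (Set (Fin n))} {s : State} (hs : HoldsGraph G K M h s)
    (hc : HoldsClique G Ω s) (ht : IsTrie (s.mem 5) (s.reg 8)) (hd : HoldsComponents G s)
    (hp : HoldsTriples G K P s) :
    Run (.forLoop 11 6 Program.triple) s (h * (200 * n + 120 * M + 108) + 6) fun s' =>
      IsTrie (s'.mem 5) (s'.reg 8) ∧ s'.reg 23 = s.reg 23 + h ∧
      HoldsTriples G K (insert Ω P) s' := by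
  refine Run.forLoop_const (200 * n + 120 * M + 100) (fun j s' =>
    IsTrie (s'.mem 5) (s'.reg 8) ∧ Keeps n (s.reg 23) s s' ∧ s'.reg 23 = s.reg 23 + j ∧
    ∀ i < j, ∀ v : Fin n, s.mem 3 i = v →
      TripleAt G K s' (s.reg 23 + i) Ω (labelSet (s.mem 4)) v)
    hs.nzCount rfl rfl rfl ⟨ht, Keeps.of_mem (fun _ _ => rfl) rfl rfl rfl rfl, by simp, by simp⟩
    ?_ (by rw [show 200 * n + 120 * M + 100 + 8 = 200 * n + 120 * M + 108 by ring]) ?_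
  · rintro j hj s₁ ha hi ⟨h1, h2, h3, h4⟩
    obtain ⟨v, hv, -⟩ := hs.nz.valid j hj
    have e4 : s₁.mem 4 = s.mem 4 := ha.mem 4 rfl
    have e6 : s₁.mem 6 = s.mem 6 := ha.mem 6 rfl
    have hc₁ : HoldsClique G Ω s₁ :=
      ⟨by rw [ha.reg 15 rfl, hc.size], by rw [ha.reg 16 rfl, hc.arcs], by rw [e4]; exact hc.labels⟩
    refine (run_triple (hs.agree ha rfl) hc₁ h1 (hd.keep ht h2.trie e4 e6) h3 hi
      (by rw [ha.mem 3 rfl, hv])).mono le_rfl ?_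
    rintro s₂ ha₂ ⟨q1, q2, q3, q4⟩
    rw [e4] at q4
    refine ⟨by simpa using q1, ?_, by simp [q3]; omega, ?_⟩
    · exact (h2.trans q2 (by omega)).trans (T' := s.reg 23)
        (Keeps.of_mem (fun _ _ => rfl) rfl rfl rfl rfl) le_rfl
    · intro i hi' w hw
      rcases Nat.lt_succ_iff_lt_or_eq.1 hi' with hlt | rfl
      · exact ((h4 i hlt w hw).keep (T := s.reg 23 + j) (by omega) h1 q2).setReg
      · obtain rfl : v = w := Fin.ext (by omega)
        exact q4.setReg
  · rintro s₁ ha hi ⟨h1, h2, h3, h4⟩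
    refine ⟨h1, h3, ?_, ?_⟩
    · intro τ hτ
      by_cases hlt : τ < s.reg 23
      · obtain ⟨Ω', hΩ', lab, v, hl, hv⟩ := hp.valid τ hlt
        exact ⟨Ω', Or.inr hΩ', lab, v, hl, hv.keep hlt ht h2⟩
      · obtain ⟨v, hv, -⟩ := hs.nz.valid (τ - s.reg 23) (by omega)
        have := h4 (τ - s.reg 23) (by omega) v hv
        rw [Nat.add_sub_cancel' (by omega)] at this
        exact ⟨Ω, Or.inl rfl, s.mem 4, v, hc.labels, this⟩
    · rintro Ω' (rfl | hΩ')
      · refine ⟨s.mem 4, hc.labels, fun v u hvu => ?_⟩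
        obtain ⟨j, hj, hv⟩ := hs.nz.complete v u hvu
        exact ⟨s.reg 23 + j, by omega, h4 j hj v hv⟩
      · obtain ⟨lab, hl, hv⟩ := hp.complete Ω' hΩ'
        refine ⟨lab, hl, fun v u hvu => ?_⟩
        obtain ⟨τ, hτ, hv⟩ := hv v u hvu
        exact ⟨τ, by omega, hv.keep hτ ht h2⟩

/-- A time bound for processing a clique. -/
def cliqueCost (n M h : ℕ) : ℕ :=
  55 * n + 48 * M + 48 * (n * M) + h * (300 * n + 120 * M + 158) + 60

lemma run_clique {P : Set (Set (Fin n))} {s : State} {l : List (Fin n)}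
    (hs : HoldsGraph G K M h s) (ht : IsTrie (s.mem 5) (s.reg 8))
    (hp : HoldsTriples G K P s) (hr : Reads (s.mem 0) (s.reg 5) (encodeList l)) (hl : l.Nodup) :
    Run Program.clique s (cliqueCost n M h) fun s' =>
      IsTrie (s'.mem 5) (s'.reg 8) ∧ s'.reg 5 = s.reg 5 + (encodeList l).length ∧
      s'.reg 23 = s.reg 23 + h ∧ HoldsTriples G K (insert {x | x ∈ l} P) s' := by
  unfold cliqueCost
  set b := h * (300 * n + 120 * M + 158) with hb
  have hb' : h * (100 * n + 50) + h * (200 * n + 120 * M + 108) = b := by rw [hb]; ring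
  have hnM : n * (48 * M + 14) = 48 * (n * M) + 14 * n := by ring
  refine Run.seq (run_initLabels hs.vertices) ?_
    (B₂ := 44 * n + 48 * M + 48 * (n * M) + b + 54) (by omega)
  rintro s₁ a₁ q₁
  have g₁ := hs.agree a₁ rfl
  refine Run.seq (run_readClique (G := G) (l := l) g₁.vertices q₁
    (by rw [a₁.mem 0 rfl, a₁.reg 5 rfl]; exact hr) hl) ?_
    (B₂ := 14 * n + 48 * M + 48 * (n * M) + b + 34) (by omega)
  rintro s₂ a₂ ⟨p₂, c₂, q₂⟩
  have g₂ := g₁.agree a₂ rfl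
  refine Run.seq (run_labels g₂ q₂) ?_ (B₂ := 48 * M + b + 28) (by omega)
  rintro s₃ a₃ q₃
  have g₃ := g₂.agree a₃ rfl
  refine Run.seq (run_countArcs g₃ q₃) ?_ (B₂ := b + 20) (by omega)
  rintro s₄ a₄ q₄
  have g₄ := g₃.agree a₄ rfl
  have e5 : s₄.mem 5 = s.mem 5 := by
    rw [a₄.mem 5 rfl, a₃.mem 5 rfl, a₂.mem 5 rfl, a₁.mem 5 rfl]
  have e8 : s₄.reg 8 = s.reg 8 := by
    rw [a₄.reg 8 rfl, a₃.reg 8 rfl, a₂.reg 8 rfl, a₁.reg 8 rfl]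
  have h23 : s₄.reg 23 = s.reg 23 := by
    rw [a₄.reg 23 rfl, a₃.reg 23 rfl, a₂.reg 23 rfl, a₁.reg 23 rfl]
  have hp₄ : HoldsTriples G K P s₄ := by
    refine hp.keep ht (Keeps.of_mem ?_ ?_ ?_ ?_ ?_) h23
    · rw [e5]; exact fun _ _ => rfl
    · rw [a₄.mem 9 rfl, a₃.mem 9 rfl, a₂.mem 9 rfl, a₁.mem 9 rfl]
    · rw [a₄.mem 10 rfl, a₃.mem 10 rfl, a₂.mem 10 rfl, a₁.mem 10 rfl]
    · rw [a₄.mem 11 rfl, a₃.mem 11 rfl, a₂.mem 11 rfl, a₁.mem 11 rfl]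
    · rw [a₄.mem 12 rfl, a₃.mem 12 rfl, a₂.mem 12 rfl, a₁.mem 12 rfl]
  refine Run.seq (run_internComponents g₄ (by rw [e5, e8]; exact ht)) ?_
    (B₂ := h * (200 * n + 120 * M + 108) + 6) (by omega)
  rintro s₅ a₅ ⟨t₅, u₅, q₅⟩
  have c₅ : HoldsClique G {x | x ∈ l} s₅ := by
    refine ⟨?_, ?_, ?_⟩
    · rw [a₅.reg 15 rfl, a₄.reg 15 rfl, a₃.reg 15 rfl, c₂, ← List.toFinset_card_of_nodup hl,
        ← Set.ncard_coe_finset]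
      congr 1
      ext x
      simp
    · rw [a₅.reg 16 rfl, q₄]
    · rw [a₅.mem 4 rfl, a₄.mem 4 rfl]; exact q₃
  have hp₅ : HoldsTriples G K P s₅ := hp₄.keep (last := s.reg 8) (by rw [e5]; exact ht)
    (Keeps.of_mem u₅ (a₅.mem 9 rfl) (a₅.mem 10 rfl) (a₅.mem 11 rfl) (a₅.mem 12 rfl))
    (a₅.reg 23 rfl)
  refine (run_triples (g₄.agree a₅ rfl) c₅ t₅ q₅ hp₅).mono le_rfl ?_
  rintro s₆ a₆ ⟨t₆, r₆, q₆⟩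
  refine ⟨t₆, ?_, ?_, q₆⟩
  · rw [a₆.reg 5 rfl, a₅.reg 5 rfl, a₄.reg 5 rfl, a₃.reg 5 rfl, p₂, a₁.reg 5 rfl]
  · rw [r₆, a₅.reg 23 rfl, h23]

/-- The cliques in a list of lists. -/
def cliqueSets (L : List (List (Fin n))) : Set (Set (Fin n)) := {Ω | ∃ l ∈ L, Ω = {x | x ∈ l}}

lemma run_cliques {s : State} {L : List (List (Fin n))} (hs : HoldsGraph G K M h s)
    (ht : IsTrie (s.mem 5) (s.reg 8)) (h23 : s.reg 23 = 0) (h2 : s.reg 2 = L.length)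
    (hr : Reads (s.mem 0) (s.reg 5) (L.flatMap encodeList)) (hL : ∀ l ∈ L, l.Nodup) :
    Run (.forLoop 10 2 Program.clique) s (L.length * (cliqueCost n M h + 8) + 6) fun s' =>
      IsTrie (s'.mem 5) (s'.reg 8) ∧ s'.reg 23 = L.length * h ∧
      HoldsTriples G K (cliqueSets L) s' := by
  refine Run.forLoop_const (cliqueCost n M h) (fun j s' => IsTrie (s'.mem 5) (s'.reg 8) ∧
    Reads (s'.mem 0) (s'.reg 5) ((L.drop j).flatMap encodeList) ∧ s'.reg 23 = j * h ∧
    HoldsTriples G K (cliqueSets (L.take j)) s') h2 rfl rfl rfl ?_ ?_ le_rfl ?_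
  · refine ⟨ht, hr, by simpa using h23, ?_, ?_⟩
    · simp [h23]
    · simp [cliqueSets]
  · rintro j hj s₁ ha hi ⟨q1, q2, q3, q4⟩
    rw [List.drop_eq_getElem_cons hj, List.flatMap_cons] at q2
    refine (run_clique (hs.agree ha rfl) q1 q4 q2.left (hL _ (List.getElem_mem hj))).mono le_rfl ?_
    rintro s₂ ha₂ ⟨r1, r2, r3, r4⟩
    have hset : cliqueSets (L.take (j + 1)) = insert {x | x ∈ L[j]} (cliqueSets (L.take j)) := by
      ext Ω
      rw [List.take_add_one, List.getElem?_eq_getElem hj]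
      simp only [cliqueSets, Option.toList_some, List.mem_append, List.mem_singleton,
        Set.mem_ofPred_eq, Set.mem_insert_iff]
      constructor
      · rintro ⟨l, hl | rfl, rfl⟩
        · exact Or.inr ⟨l, hl, rfl⟩
        · exact Or.inl rfl
      · rintro (rfl | ⟨l, hl, rfl⟩)
        · exact ⟨_, Or.inr rfl, rfl⟩
        · exact ⟨l, Or.inl hl, rfl⟩
    rw [hset]
    refine ⟨by simpa using r1, ?_, by simp [r3, q3]; ring, ?_⟩
    · have := q2.right
      rw [← r2] at this
      simpa [ha₂.mem 0 rfl] using this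
    · exact r4.keep r1 (Keeps.of_mem (fun _ _ => rfl) rfl rfl rfl rfl) (by simp)
  · rintro s₁ ha hi ⟨q1, q2, q3, q4⟩
    rw [List.take_length] at q4
    exact ⟨q1, q3, q4⟩

end Cliques

/-! ### The dynamic program -/

section Table

variable {n : ℕ} {G H : SimpleGraph (Fin n)} {Ω C : Set (Fin n)} {K M h b : ℕ}

/-- The table with entries `R` for the trie nodes, as a function of the vertex sets. -/
noncomputable def tab (ch R : ℕ → ℕ) (A : Set (Fin n)) : ℕ :=
  if key ch A = 0 then 0 else R (key ch A)

open Classical in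
/-- The value of the block of the clique `Ω` and the component `D v`, given the values `t` of the
components in the block. -/
noncomputable def stepValue (G : SimpleGraph (Fin n)) (K : ℕ) (Ω : Set (Fin n))
    (D : Fin n → Set (Fin n)) (v : Fin n) (t : Set (Fin n) → ℕ) : ℕ :=
  K - (fill2 G Ω - fill2 G (nb G (D v))) -
    ∑ i with ¬ nb G (D i) ⊆ nb G (D v), (K - t (D i))

/-- Components outside of the block are recorded as node 0, whose entry is `K`, so they contribute
nothing and the machine can sum over all indices. -/
lemma TripleAt.stepValue_eq {s : State} {τ : ℕ} {D : Fin n → Set (Fin n)} {v : Fin n}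
    (ht : TripleAt G K s τ Ω D v) {R : ℕ → ℕ} (h0 : R 0 = K) :
    s.mem 10 τ - ∑ x ∈ Finset.range n, (K - R (s.mem 12 (τ * n + x))) =
      stepValue G K Ω D v (tab (s.mem 5) R) := by
  classical
  rw [stepValue, ht.weight, Finset.sum_range, Finset.sum_filter]
  congr 1
  refine Finset.sum_congr rfl fun i _ => ?_
  by_cases hi : nb G (D i) ⊆ nb G (D v)
  · rw [ht.comp_zero i hi, h0, Nat.sub_self, if_neg (not_not.2 hi)]
  · obtain ⟨h1, h2⟩ := ht.comp i hi
    rw [if_pos hi, tab, if_neg (by rw [← h1]; exact h2), h1]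

lemma TripleAt.tab_block {s : State} {τ : ℕ} {D : Fin n → Set (Fin n)} {v : Fin n}
    (ht : TripleAt G K s τ Ω D v) (R : ℕ → ℕ) :
    tab (s.mem 5) R (blk G Ω D (nb G (D v))) = R (s.mem 9 τ) := by
  rw [tab, ← ht.node, if_neg ht.node_ne]

/-- Writing one cell changes the value of one set only, as different sets have different nodes. -/
lemma TripleAt.tab_update {s : State} {τ a last : ℕ} {D : Fin n → Set (Fin n)} {v : Fin n}
    (ht : TripleAt G K s τ Ω D v) (hs : IsTrie (s.mem 5) last) (R : ℕ → ℕ) :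
    tab (s.mem 5) (Function.update R (s.mem 9 τ) a) =
      Function.update (tab (s.mem 5) R) (blk G Ω D (nb G (D v))) a := by
  ext A
  by_cases hA : A = blk G Ω D (nb G (D v))
  · rw [hA, ht.tab_block, Function.update_self, Function.update_self]
  · rw [Function.update_of_ne hA, tab, tab]
    split_ifs with h
    · rfl
    · rw [Function.update_of_ne]
      intro h'
      rw [ht.node] at h'
      exact hA (hs.key_inj h h')

/-- The cliques in `P` are potential maximal cliques, among them all those of the minimal
triangulations with at most `b` new ordered pairs. -/
structure Covers (G : SimpleGraph (Fin n)) (b : ℕ) (P : Set (Set (Fin n))) : Prop where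
  valid : ∀ Ω ∈ P, ∃ H, IsMinimalTriangulation G H ∧ Maximal H.IsClique Ω
  complete : ∀ H, IsMinimalTriangulation G H → fillOn G H Set.univ ≤ b →
    ∀ Ω, Maximal H.IsClique Ω → Ω ∈ P

/-- A nonempty separator belongs to a component with an edge, whose root is not isolated. For the
empty one, a non-isolated vertex of `Ω` has an empty label set; if there is none, no component has
neighbours in `Ω`, and the end `a` of an arbitrary edge serves. -/
lemma Labels.exists_nb_eq {lab : ℕ → ℕ} (hl : Labels G Ω lab) {a c : Fin n} (hac : G.Adj a c)
    (hC : nb G C = ∅ ∨ ∃ i : Fin n, nb G C = nb G (labelSet lab i) ∧ (labelSet lab i).Nonempty) :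
    ∃ v u, G.Adj v u ∧ nb G C = nb G (labelSet lab v) := by
  by_cases h0 : nb G C = ∅
  · rw [h0]
    by_cases hex : ∃ v ∈ Ω, ∃ u, G.Adj v u
    · obtain ⟨v, hv, u, hvu⟩ := hex
      refine ⟨v, u, hvu, Eq.symm (Set.eq_empty_of_forall_notMem ?_)⟩
      rintro y ⟨_, x, hx, _⟩
      exact hl.compFam.disj v v (hl.mem_self hx) hv
    · refine ⟨a, c, hac, Eq.symm (Set.eq_empty_of_forall_notMem fun y hy => hex ?_)⟩
      obtain ⟨_, x, _, hxy⟩ := id hy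
      exact ⟨y, hl.compFam.nb_sub a hy, x, hxy.symm⟩
  · obtain ⟨i, hi, -⟩ := hC.resolve_left h0
    obtain ⟨y, hy⟩ := Set.nonempty_iff_ne_empty.2 h0
    rw [hi] at hy
    obtain ⟨_, x, hx, hxy⟩ := hy
    obtain ⟨u, hu⟩ := hl.exists_adj hx hxy
    exact ⟨i, u, hu, hi⟩

/-- The clique explaining the block is on the list because `H` is cheap, and its separator is
realised by a non-isolated vertex, so the triple has been recorded. -/
lemma HoldsTriples.exists_step {P : Set (Set (Fin n))} {s : State} (hs : HoldsTriples G K P s)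
    (hP : Covers G b P) {a c : Fin n} (hac : G.Adj a c) (hH : IsMinimalTriangulation G H)
    (hb : fillOn G H Set.univ ≤ b) (hC : Block G H C) :
    ∃ τ < s.reg 23, ∃ Ω lab v, TripleAt G K s τ Ω (labelSet lab) v ∧
      blk G Ω (labelSet lab) (nb G (labelSet lab v)) = C ∧
      ∀ t, CompleteTable G H K t C.ncard →
        K - fillOn G H C ≤ stepValue G K Ω (labelSet lab) v t := by
  classical
  have : Nonempty (Fin n) := ⟨a⟩
  obtain ⟨Ω, hΩ, hstep⟩ := hC.exists_step (ι := Fin n) (K := K) hH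
  obtain ⟨lab, hl, hv⟩ := hs.complete Ω (hP.complete H hH hb Ω hΩ)
  obtain ⟨h1, h2, h3⟩ := hstep _ hl.compFam
  obtain ⟨v, u, hvu, hnb⟩ := hl.exists_nb_eq hac h1
  obtain ⟨τ, hτ, htr⟩ := hv v u hvu
  refine ⟨τ, hτ, Ω, lab, v, htr, by rw [← hnb, h2], fun t ht => ?_⟩
  have := h3 (Finset.univ.filter fun i => ¬ nb G (labelSet lab i) ⊆ nb G C) (by simp) t ht
  rw [stepValue, ← hnb]
  convert this

/-- Soundness does not depend on the order of the updates; only completeness needs increasing block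
sizes. -/
lemma SoundTable.update {t : Set (Fin n) → ℕ} (ht : SoundTable G K t)
    (hH : IsMinimalTriangulation G H) (hΩ : Maximal H.IsClique Ω) {D : Fin n → Set (Fin n)}
    (hD : CompFam G Ω D) (v : Fin n) :
    SoundTable G K (Function.update t (blk G Ω D (nb G (D v)))
      (max (t (blk G Ω D (nb G (D v)))) (stepValue G K Ω D v t))) := by
  classical
  have : Nonempty (Fin n) := ⟨v⟩
  intro A hA
  rw [Function.update_apply] at hA ⊢
  split_ifs at hA ⊢ with h
  · subst h
    rcases max_choice (t (blk G Ω D (nb G (D v)))) (stepValue G K Ω D v t) with hm | hm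
    · rw [hm] at hA ⊢
      exact ht _ hA
    · rw [hm] at hA ⊢
      exact ⟨by rw [stepValue]; omega, ht.glue hH hΩ hD v _ (by simp) hA⟩
  · exact ht A hA

lemma CompleteTable.mono {t t' : Set (Fin n) → ℕ} {r : ℕ} (h : CompleteTable G H K t r)
    (ht : ∀ A, t A ≤ t' A) : CompleteTable G H K t' r :=
  fun C hC hr => (h C hC hr).trans (ht C)

lemma run_improve {s : State} {τ : ℕ} (hn : s.reg 1 = n) (hK : s.reg 3 = K)
    (hτ : s.reg 14 = τ) :
    Run Program.improve s (20 * n + 40) fun s' => s'.mem 13 =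
      Function.update (s.mem 13) (s.mem 9 τ) (max (s.mem 13 (s.mem 9 τ))
        (s.mem 10 τ - ∑ x ∈ Finset.range n, (K - s.mem 13 (s.mem 12 (τ * n + x))))) := by
  refine Run.seq (B₁ := 3) (Q := fun s' => s' = s.setReg 22 (s.mem 10 τ))
    (Run.line rfl (by decide) (by simp [Program.result, Expr.eval, hτ])) ?_
    (B₂ := 20 * n + 37) (by omega)
  rintro _ - rfl
  refine Run.seq (B₁ := 20 * n + 6) (Q := fun s' => s'.reg 22 =
    s.mem 10 τ - ∑ x ∈ Finset.range n, (K - s.mem 13 (s.mem 12 (τ * n + x)))) ?_ ?_ (B₂ := 31)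
    (by omega)
  · refine Run.forLoop_const 12 (N := n) (fun j s' => s'.reg 22 =
      s.mem 10 τ - ∑ x ∈ Finset.range j, (K - s.mem 13 (s.mem 12 (τ * n + x)))) (by simp [hn])
      rfl rfl rfl (by simp) ?_ (by omega) fun _ _ _ h => h
    intro j hj s₁ ha hi hI
    refine Run.line rfl (by decide) ?_
    have e1 : s₁.reg 1 = n := by rw [ha.reg 1 rfl]; simpa using hn
    have e3 : s₁.reg 3 = K := by rw [ha.reg 3 rfl]; simpa using hK
    have e14 : s₁.reg 14 = τ := by rw [ha.reg 14 rfl]; simpa using hτ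
    have m12 : s₁.mem 12 = s.mem 12 := ha.mem 12 rfl
    have m13 : s₁.mem 13 = s.mem 13 := ha.mem 13 rfl
    simp only [Program.result, Expr.eval, State.setReg_reg, hI, hi, e1, e3, e14, m12, m13,
      Finset.sum_range_succ, Nat.sub_sub]
    simp
  · intro s₁ ha h22
    refine Run.line rfl (by decide) ?_
    have e14 : s₁.reg 14 = τ := by rw [ha.reg 14 rfl]; simpa using hτ
    have m9 : s₁.mem 9 = s.mem 9 := ha.mem 9 rfl
    have m13 : s₁.mem 13 = s.mem 13 := ha.mem 13 rfl
    simp only [Program.result, Expr.lt_eval_eq_zero, Expr.eval, e14, m9, m13, h22]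
    split_ifs with hlt
    · rw [State.setMem_mem, if_pos rfl, m13, max_eq_right (by omega)]
    · rw [m13, max_eq_left (by omega), Function.update_eq_self]

/-- The table is correct, and complete for the blocks with fewer than `r` vertices. -/
structure Correct (G : SimpleGraph (Fin n)) (K b r : ℕ) (s : State) : Prop where
  zero : s.mem 13 0 = K
  sound : SoundTable G K (tab (s.mem 5) (s.mem 13))
  complete : ∀ H, IsMinimalTriangulation G H → fillOn G H Set.univ ≤ b →
    CompleteTable G H K (tab (s.mem 5) (s.mem 13)) r

/-- The triples with index below `j` have been used to improve the entries for the blocks with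
`r` vertices. -/
def Improved (G : SimpleGraph (Fin n)) (K b r j : ℕ) (s : State) : Prop :=
  ∀ H, IsMinimalTriangulation G H → fillOn G H Set.univ ≤ b → ∀ τ < j, ∀ Ω lab v,
    TripleAt G K s τ Ω (labelSet lab) v →
    let C := blk G Ω (labelSet lab) (nb G (labelSet lab v))
    C.ncard = r → (∀ t, CompleteTable G H K t C.ncard →
        K - fillOn G H C ≤ stepValue G K Ω (labelSet lab) v t) →
      K - fillOn G H C ≤ tab (s.mem 5) (s.mem 13) C

/-- The table changes during the round. This is harmless, since entries only increase and the
inequality in `Improved` is required of every table that is complete for smaller blocks. -/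
lemma run_improve_triple {P : Set (Set (Fin n))} {s : State} {τ r last : ℕ}
    (hn : s.reg 1 = n) (hK : s.reg 3 = K) (hp : HoldsTriples G K P s) (hP : Covers G b P)
    (ht : IsTrie (s.mem 5) last) (hτ : s.reg 14 = τ) (hτT : τ < s.reg 23) (hr : s.reg 13 = r)
    (hc : Correct G K b r s) (hi : Improved G K b r τ s) :
    Run (.ite (.eq (.load 11 (.reg 14)) (.reg 13)) Program.improve .skip) s
      (20 + if s.mem 11 τ = r then 20 * n + 40 else 0) fun s' =>
        Correct G K b r s' ∧ Improved G K b r (τ + 1) s' := by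
  have hcond : (Expr.eq (.load 11 (.reg 14)) (.reg 13)).eval s = 0 ↔ s.mem 11 τ ≠ r := by
    rw [Expr.eq_eval_eq_zero]; simp [Expr.eval, hτ, hr]
  refine Run.ite (B := 1 + if s.mem 11 τ = r then 20 * n + 40 else 0) ?_ ?_
    (by simp [Expr.cost, Expr.eq]; omega)
  · intro h
    rw [Ne, hcond, not_not] at h
    rw [if_pos h]
    refine (run_improve hn hK hτ).mono (by omega) ?_
    intro s' ha h13
    obtain ⟨Ω, hΩ, lab, v, hl, htr⟩ := hp.valid τ hτT
    obtain ⟨H, hH, hmax⟩ := hP.valid Ω hΩ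
    have m5 : s'.mem 5 = s.mem 5 := ha.mem 5 rfl
    have hback : ∀ {σ : ℕ} {Ω' : Set (Fin n)} {lab' : ℕ → ℕ} {v' : Fin n},
        TripleAt G K s' σ Ω' (labelSet lab') v' → TripleAt G K s σ Ω' (labelSet lab') v' :=
      fun h => ⟨by rw [← m5, ← h.node, ha.mem 9 rfl], by rw [← ha.mem 9 rfl]; exact h.node_ne,
        by rw [← ha.mem 10 rfl]; exact h.weight, by rw [← ha.mem 11 rfl]; exact h.size,
        by rw [← ha.mem 12 rfl, ← m5]; exact h.comp, by rw [← ha.mem 12 rfl]; exact h.comp_zero⟩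
    -- The update formula holds for every clique, labelling and vertex described by record `τ`, not
    -- only for those obtained from `hp.valid`.
    have htab : ∀ {Ω' : Set (Fin n)} {lab' : ℕ → ℕ} {v' : Fin n},
        TripleAt G K s τ Ω' (labelSet lab') v' → tab (s'.mem 5) (s'.mem 13) =
          Function.update (tab (s.mem 5) (s.mem 13))
            (blk G Ω' (labelSet lab') (nb G (labelSet lab' v')))
            (max (tab (s.mem 5) (s.mem 13) (blk G Ω' (labelSet lab') (nb G (labelSet lab' v'))))
              (stepValue G K Ω' (labelSet lab') v' (tab (s.mem 5) (s.mem 13)))) := by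
      intro Ω' lab' v' htr'
      rw [m5, h13, htr'.tab_update ht, htr'.tab_block, htr'.stepValue_eq hc.zero]
    have hle : ∀ A : Set (Fin n), tab (s.mem 5) (s.mem 13) A ≤ tab (s'.mem 5) (s'.mem 13) A := by
      intro A
      rw [htab htr, Function.update_apply]
      split_ifs with h
      · rw [h]; exact le_max_left _ _
      · exact le_rfl
    refine ⟨⟨?_, ?_, ?_⟩, ?_⟩
    · rw [h13, Function.update_of_ne htr.node_ne.symm, hc.zero]
    · rw [htab htr]
      exact hc.sound.update hH hmax hl.compFam v
    · intro H hH hb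
      exact (hc.complete H hH hb).mono hle
    · intro H hH hb σ hσ Ω' lab' v' htr' C hC hstep
      rcases Nat.lt_succ_iff_lt_or_eq.1 hσ with hlt | rfl
      · exact (hi H hH hb σ hlt Ω' lab' v' (hback htr') hC hstep).trans (hle _)
      · have := hstep _ (by rw [hC]; exact hc.complete H hH hb)
        rw [htab (hback htr'), Function.update_self]
        exact this.trans (le_max_right _ _)
  · intro h
    rw [hcond] at h
    refine Run.line rfl (by simp [Program.lineCost]) ⟨hc, ?_⟩
    intro H hH hb σ hσ Ω' lab' v' htr' C hC hstep
    rcases Nat.lt_succ_iff_lt_or_eq.1 hσ with hlt | rfl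
    · exact hi H hH hb σ hlt Ω' lab' v' htr' hC hstep
    · exact absurd (htr'.size.trans hC) h

lemma Correct.setReg {r i a : ℕ} {s : State} (h : Correct G K b r s) :
    Correct G K b r (s.setReg i a) := ⟨h.zero, h.sound, h.complete⟩

lemma Improved.setReg {r j i a : ℕ} {s : State} (h : Improved G K b r j s) :
    Improved G K b r j (s.setReg i a) := fun H hH hb τ hτ Ω lab v htr =>
  h H hH hb τ hτ Ω lab v ⟨htr.node, htr.node_ne, htr.weight, htr.size, htr.comp, htr.comp_zero⟩

/-- Each block of size `r` of a cheap triangulation is explained by some recorded triple, and the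
loop has evaluated this triple. -/
lemma run_round {P : Set (Set (Fin n))} {s : State} {r T last : ℕ} {a c : Fin n}
    (hac : G.Adj a c) (hn : s.reg 1 = n) (hK : s.reg 3 = K) (hp : HoldsTriples G K P s)
    (hT : s.reg 23 = T) (hP : Covers G b P) (ht : IsTrie (s.mem 5) last) (hr : s.reg 13 = r)
    (hc : Correct G K b r s) :
    Run (.forLoop 14 23 <| .ite (.eq (.load 11 (.reg 14)) (.reg 13)) Program.improve .skip) s
      (∑ τ ∈ Finset.range T, (28 + if s.mem 11 τ = r then 20 * n + 40 else 0) + 6)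
      (Correct G K b (r + 1)) := by
  refine Run.forLoop (fun j s' => Correct G K b r s' ∧ Improved G K b r j s')
    (fun τ => 20 + if s.mem 11 τ = r then 20 * n + 40 else 0) hT rfl rfl rfl
    ⟨hc.setReg, fun _ _ _ τ hτ => by omega⟩ ?_ ?_ ?_
  · rintro τ hτ s₁ ha hi ⟨h1, h2⟩
    have e23 := ha.reg 23 rfl
    have e11 : s₁.mem 11 = s.mem 11 := ha.mem 11 rfl
    have e5 : s₁.mem 5 = s.mem 5 := ha.mem 5 rfl
    have hp₁ := hp.keep ht (Keeps.of_mem (by rw [e5]; exact fun _ _ => rfl) (ha.mem 9 rfl)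
      (ha.mem 10 rfl) e11 (ha.mem 12 rfl)) e23
    rw [← e11]
    exact (run_improve_triple (by rw [ha.reg 1 rfl, hn]) (by rw [ha.reg 3 rfl, hK]) hp₁ hP
      (by rw [e5]; exact ht) hi (by omega) (by rw [ha.reg 13 rfl, hr]) h1 h2).mono le_rfl
      fun s' _ h => ⟨h.1.setReg, h.2.setReg⟩
  · refine Nat.add_le_add_right (Finset.sum_le_sum fun τ _ => ?_) 6
    omega
  · rintro s₁ ha hi ⟨h1, h2⟩
    refine ⟨h1.zero, h1.sound, fun H hH hb C hC hlt => ?_⟩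
    rcases Nat.lt_succ_iff_lt_or_eq.1 hlt with hlt | heq
    · exact h1.complete H hH hb C hC hlt
    · have e23 := ha.reg 23 rfl
      have e5 : s₁.mem 5 = s.mem 5 := ha.mem 5 rfl
      have hp₁ := hp.keep ht (Keeps.of_mem (by rw [e5]; exact fun _ _ => rfl) (ha.mem 9 rfl)
        (ha.mem 10 rfl) (ha.mem 11 rfl) (ha.mem 12 rfl)) e23
      obtain ⟨τ, hτ, Ω, lab, v, htr, rfl, hstep⟩ := hp₁.exists_step hP hac hH hb hC
      exact h2 H hH hb τ (by omega) Ω lab v htr heq hstep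

/-- The rounds run over the sizes from `0` to `n`, hence `n + 1` of them. Cell 0 is set to `K` as
the neutral entry for absent components. -/
lemma run_fillTable {P : Set (Set (Fin n))} {s : State} {T last : ℕ} {a c : Fin n}
    (hac : G.Adj a c) (hn : s.reg 1 = n) (hK : s.reg 3 = K) (hp : HoldsTriples G K P s)
    (hT : s.reg 23 = T) (hP : Covers G b P) (ht : IsTrie (s.mem 5) last)
    (h13 : ∀ i, s.mem 13 i = 0) :
    Run Program.fillTable s (28 * ((n + 1) * T) + (20 * n + 40) * T + 14 * n + 40) fun s' =>
      Correct G K b (n + 1) s' := by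
  refine Run.seq (B₁ := 3) (Q := fun s' => s' = s.setMem 13 0 K)
    (Run.line rfl (by decide) (by simp [Program.result, Expr.eval, hK])) ?_
    (B₂ := 28 * ((n + 1) * T) + (20 * n + 40) * T + 14 * n + 37) (by omega)
  rintro s₁ a₁ q₁
  refine Run.seq (B₁ := 4) (Q := fun s' => s' = s₁.setReg 9 (n + 1))
    (Run.line rfl (by decide) (by simp [Program.result, Expr.eval, a₁.reg 1 rfl, hn])) ?_
    (B₂ := 28 * ((n + 1) * T) + (20 * n + 40) * T + 14 * n + 33) (by omega)
  rintro s₂ a₂ q₂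
  have k₂ : s₂.mem = s₁.mem := by rw [q₂]; rfl
  refine Run.forLoop (N := n + 1) (fun r s' => Correct G K b r s')
    (fun r => ∑ τ ∈ Finset.range T, (28 + if s.mem 11 τ = r then 20 * n + 40 else 0) + 6)
    (by simp [q₂]) rfl rfl rfl ?_ ?_ ?_ fun _ _ _ h => h
  · have hz : ∀ A : Set (Fin n), tab (s₂.mem 5) (s₂.mem 13) A = 0 := by
      intro A
      rw [tab]
      split_ifs with h
      · rfl
      · rw [k₂, q₁] at h ⊢
        rw [State.setMem_mem, if_pos rfl, Function.update_of_ne h, h13]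
    refine ⟨by simp [k₂, q₁], fun A hA => absurd (hz A) hA, fun H _ _ C _ hC => by omega⟩
  · intro r hr s₃ ha hi hc
    have e11 : s₃.mem 11 = s.mem 11 := by rw [ha.mem 11 rfl, k₂, a₁.mem 11 rfl]
    have e5 : s₃.mem 5 = s.mem 5 := by rw [ha.mem 5 rfl, k₂, a₁.mem 5 rfl]
    have e23 : s₃.reg 23 = s.reg 23 := by rw [ha.reg 23 rfl, a₂.reg 23 rfl, a₁.reg 23 rfl]
    have hp₃ := hp.keep ht (Keeps.of_mem (s' := s₃) (by rw [e5]; exact fun _ _ => rfl)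
      (by rw [ha.mem 9 rfl, k₂, a₁.mem 9 rfl]) (by rw [ha.mem 10 rfl, k₂, a₁.mem 10 rfl]) e11
      (by rw [ha.mem 12 rfl, k₂, a₁.mem 12 rfl])) e23
    rw [← e11]
    exact (run_round hac (by rw [ha.reg 1 rfl, a₂.reg 1 rfl, a₁.reg 1 rfl, hn])
      (by rw [ha.reg 3 rfl, a₂.reg 3 rfl, a₁.reg 3 rfl, hK]) hp₃ (by rw [e23, hT]) hP
      (by rw [e5]; exact ht) hi hc).mono le_rfl fun s' _ h => h.setReg
  · have h1 : ∑ r ∈ Finset.range (n + 1), ∑ τ ∈ Finset.range T,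
        (28 + if s.mem 11 τ = r then 20 * n + 40 else 0) ≤
        28 * ((n + 1) * T) + (20 * n + 40) * T := by
      -- After exchanging the sums, each triple pays for its expensive evaluation in at most one
      -- round.
      rw [Finset.sum_comm]
      calc _ ≤ ∑ τ ∈ Finset.range T, (28 * (n + 1) + (20 * n + 40)) := by
            refine Finset.sum_le_sum fun τ _ => ?_
            rw [Finset.sum_add_distrib, Finset.sum_ite_eq]
            simp only [Finset.sum_const, Finset.card_range, smul_eq_mul]
            split_ifs <;> omega
        _ = _ := by simp; ring
    rw [Finset.sum_add_distrib, Finset.sum_add_distrib, Finset.sum_const, Finset.sum_const,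
      Finset.card_range, smul_eq_mul, smul_eq_mul]
    omega

end Table

/-! ### Combining the components of the graph. -/

section Answer

variable {n : ℕ} {G : SimpleGraph (Fin n)} {K M h : ℕ}

lemma ListsNonisolated.sum_eq {nz : ℕ → ℕ} (hz : ListsNonisolated G nz h) (I : Finset (Fin n))
    (hI : ∀ v, v ∈ I ↔ ∃ u, G.Adj v u) (f : ℕ → ℕ) :
    ∑ j ∈ Finset.range h, f (nz j) = ∑ v ∈ I, f v := by
  have hlt : ∀ j < h, nz j < n := by
    intro j hj
    obtain ⟨v, hv, _⟩ := hz.valid j hj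
    omega
  refine Finset.sum_bij (fun j hj => ⟨nz j, hlt j (Finset.mem_range.1 hj)⟩) ?_ ?_ ?_ ?_
  · intro j hj
    obtain ⟨v, hv, hu⟩ := hz.valid j (Finset.mem_range.1 hj)
    rw [hI]
    convert hu
  · intro i hi j hj he
    exact hz.inj i (Finset.mem_range.1 hi) j (Finset.mem_range.1 hj) (by simpa using he)
  · intro v hv
    obtain ⟨u, hu⟩ := (hI v).1 hv
    obtain ⟨j, hj, he⟩ := hz.complete v u hu
    exact ⟨j, Finset.mem_range.2 hj, Fin.ext he⟩
  · intro j hj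
    rfl

/-- Vertices carrying their own label represent the components, so each component with an edge is
subtracted once. -/
lemma run_answer {k : ℕ} {s : State} (hs : HoldsGraph G (2 * k + 1) M h s)
    (hl : Labels G ∅ (s.mem 4)) (hd : HoldsComponents G s)
    (hc : Correct G (2 * k + 1) (2 * k) (n + 1) s) :
    Run Program.answer s (50 * h + 20) fun s' =>
      (IsYesInstance G k → s'.reg 0 = 1) ∧ (¬ IsYesInstance G k → s'.reg 0 = 0) := by
  classical
  set K := 2 * k + 1 with hK
  let f : ℕ → ℕ := fun v => if s.mem 4 v = v then K - s.mem 13 (s.mem 6 v) else 0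
  let I : Finset (Fin n) := {v | (∃ u, G.Adj v u) ∧ s.mem 4 v = v}
  have hsum : ∑ j ∈ Finset.range h, f (s.mem 3 j) =
      ∑ v ∈ I, (K - tab (s.mem 5) (s.mem 13) (labelSet (n := n) (s.mem 4) v)) := by
    rw [hs.nz.sum_eq ({v | ∃ u, G.Adj v u} : Finset (Fin n)) (by simp) f, ← Finset.sum_filter,
      Finset.filter_filter]
    refine Finset.sum_congr rfl fun v hv => ?_
    obtain ⟨⟨u, hu⟩, _⟩ := (Finset.mem_filter.1 hv).2
    obtain ⟨h1, h2⟩ := hd v u hu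
    rw [tab, if_neg (by rwa [← h1]), h1]
  refine Run.seq (B₁ := 2) (Q := fun s' => s' = s.setReg 22 K)
    (Run.line rfl le_rfl (by simp [Program.result, Expr.eval, hs.param])) ?_
    (B₂ := 50 * h + 18) (by omega)
  rintro _ - rfl
  refine Run.seq (B₁ := 50 * h + 6)
    (Q := fun s' => s'.reg 22 = K - ∑ j ∈ Finset.range h, f (s.mem 3 j)) ?_ ?_ (B₂ := 12)
    (by omega)
  · refine Run.forLoop_const 42 (N := h) (fun i s' => s'.reg 22 =
      K - ∑ j ∈ Finset.range i, f (s.mem 3 j)) (by simpa using hs.nzCount) rfl rfl rfl (by simp)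
      ?_ (by omega) fun _ _ _ h => h
    intro j hj s₁ ha hi hI
    refine Run.line rfl (by decide) ?_
    have e3 : s₁.reg 3 = K := by rw [ha.reg 3 rfl]; simpa using hs.param
    have m3 : s₁.mem 3 = s.mem 3 := ha.mem 3 rfl
    have m4 : s₁.mem 4 = s.mem 4 := ha.mem 4 rfl
    have m6 : s₁.mem 6 = s.mem 6 := ha.mem 6 rfl
    have m13 : s₁.mem 13 = s.mem 13 := ha.mem 13 rfl
    simp only [Program.result, Expr.eq_eval_eq_zero, Expr.eval, State.setReg_reg,
      State.setReg_mem, hi, m3, m4, if_true, Finset.sum_range_succ, f]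
    by_cases hv : s.mem 4 (s.mem 3 j) = s.mem 3 j
    · simp [hv, hI, e3, m6, m13, Nat.sub_sub, f]
    · simp [hv, hI, f]
  · intro s₁ ha h22
    rw [hsum] at h22
    refine Run.line rfl (by decide) ?_
    have hD := hl.compFam
    constructor
    · intro hy
      obtain ⟨H, hH, hf⟩ := hy.exists_triangulation
      have := (hc.complete H hH hf).ne_zero hH hf (by simp [Set.ncard_univ]) hD I (by
        intro i hi
        exact ⟨i, (Finset.mem_filter.1 hi).2.2⟩)
      rw [← hK] at this
      simp only [Program.result, Expr.eval, h22, if_neg this]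
      simp
    · intro hn
      have : K - ∑ v ∈ I, (K - tab (s.mem 5) (s.mem 13) (labelSet (n := n) (s.mem 4) v)) = 0 := by
        by_contra hne
        refine hn (hc.sound.isYesInstance hD I ?_ hne)
        intro i hi x hx y hxy
        obtain ⟨w, hw⟩ := hl.exists_adj hx hxy
        exact hi (by simpa [I] using ⟨⟨w, hw⟩, hl.mem_self hx⟩)
      simp only [Program.result, Expr.eval, h22, if_pos this]
      simp

end Answer

/-! ### Reading the graph -/

lemma Reads.append_singleton {f : ℕ → ℕ} {l : List ℕ} (h : Reads f 0 l) (a : ℕ) :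
    Reads (Function.update f l.length a) 0 (l ++ [a]) := by
  intro i hi
  rw [List.length_append, List.length_singleton] at hi
  rw [zero_add, Function.update_apply]
  split_ifs with hil
  · simp [hil]
  · have := h i (by omega)
    rw [zero_add] at this
    rw [this, List.getElem_append_left]

lemma length_eq_ncard_of_nodup {α : Type*} {l : List α} (hl : l.Nodup) {S : Set α}
    (h : ∀ x, x ∈ l ↔ x ∈ S) : l.length = S.ncard := by
  classical
  rw [← List.toFinset_card_of_nodup hl, ← Set.ncard_coe_finset]
  congr 1
  ext x
  simp [h]

lemma length_le_ncard_of_nodup {α : Type*} [Finite α] {l : List α} (hl : l.Nodup) {S : Set α}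
    (h : ∀ x ∈ l, x ∈ S) : l.length ≤ S.ncard := by
  rw [length_eq_ncard_of_nodup hl (S := {x | x ∈ l}) fun _ => Iff.rfl]
  exact Set.ncard_le_ncard h (Set.toFinite _)

section Graph

variable {n : ℕ} {G : SimpleGraph (Fin n)} {K M h : ℕ}

/-- The arrays hold the arcs in the list `A`. -/
structure HoldsArcs (s : State) (A : List (Fin n × Fin n)) : Prop where
  count : s.reg 7 = A.length
  tails : Reads (s.mem 1) 0 (A.map fun p => (p.1 : ℕ))
  heads : Reads (s.mem 2) 0 (A.map fun p => (p.2 : ℕ))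

lemma HoldsArcs.listsArcs {s : State} {A : List (Fin n × Fin n)} (hA : HoldsArcs s A)
    (hn : A.Nodup) (hG : ∀ p, p ∈ A ↔ G.Adj p.1 p.2) :
    ListsArcs G (s.mem 1) (s.mem 2) A.length := by
  have h1 : ∀ e (he : e < A.length), s.mem 1 e = A[e].1 := by
    intro e he
    have := hA.tails e (by simpa using he)
    simpa using this
  have h2 : ∀ e (he : e < A.length), s.mem 2 e = A[e].2 := by
    intro e he
    have := hA.heads e (by simpa using he)
    simpa using this
  refine ⟨?_, ?_, ?_⟩
  · intro e he
    exact ⟨_, _, (hG _).1 (List.getElem_mem he), h1 e he, h2 e he⟩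
  · intro a b hab
    obtain ⟨e, he, heq⟩ := List.getElem_of_mem ((hG (a, b)).2 hab)
    exact ⟨e, he, by rw [h1 e he, heq], by rw [h2 e he, heq]⟩
  · intro e he e' he' hs hd
    rw [h1 e he, h1 e' he'] at hs
    rw [h2 e he, h2 e' he'] at hd
    exact (hn.getElem_inj_iff).1 (Prod.ext (Fin.ext hs) (Fin.ext hd))

lemma listsNonisolated_of_reads {f : ℕ → ℕ} {Z : List (Fin n)}
    (hZ : Reads f 0 (Z.map Fin.val)) (hn : Z.Nodup) (hG : ∀ v, v ∈ Z ↔ ∃ u, G.Adj v u) :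
    ListsNonisolated G f Z.length := by
  have h1 : ∀ e (he : e < Z.length), f e = Z[e] := by
    intro e he
    have := hZ e (by simpa using he)
    simpa using this
  refine ⟨?_, ?_, ?_⟩
  · intro e he
    exact ⟨_, h1 e he, (hG _).1 (List.getElem_mem he)⟩
  · intro v u hvu
    obtain ⟨e, he, heq⟩ := List.getElem_of_mem ((hG v).2 ⟨u, hvu⟩)
    exact ⟨e, he, by rw [h1 e he, heq]⟩
  · intro e he e' he' hs
    rw [h1 e he, h1 e' he'] at hs
    exact (hn.getElem_inj_iff).1 (Fin.ext hs)

lemma run_readArcs {s : State} {A : List (Fin n × Fin n)} {v : Fin n} {l : List (Fin n)}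
    (hA : HoldsArcs s A) (hv : s.reg 10 = v) (hl : s.reg 15 = l.length)
    (hr : Reads (s.mem 0) (s.reg 5) (l.map Fin.val)) :
    Run Program.readArcs s (23 * l.length + 6) fun s' =>
      HoldsArcs s' (A ++ l.map fun u => (v, u)) ∧ s'.reg 5 = s.reg 5 + l.length := by
  refine Run.forLoop_const 15 (fun j s' => HoldsArcs s' (A ++ (l.take j).map fun u => (v, u)) ∧
    s'.reg 5 = s.reg 5 + j) hl rfl rfl rfl ⟨⟨by simpa using hA.count, by simpa using hA.tails,
      by simpa using hA.heads⟩, by simp⟩ ?_ (by omega) ?_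
  · rintro j hj s₁ ha hi ⟨h1, h2⟩
    refine Run.line rfl (by decide) ?_
    have hm0 : s₁.mem 0 (s₁.reg 5) = l[j] := by
      rw [ha.mem 0 rfl, h2]
      have := hr j (by rw [List.length_map]; exact hj)
      rwa [List.getElem_map] at this
    have e10 : s₁.reg 10 = v := by rw [ha.reg 10 rfl, hv]
    have hres : Program.result (.seq (.store 1 (.reg 7) (.reg 10)) <|
        .seq (.store 2 (.reg 7) (.load 0 (.reg 5))) <| .seq (Program.incr 7) (Program.incr 5)) s₁ =
        (((s₁.setMem 1 (s₁.reg 7) v).setMem 2 (s₁.reg 7) l[j]).setReg 7 (s₁.reg 7 + 1)).setReg 5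
          (s₁.reg 5 + 1) := by
      simp [Program.result, Expr.eval, Program.incr, hm0, e10]
    rw [hres, List.take_add_one, List.getElem?_eq_getElem hj, Option.toList_some, List.map_append,
      ← List.append_assoc, List.map_singleton]
    refine ⟨⟨?_, ?_, ?_⟩, ?_⟩
    · simp [h1.count]; omega
    · rw [List.map_append, List.map_singleton]
      have := h1.tails.append_singleton v
      rw [List.length_map, ← h1.count] at this
      simpa using this
    · rw [List.map_append, List.map_singleton]
      have := h1.heads.append_singleton l[j]
      rw [List.length_map, ← h1.count] at this
      simpa using this
    · simp [h2]; omega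
  · rintro s₁ ha hi ⟨h1, h2⟩
    rw [List.take_length] at h1
    exact ⟨h1, h2⟩

/-- The adjacency lists of the vertices below `i` have been read into the lists `A` of arcs and
`Z` of non-isolated vertices. -/
structure HoldsPrefix (G : SimpleGraph (Fin n)) (s : State) (i : ℕ) (A : List (Fin n × Fin n))
    (Z : List (Fin n)) : Prop where
  arcs : HoldsArcs s A
  arcs_nodup : A.Nodup
  mem_arcs : ∀ p, p ∈ A ↔ (p.1 : ℕ) < i ∧ G.Adj p.1 p.2
  count : s.reg 6 = Z.length
  nz : Reads (s.mem 3) 0 (Z.map Fin.val)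
  nz_nodup : Z.Nodup
  mem_nz : ∀ v, v ∈ Z ↔ (v : ℕ) < i ∧ ∃ u, G.Adj v u
  le : Z.length ≤ A.length

lemma run_readGraph {s : State} {adj : Fin n → List (Fin n)} {rest : List ℕ}
    (hadj : ∀ v, (adj v).Nodup ∧ ∀ u, u ∈ adj v ↔ G.Adj v u)
    (hM : {p : Fin n × Fin n | G.Adj p.1 p.2}.ncard = M) (hn : s.reg 1 = n) (hK : s.reg 3 = K)
    (h6 : s.reg 6 = 0) (h7 : s.reg 7 = 0)
    (hr : Reads (s.mem 0) 4 ((List.ofFn adj).flatMap encodeList ++ rest)) :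
    Run Program.readGraph s (n * (23 * M + 50) + 12) fun s' =>
      Reads (s'.mem 0) (s'.reg 5) rest ∧ ∃ h ≤ n, h ≤ M ∧ HoldsGraph G K M h s' := by
  refine Run.seq (B₁ := 2) (Q := fun s' => s' = s.setReg 5 4) (Run.line rfl le_rfl rfl) ?_
    (B₂ := n * (23 * M + 50) + 10) (by omega)
  rintro _ - rfl
  refine Run.seq (B₁ := n * (23 * M + 50) + 6) (Q := fun s' => s'.reg 1 = n ∧ s'.reg 3 = K ∧
    Reads (s'.mem 0) (s'.reg 5) rest ∧ ∃ A Z, HoldsPrefix G s' n A Z) ?_ ?_ (B₂ := 2) (by omega)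
  · refine Run.forLoop_const (23 * M + 42) (N := n) (fun i s' =>       Reads (s'.mem 0) (s'.reg 5) (((List.ofFn adj).drop i).flatMap encodeList ++ rest) ∧
      ∃ A Z, HoldsPrefix G s' i A Z) (by simpa using hn) rfl rfl rfl ?_ ?_ le_rfl ?_
    · refine ⟨by simpa using hr, [], [], ?_⟩
      exact ⟨⟨by simpa using h7, fun i hi => by simp at hi, fun i hi => by simp at hi⟩,
        List.nodup_nil, by simp, by simpa using h6, fun i hi => by simp at hi, List.nodup_nil,
        by simp, le_rfl⟩
    · rintro i hi s₁ ha h10 ⟨hr₁, A, Z, hp⟩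
      rw [List.drop_eq_getElem_cons (by simpa using hi), List.flatMap_cons, List.getElem_ofFn,
        List.append_assoc, encodeList_eq] at hr₁
      generalize hv : (⟨i, _⟩ : Fin n) = v at hr₁
      obtain ⟨hnd, hmem⟩ := hadj v
      -- Bounding each list by `M` gives only `n * M` for the total reading time, which is
      -- affordable.
      have hd : (adj v).length ≤ M := by
        rw [← hM, ← List.length_map (f := fun u => (v, u))]
        refine length_le_ncard_of_nodup (hnd.map fun _ _ h => (Prod.ext_iff.1 h).2) ?_
        simp [hmem]
      have hiv : i = v := by rw [← hv]
      set l := adj v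
      refine Run.seq (B₁ := 3) (Q := fun s' => s' = s₁.setReg 15 l.length)
        (Run.line rfl (by decide) ?_) ?_ (B₂ := 23 * M + 39) (by omega)
      · simp [Program.result, Expr.eval, hr₁.left.head]
      rintro s₂ a₂ q₂
      refine Run.seq (B₁ := 4) (Q := fun s' => s' = s₂.setReg 5 (s₁.reg 5 + 1))
        (Run.line rfl (by decide) ?_) ?_ (B₂ := 23 * M + 35) (by omega)
      · simp [Program.result, Expr.eval, Program.incr, q₂]
      rintro s₃ a₃ q₃
      have e15 : s₃.reg 15 = l.length := by rw [a₃.reg 15 rfl, q₂]; simp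
      have e10 : s₃.reg 10 = v := by rw [a₃.reg 10 rfl, a₂.reg 10 rfl, h10, hiv]
      have e6 : s₃.reg 6 = Z.length := by rw [a₃.reg 6 rfl, a₂.reg 6 rfl, hp.count]
      have m3 : s₃.mem 3 = s₁.mem 3 := by rw [a₃.mem 3 rfl, a₂.mem 3 rfl]
      have e5 : s₃.reg 5 = s₁.reg 5 + 1 := by rw [q₃]; simp
      set Z' := if l = [] then Z else Z ++ [v] with hZ'
      refine Run.seq (B₁ := 9) (Q := fun s' => s'.reg 6 = Z'.length ∧
        Reads (s'.mem 3) 0 (Z'.map Fin.val)) (Run.line rfl (by decide) ?_) ?_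
        (B₂ := 23 * M + 26) (by omega)
      · by_cases hl : l = []
        · simpa [Program.result, Expr.eval, e15, hl, hZ', e6, m3] using hp.nz
        · have := hp.nz.append_singleton v
          rw [List.length_map] at this
          simpa [Program.result, Expr.eval, e15, hl, hZ', e6, m3, Program.incr, e10] using this
      rintro s₄ a₄ ⟨c₄, z₄⟩
      have hA₄ : HoldsArcs s₄ A := by
        refine ⟨?_, ?_, ?_⟩
        · rw [a₄.reg 7 rfl, a₃.reg 7 rfl, a₂.reg 7 rfl, hp.arcs.count]
        · rw [a₄.mem 1 rfl, a₃.mem 1 rfl, a₂.mem 1 rfl]; exact hp.arcs.tails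
        · rw [a₄.mem 2 rfl, a₃.mem 2 rfl, a₂.mem 2 rfl]; exact hp.arcs.heads
      have m0 : s₄.mem 0 = s₁.mem 0 := by rw [a₄.mem 0 rfl, a₃.mem 0 rfl, a₂.mem 0 rfl]
      have e5' : s₄.reg 5 = s₁.reg 5 + 1 := by rw [a₄.reg 5 rfl, e5]
      refine (run_readArcs (v := v) (l := l) hA₄ (by rw [a₄.reg 10 rfl, e10])
        (by rw [a₄.reg 15 rfl, e15]) (by rw [m0, e5']; exact hr₁.left.tail)).mono
        (by have := Nat.mul_le_mul_left 23 hd; omega) ?_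
      rintro s₅ a₅ ⟨r₅, p₅⟩
      have hlt : ∀ u : Fin n, (u : ℕ) < i + 1 ↔ (u : ℕ) < i ∨ u = v := by
        intro u
        rw [Fin.ext_iff]; omega
      have hvA : ∀ u, (v, u) ∉ A := fun u h => by
        have : (v : ℕ) < i := ((hp.mem_arcs _).1 h).1
        omega
      have hvZ : v ∉ Z := fun h => by
        have := ((hp.mem_nz _).1 h).1
        omega
      have hlne : l ≠ [] ↔ ∃ u, G.Adj v u := by
        simp only [← hmem]
        exact ⟨List.exists_mem_of_ne_nil l, fun ⟨u, hu⟩ => List.ne_nil_of_mem hu⟩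
      refine ⟨?_, A ++ l.map fun u => (v, u), Z', ?_, ?_, ?_, ?_, ?_, ?_, ?_, ?_⟩
      · have := hr₁.right
        rw [List.length_cons, List.length_map] at this
        simpa [a₅.mem 0 rfl, m0, p₅, e5', add_assoc, add_comm 1] using this
      · exact ⟨by simpa using r₅.count, r₅.tails, r₅.heads⟩
      · refine hp.arcs_nodup.append (hnd.map fun _ _ h => (Prod.ext_iff.1 h).2) ?_
        intro p hpA hpl
        obtain ⟨u, _, rfl⟩ := List.mem_map.1 hpl
        exact hvA u hpA
      · rintro ⟨a, c⟩
        rw [List.mem_append, hp.mem_arcs, hlt]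
        simp only [List.mem_map, hmem, Prod.mk.injEq]
        constructor
        · rintro (⟨h1, h2⟩ | ⟨u, h1, rfl, rfl⟩)
          · exact ⟨Or.inl h1, h2⟩
          · exact ⟨Or.inr rfl, h1⟩
        · rintro ⟨h1 | rfl, h2⟩
          · exact Or.inl ⟨h1, h2⟩
          · exact Or.inr ⟨c, h2, rfl, rfl⟩
      · simpa [a₅.reg 6 rfl] using c₄
      · simpa [a₅.mem 3 rfl] using z₄
      · rw [hZ']
        split_ifs
        · exact hp.nz_nodup
        · exact hp.nz_nodup.append (List.nodup_singleton v) (by simpa using hvZ)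
      · intro u
        rw [hZ', hlt]
        split_ifs with hl
        · rw [hp.mem_nz]
          refine ⟨fun h => ⟨Or.inl h.1, h.2⟩, ?_⟩
          rintro ⟨h | rfl, h'⟩
          · exact ⟨h, h'⟩
          · exact absurd hl (hlne.2 h')
        · rw [List.mem_append, hp.mem_nz, List.mem_singleton]
          constructor
          · rintro (h | rfl)
            · exact ⟨Or.inl h.1, h.2⟩
            · exact ⟨Or.inr rfl, hlne.1 hl⟩
          · rintro ⟨h | h, h'⟩
            · exact Or.inl ⟨h, h'⟩
            · exact Or.inr h
      -- A vertex enters `Z` only together with at least one arc. This yields `h ≤ M`, on which the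
      -- time bound depends for sparse graphs.
      · have := hp.le
        rw [hZ', List.length_append, List.length_map]
        split_ifs with hl
        · omega
        · have := List.length_pos_iff.2 hl
          simp only [List.length_append, List.length_singleton]
          omega
    · rintro s₁ ha h10 ⟨hr₁, hp⟩
      refine ⟨?_, ?_, ?_, hp⟩
      · rw [ha.reg 1 rfl]; simpa using hn
      · rw [ha.reg 3 rfl]; simpa using hK
      · rwa [List.drop_eq_nil_of_le (by simp), List.flatMap_nil, List.nil_append] at hr₁
  · rintro s₁ - ⟨h1, h3, hr₁, A, Z, hp⟩
    have hAM : A.length = M := by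
      rw [length_eq_ncard_of_nodup hp.arcs_nodup (S := {p | G.Adj p.1 p.2}) (by simp [hp.mem_arcs]),
        hM]
    refine Run.line rfl (by decide) ⟨by simpa [Program.result] using hr₁, Z.length,
      by simpa using hp.nz_nodup.length_le_card, by rw [← hAM]; exact hp.le, ?_⟩
    refine ⟨by simpa [Program.result] using h1, by simpa [Program.result] using h3,
      by simpa [Program.result, Expr.eval, ← hAM] using hp.arcs.count,
      by simpa [Program.result] using hp.count, ?_,
      listsNonisolated_of_reads hp.nz hp.nz_nodup (by simp [hp.mem_nz])⟩
    have := hp.arcs.listsArcs (G := G) hp.arcs_nodup (by simp [hp.mem_arcs])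
    rwa [hAM] at this

end Graph

/-! ### Total running time. -/

section Solve

variable {n : ℕ} {G : SimpleGraph (Fin n)} {M k : ℕ}

/-- The monomials are compared with `n * M * Q`: terms in `h * n` use `h ≤ M`, terms in `h * M` use
`h ≤ n`, and smaller ones use that `n`, `M` and `Q` are positive. -/
lemma solve_cost_le {n M Q h : ℕ} (hn : 1 ≤ n) (hM : 1 ≤ M) (hQ : 1 ≤ Q) (h1 : h ≤ n)
    (h2 : h ≤ M) :
    n * (23 * M + 50) + 12 + 2 + (Q * (cliqueCost n M h + 8) + 6) + (11 * n + 6) +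
      (n * (48 * M + 14) + 6) + (h * (100 * n + 50) + 6) +
      (28 * ((n + 1) * (Q * h)) + (20 * n + 40) * (Q * h) + 14 * n + 40) + (50 * h + 20) ≤
    2000 * (n * M * Q) := by
  have a1 : n * M ≤ n * M * Q := Nat.le_mul_of_pos_right _ hQ
  have a2 : n ≤ n * M := Nat.le_mul_of_pos_right _ hM
  have a3 : h * n ≤ n * M := by rw [Nat.mul_comm n M]; exact Nat.mul_le_mul_right n h2
  have a4 : h * M ≤ n * M := Nat.mul_le_mul_right M h1
  have a5 : M ≤ n * M := Nat.le_mul_of_pos_left _ hn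
  have b1 : Q * (h * n) ≤ n * M * Q := by rw [Nat.mul_comm]; exact Nat.mul_le_mul_right Q a3
  have b2 : Q * (h * M) ≤ n * M * Q := by rw [Nat.mul_comm]; exact Nat.mul_le_mul_right Q a4
  have b3 : Q * n ≤ n * M * Q := by rw [Nat.mul_comm]; exact Nat.mul_le_mul_right Q a2
  have b4 : Q * M ≤ n * M * Q := by rw [Nat.mul_comm]; exact Nat.mul_le_mul_right Q a5
  have b5 : Q * (n * M) = n * M * Q := Nat.mul_comm _ _
  have b6 : Q * h ≤ Q * n := Nat.mul_le_mul_left Q h1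
  have b7 : Q ≤ Q * n := Nat.le_mul_of_pos_right _ hn
  have e1 : Q * (cliqueCost n M h + 8) = 55 * (Q * n) + 48 * (Q * M) + 48 * (Q * (n * M)) +
      300 * (Q * (h * n)) + 120 * (Q * (h * M)) + 158 * (Q * h) + 68 * Q := by
    rw [cliqueCost]; ring
  have e2 : 28 * ((n + 1) * (Q * h)) + (20 * n + 40) * (Q * h) =
      48 * (Q * (h * n)) + 68 * (Q * h) := by ring
  have e3 : n * (23 * M + 50) = 23 * (n * M) + 50 * n := by ring
  have e4 : n * (48 * M + 14) = 48 * (n * M) + 14 * n := by ring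
  have e5 : h * (100 * n + 50) = 100 * (h * n) + 50 * h := by ring
  rw [e1, e2, e3, e4, e5]
  omega

lemma run_solve {s : State} {adj : Fin n → List (Fin n)} {L : List (List (Fin n))} {a c : Fin n}
    (hac : G.Adj a c) (hadj : ∀ v, (adj v).Nodup ∧ ∀ u, u ∈ adj v ↔ G.Adj v u)
    (hM : {p : Fin n × Fin n | G.Adj p.1 p.2}.ncard = M) (hL : ∀ l ∈ L, l.Nodup)
    (hP : Covers G (2 * k) (cliqueSets L)) (hL0 : L ≠ []) (hn : s.reg 1 = n)
    (h2 : s.reg 2 = L.length) (hK : s.reg 3 = 2 * k + 1) (h6 : s.reg 6 = 0) (h7 : s.reg 7 = 0)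
    (h23 : s.reg 23 = 0) (h5 : ∀ i, s.mem 5 i = 0) (h13 : ∀ i, s.mem 13 i = 0)
    (hr : Reads (s.mem 0) 4 ((List.ofFn adj).flatMap encodeList ++ L.flatMap encodeList)) :
    Run Program.solve s (2000 * (n * M * L.length)) fun s' =>
      (IsYesInstance G k → s'.reg 0 = 1) ∧ (¬ IsYesInstance G k → s'.reg 0 = 0) := by
  have hn1 : 1 ≤ n := Nat.one_le_of_lt a.2
  have hM1 : 1 ≤ M := by
    rw [← hM]
    exact (Set.ncard_pos (Set.toFinite _)).2 ⟨(a, c), hac⟩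
  have hcost : ∀ h, h ≤ n → h ≤ M → _ := fun h =>
    solve_cost_le hn1 hM1 (List.length_pos_iff.2 hL0) (h := h)
  -- The time for reading the graph has to be split off before `h` is known, so the cost bound is
  -- used with `h = 0`.
  have hX : n * (23 * M + 50) + 12 ≤ 2000 * (n * M * L.length) := by
    have := hcost 0 (by omega) (by omega)
    omega
  set X := 2000 * (n * M * L.length) with hXdef
  refine Run.seq (run_readGraph hadj hM hn hK h6 h7 hr) ?_ (B₂ := X - (n * (23 * M + 50) + 12))
    (by omega)
  rintro s₁ a₁ ⟨r₁, h, hhn, hhM, g₁⟩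
  have hc := hcost h hhn hhM
  set x₁ := n * (23 * M + 50) + 12
  set x₂ := L.length * (cliqueCost n M h + 8) + 6
  set x₃ := n * (48 * M + 14) + 6
  set x₄ := h * (100 * n + 50) + 6
  set x₅ := 28 * ((n + 1) * (L.length * h)) + (20 * n + 40) * (L.length * h) + 14 * n + 40
  refine Run.seq (B₁ := 2) (Q := fun s' => s' = s₁.setReg 8 1) (Run.line rfl le_rfl rfl) ?_
    (B₂ := X - x₁ - 2) (by omega)
  rintro s₂ a₂ q₂
  have g₂ := g₁.agree a₂ rfl
  have t₂ : IsTrie (s₂.mem 5) (s₂.reg 8) := by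
    have m5 : ∀ i, s₂.mem 5 i = 0 := fun i => by rw [a₂.mem 5 rfl, a₁.mem 5 rfl, h5]
    exact ⟨fun i _ => m5 i, fun i hi => absurd (m5 i) hi, fun i _ hi => absurd (m5 i) hi,
      by simp [q₂]⟩
  refine Run.seq (run_cliques g₂ t₂ (by rw [a₂.reg 23 rfl, a₁.reg 23 rfl, h23])
    (by rw [a₂.reg 2 rfl, a₁.reg 2 rfl, h2])
    (by rw [a₂.mem 0 rfl, a₂.reg 5 rfl]; exact r₁) hL) ?_ (B₂ := X - x₁ - 2 - x₂) (by omega)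
  rintro s₃ a₃ ⟨t₃, T₃, p₃⟩
  have g₃ := g₂.agree a₃ rfl
  refine Run.seq (run_initLabels g₃.vertices) ?_ (B₂ := X - x₁ - 2 - x₂ - (11 * n + 6)) (by omega)
  rintro s₄ a₄ l₄
  have g₄ := g₃.agree a₄ rfl
  refine Run.seq (run_labels (Ω := ∅) g₄ (partialLabels_zero fun x => ⟨by simp, fun _ =>
    l₄ x x.2⟩)) ?_ (B₂ := X - x₁ - 2 - x₂ - (11 * n + 6) - x₃) (by omega)
  rintro s₅ a₅ l₅
  have g₅ := g₄.agree a₅ rfl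
  have e5 : s₅.mem 5 = s₃.mem 5 := by rw [a₅.mem 5 rfl, a₄.mem 5 rfl]
  have e8 : s₅.reg 8 = s₃.reg 8 := by rw [a₅.reg 8 rfl, a₄.reg 8 rfl]
  refine Run.seq (run_internComponents g₅ (by rw [e5, e8]; exact t₃)) ?_ (B₂ := x₅ + (50 * h + 20))
    (by omega)
  rintro s₆ a₆ ⟨t₆, u₆, d₆⟩
  rw [e5] at u₆
  have g₆ := g₅.agree a₆ rfl
  have T₆ : s₆.reg 23 = s₃.reg 23 := by rw [a₆.reg 23 rfl, a₅.reg 23 rfl, a₄.reg 23 rfl]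
  have p₆ := p₃.keep t₃ (Keeps.of_mem (s' := s₆) u₆ (by rw [a₆.mem 9 rfl, a₅.mem 9 rfl, a₄.mem 9 rfl])
    (by rw [a₆.mem 10 rfl, a₅.mem 10 rfl, a₄.mem 10 rfl])
    (by rw [a₆.mem 11 rfl, a₅.mem 11 rfl, a₄.mem 11 rfl])
    (by rw [a₆.mem 12 rfl, a₅.mem 12 rfl, a₄.mem 12 rfl])) T₆
  refine Run.seq (run_fillTable hac g₆.vertices g₆.param p₆ (T₆.trans T₃) hP t₆ fun i => ?_) ?_
    (B₂ := 50 * h + 20) (by omega)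
  · rw [a₆.mem 13 rfl, a₅.mem 13 rfl, a₄.mem 13 rfl, a₃.mem 13 rfl, a₂.mem 13 rfl, a₁.mem 13 rfl,
      h13]
  rintro s₇ a₇ c₇
  have m5 : s₇.mem 5 = s₆.mem 5 := a₇.mem 5 rfl
  have m4 : s₇.mem 4 = s₆.mem 4 := a₇.mem 4 rfl
  refine run_answer (g₆.agree a₇ rfl) ?_ ?_ c₇
  · rw [m4, a₆.mem 4 rfl]; exact l₅
  · exact d₆.keep t₆ (by rw [m5]; exact fun _ _ => rfl) m4 (a₇.mem 6 rfl)

end Solve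

/-! ### Vital cliques and degenerate instances. -/

section Main

variable {n : ℕ} {G : SimpleGraph (Fin n)} {k : ℕ}

lemma covers_cliqueSets {L : List (List (Fin n))}
    (hL : ∀ Ω : Finset (Fin n), Ω ∈ vitalPMCs G k ↔ Ω ∈ L.map List.toFinset) :
    Covers G (2 * k) (cliqueSets L) := by
  classical
  constructor
  · rintro _ ⟨l, hl, rfl⟩
    obtain ⟨H, hH, hmax⟩ := ((hL l.toFinset).2 (List.mem_map_of_mem hl)).1
    exact ⟨H, hH, by simpa using hmax⟩
  · intro H hH hb Ω hΩ
    have hΩ' : Maximal H.IsClique (Ω.toFinset : Set (Fin n)) := by simpa using hΩ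
    obtain ⟨l, hl, he⟩ := List.mem_map.1 ((hL _).1 (isVital_of_fillOn_le hH hb hΩ'))
    refine ⟨l, hl, ?_⟩
    rw [← Set.coe_toFinset Ω, ← he]
    simp

lemma isYesInstance_bot : IsYesInstance (⊥ : SimpleGraph (Fin n)) k := by
  refine ⟨∅, by simp, by simp, ?_⟩
  rintro l hl ⟨f⟩
  obtain ⟨l, rfl⟩ : ∃ l', l = l' + 2 := ⟨l - 2, by omega⟩
  have h01 : (cycleGraph (l + 2)).Adj 0 1 := by
    rw [cycleGraph_adj]
    simp
  have := f.map_rel_iff.2 h01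
  simp at this

/-- Any triangulation has a maximal clique, possibly the empty set if there are no vertices. This
justifies the negative answer for an empty list. -/
lemma IsYesInstance.vitalPMCs_nonempty (h : IsYesInstance G k) : (vitalPMCs G k).Nonempty := by
  classical
  obtain ⟨H, hH, hb⟩ := h.exists_triangulation
  obtain ⟨Ω, -, hΩ⟩ := (Set.toFinite {A : Set (Fin n) | H.IsClique A}).exists_le_maximal
    (a := ∅) (by simp)
  exact ⟨Ω.toFinset, isVital_of_fillOn_le hH hb (by simpa using hΩ)⟩

end Main

/-! ### Execution with bounded words. -/

section Main

/-- The three assignments before the tests take 3, 3 and 8 steps. -/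
lemma exec_main {W : ℕ} {s s' : State} {t a₀ a₂ a₃ : ℕ} (h0 : s.mem 0 0 = a₀) (h2 : s.mem 0 2 = a₂) (h3 : s.mem 0 3 = a₃) (hW : 4 < W) (h0W : a₀ < W)
    (h2W : 2 * a₂ + 1 < W) (h3W : a₃ < W)
    (h : Exec W (.ite (.load 0 (.lit 1)) (.ite (.reg 2) Program.solve (.set 0 (.lit 0)))
      (.set 0 (.lit 1))) (((s.setReg 1 a₀).setReg 2 a₃).setReg 3 (2 * a₂ + 1)) t s') :
    Exec W Program.main s (t + 14) s' := by
  have e0 := Exec.set (W := W) s 1 (.load 0 (.lit 0))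
    ⟨show 0 < W by omega, show s.mem 0 0 < W by omega⟩
  have e1 := Exec.set (W := W) (s.setReg 1 a₀) 2 (.load 0 (.lit 3))
    ⟨show 3 < W by omega, show s.mem 0 3 < W by omega⟩
  have f2 : (Expr.load 0 (.lit 2)).Fits W ((s.setReg 1 a₀).setReg 2 a₃) :=
    ⟨show 2 < W by omega, show s.mem 0 2 < W by omega⟩
  have e2 := Exec.set (W := W) ((s.setReg 1 a₀).setReg 2 a₃) 3
    (.add (.add (.load 0 (.lit 2)) (.load 0 (.lit 2))) (.lit 1))
    ⟨⟨f2, f2, show s.mem 0 2 + s.mem 0 2 < W by omega⟩, show 1 < W by omega,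
      show s.mem 0 2 + s.mem 0 2 + 1 < W by omega⟩
  simp only [Expr.eval, Expr.cost, State.setReg_mem, h0, h3, h2] at e0 e1 e2
  rw [show a₂ + a₂ = 2 * a₂ by omega] at e2
  have := Exec.seq _ _ _ _ _ _ _ e0 (Exec.seq _ _ _ _ _ _ _ e1 (Exec.seq _ _ _ _ _ _ _ e2 h))
  convert this using 1
  · rfl
  · omega

variable {n : ℕ} {G : SimpleGraph (Fin n)} {k : ℕ}

/-- A bound for the numbers in the input. -/
lemma allLe_initState {w : List ℕ} {B : ℕ} (h : ∀ x ∈ w, x ≤ B) : (initState w).AllLe B := by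
  refine ⟨fun _ => Nat.zero_le _, fun a i => ?_⟩
  simp only [initState]
  split_ifs
  · rw [List.getD_eq_getElem?_getD]
    by_cases hi : i < w.length
    · rw [List.getElem?_eq_getElem hi]
      exact h _ (List.getElem_mem hi)
    · simp [List.getElem?_eq_none (Nat.not_lt.1 hi)]
  · exact Nat.zero_le _

lemma le_of_mem_encodeList {l : List (Fin n)} (hl : l.Nodup) {x : ℕ} (hx : x ∈ encodeList l) :
    x ≤ n := by
  rw [encodeList_eq, List.mem_cons] at hx
  rcases hx with rfl | hx
  · simpa using hl.length_le_card
  · obtain ⟨v, -, rfl⟩ := List.mem_map.1 hx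
    exact v.2.le

lemma two_mul_edges_le : 2 * G.edgeSet.ncard ≤ n * n := by
  rw [← ncard_adj_pairs]
  refine (Set.ncard_le_ncard (Set.subset_univ _)).trans ?_
  simp [Set.ncard_univ]

/-- With `N = n + k + Q + 1`, initial values and time together are at most `2 ^ 12 * N ^ 4`; the
power 30 explains both lower bounds on `d`. -/
lemma word_bound {n m k Q t d : ℕ} (hm : 2 * m ≤ n * n) (ht : t ≤ 2000 * (n * (2 * m) * Q))
    (hd : (2 ^ 12) ^ 30 < d) (hd' : 120 ≤ d) :
    (n + m + 2 * k + Q + 5 + t) ^ 30 < d * (n + k + Q + 1) ^ d := by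
  obtain ⟨N, hN⟩ : ∃ N, N = n + k + Q + 1 := ⟨_, rfl⟩
  rw [← hN]
  have hN1 : 1 ≤ N := by omega
  have h1 : n * n ≤ N ^ 4 := by
    calc n * n ≤ N * N := Nat.mul_le_mul (by omega) (by omega)
      _ = N ^ 2 := (sq N).symm
      _ ≤ N ^ 4 := Nat.pow_le_pow_right hN1 (by norm_num)
  have h2 : N ≤ N ^ 4 := Nat.le_self_pow (by norm_num) N
  have h3 : n * (2 * m) * Q ≤ N ^ 4 := by
    calc n * (2 * m) * Q ≤ N * (N * N) * N :=
          Nat.mul_le_mul (Nat.mul_le_mul (by omega) (hm.trans (Nat.mul_le_mul (by omega)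
            (by omega)))) (by omega)
      _ = N ^ 4 := by ring
  have h4 : n + m + 2 * k + Q + 5 + t ≤ 2 ^ 12 * N ^ 4 := by omega
  calc (n + m + 2 * k + Q + 5 + t) ^ 30 ≤ (2 ^ 12 * N ^ 4) ^ 30 := Nat.pow_le_pow_left h4 30
    _ = (2 ^ 12) ^ 30 * N ^ 120 := by rw [mul_pow, ← pow_mul N]
    _ < d * N ^ 120 := Nat.mul_lt_mul_of_pos_right hd (Nat.pow_pos hN1)
    _ ≤ d * N ^ d := Nat.mul_le_mul_left d (Nat.pow_le_pow_right hN1 hd')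

lemma exists_exec_main {w : List ℕ} (hw : Encodes G k (vitalPMCs G k) w) {d : ℕ}
    (hd : (2 ^ 12) ^ 30 < d) (hd' : 120 ≤ d) :
    ∃ t s, Exec (d * (n + k + (vitalPMCs G k).ncard + 1) ^ d) Program.main (initState w) t s ∧
      t ≤ 5000 * (n * G.edgeSet.ncard * (vitalPMCs G k).ncard + 1) ∧
      (IsYesInstance G k → s.reg 0 = 1) ∧ (¬ IsYesInstance G k → s.reg 0 = 0) := by
  obtain ⟨adj, L, hadj, hL, hLn, hLF, rfl⟩ := hw
  set m := G.edgeSet.ncard with hm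
  set Q := (vitalPMCs G k).ncard with hQ
  have hQL : L.length = Q := by
    rw [← List.length_map (f := List.toFinset) (as := L)]
    exact length_eq_ncard_of_nodup hLn fun Ω => (hLF Ω).symm
  have hm2 : 2 * m ≤ n * n := two_mul_edges_le
  set w := [n, m, k, Q] ++ (List.ofFn adj).flatMap encodeList ++ L.flatMap encodeList with hw
  set W := d * (n + k + Q + 1) ^ d with hW
  have hword : ∀ t ≤ 2000 * (n * (2 * m) * Q), (n + m + 2 * k + Q + 5 + t) ^ 30 < W :=
    fun t ht => word_bound hm2 ht hd hd'
  have hBW : n + m + 2 * k + Q + 5 < W :=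
    (Nat.le_self_pow (by norm_num) _).trans_lt (hword 0 (Nat.zero_le _))
  have hall : (initState w).AllLe (n + m + 2 * k + Q + 5) := by
    refine allLe_initState fun x hx => ?_
    simp only [hw, List.mem_append, List.mem_cons, List.not_mem_nil, or_false, List.mem_flatMap,
      List.mem_ofFn] at hx
    rcases hx with ((rfl | rfl | rfl | rfl) | ⟨_, ⟨v, rfl⟩, hx⟩) | ⟨l, hl, hx⟩
    · omega
    · omega
    · omega
    · omega
    · have := le_of_mem_encodeList (hadj v).1 hx; omega
    · have := le_of_mem_encodeList (hL l hl) hx; omega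
  set s₀ := (((initState w).setReg 1 n).setReg 2 Q).setReg 3 (2 * k + 1) with hs₀
  have hall₀ : s₀.AllLe (n + m + 2 * k + Q + 5) :=
    ((hall.setReg (by omega)).setReg (by omega)).setReg (by omega)
  have hmain : ∀ {t s'}, Exec W (.ite (.load 0 (.lit 1)) (.ite (.reg 2) Program.solve
      (.set 0 (.lit 0))) (.set 0 (.lit 1))) s₀ t s' →
        Exec W Program.main (initState w) (t + 14) s' :=
    fun h => exec_main (a₀ := n) (a₂ := k) (a₃ := Q) rfl rfl rfl (by omega) (by omega) (by omega) (by omega) h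
  have hm0 : (Expr.load 0 (.lit 1)).eval s₀ = m := rfl
  have hfm : (Expr.load 0 (.lit 1)).Fits W s₀ := ⟨show 1 < W by omega, show m < W by omega⟩
  have hfQ : (Expr.reg 2).Fits W s₀ := show Q < W by omega
  -- If `m` or `Q` is zero, the time bound is a constant, so the answer has to be given without
  -- reading the lists.
  by_cases hmz : m = 0
  · have hG : G = ⊥ := by
      rw [hm, Set.ncard_eq_zero (Set.toFinite _)] at hmz
      exact edgeSet_eq_empty.1 hmz
    refine ⟨_, _, hmain (Exec.ite_false _ _ _ _ _ _ hfm (hm0.trans hmz)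
      (Exec.set _ _ _ (show 1 < W by omega))), ?_, ?_, ?_⟩
    · simp only [Expr.cost]; omega
    · intro _; rfl
    · intro h
      exact absurd (by rw [hG]; exact isYesInstance_bot) h
  have hmz' : (Expr.load 0 (.lit 1)).eval s₀ ≠ 0 := by rwa [hm0]
  by_cases hQz : Q = 0
  · refine ⟨_, _, hmain (Exec.ite_true _ _ _ _ _ _ hfm hmz'
      (Exec.ite_false _ _ _ _ _ _ hfQ hQz (Exec.set _ _ _ (show 0 < W by omega)))), ?_, ?_, ?_⟩
    · simp only [Expr.cost]; omega
    · intro h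
      have := h.vitalPMCs_nonempty
      rw [hQ, Set.ncard_eq_zero (Set.toFinite _)] at hQz
      rw [hQz] at this
      exact absurd this Set.not_nonempty_empty
    · intro _; rfl
  obtain ⟨a, c, hac⟩ : ∃ a c, G.Adj a c := by
    by_contra hc
    push Not at hc
    refine hmz ?_
    rw [hm, Set.ncard_eq_zero (Set.toFinite _), edgeSet_eq_empty]
    exact SimpleGraph.ext (by ext a c; simpa using hc a c)
  have hL0 : L ≠ [] := by
    rintro rfl
    exact hQz hQL.symm
  have hreads : Reads (s₀.mem 0) 4
      ((List.ofFn adj).flatMap encodeList ++ L.flatMap encodeList) := by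
    intro i hi
    have hi' : 4 + i < w.length := by
      rw [hw, List.append_assoc, List.length_append]
      exact Nat.add_lt_add_left hi 4
    have : s₀.mem 0 (4 + i) = w.getD (4 + i) 0 := rfl
    rw [this, List.getD_eq_getElem _ _ hi']
    simp only [hw, List.append_assoc]
    rw [List.getElem_append_right (by simp)]
    congr 1
    simp
  obtain ⟨t, s', hst, ht, hres⟩ := run_solve (s := s₀) (k := k) hac hadj (ncard_adj_pairs G) hL
    (covers_cliqueSets hLF) hL0 rfl hQL.symm rfl rfl rfl rfl (fun _ => rfl) (fun _ => rfl) hreads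
  rw [hQL, ← hm] at ht
  obtain ⟨hex, -⟩ := hst.exec Program.tame_solve (by omega) hall₀ (hword t ht)
  refine ⟨_, s', hmain (Exec.ite_true _ _ _ _ _ _ hfm hmz'
    (Exec.ite_true _ _ _ _ _ _ hfQ hQz hex)), ?_, hres⟩
  -- There are `2 * m` arcs, so the constant 2000 doubles; the rest of 5000 covers the prologue and
  -- the two tests.
  have : n * (2 * m) * Q = 2 * (n * m * Q) := by ring
  simp only [Expr.cost]
  omega

end Main

end MinFill

theorem mainTheorem7 :
    ∃ (P : MinFill.Program) (c d : ℕ),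
      ∀ (n : ℕ) (G : SimpleGraph (Fin n)) (k : ℕ) (w : List ℕ),
        MinFill.Encodes G k (MinFill.vitalPMCs G k) w →
        ∃ (t : ℕ) (s : MinFill.State),
          MinFill.Exec (d * (n + k + (MinFill.vitalPMCs G k).ncard + 1) ^ d)
            P (MinFill.initState w) t s ∧
          t ≤ c * (n * G.edgeSet.ncard * (MinFill.vitalPMCs G k).ncard + 1) ∧
          (MinFill.IsYesInstance G k → s.reg 0 = 1) ∧
          (¬ MinFill.IsYesInstance G k → s.reg 0 = 0) := by
  -- Only these two inequalities about `d` are kept, which hides the huge numeral from later steps.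
  obtain ⟨d, hd, hd'⟩ : ∃ d, (2 ^ 12) ^ 30 < d ∧ 120 ≤ d :=
    ⟨(2 ^ 12) ^ 30 + 120, Nat.lt_add_of_pos_right (by norm_num), Nat.le_add_left _ _⟩
  exact ⟨MinFill.Program.main, 5000, d, fun n G k w hw => MinFill.exists_exec_main hw hd hd'⟩
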